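/- Consider the $2\pi$-periodic Kawahara problem $u_t+uu_x+u_{xxx}=u_{xxxxx}$, $u(\cdot,0)=u_0$, with real-valued $u_0$. Let $(f,g)=\int_{-\pi}^{\pi}f\bar g\,dx$, $\|f\|=(f,f)^{1/2}$, let $\hat f(k)=\frac1{2\pi}\int_{-\pi}^{\pi}e^{-ikx}f(x)\,dx$, and let $H^r$ be the space of $2\pi$-periodic $L^2$ functions with $\|f\|_r^2=\sum_{k\in\mathbb Z}(1+k^2)^r|\hat f(k)|^2<\infty$. For an integer $N\ge1$ let $S_N=\operatorname{span}\{e^{ikx}:-N\le k\le N\}$ and let $P_N$ be the $L^2$-orthogonal projection onto $S_N$. The semi-discrete solution is the map $U$ from $[0,\infty)$ to the real-valued elements of $S_N$ with $U(0)=P_Nu_0$ and $$(U_t+UU_x+U_{xxx}-U_{xxxxx},\phi)=0\qquad\text{for all }\phi\in S_N,\ t\ge0.$$ Given $\Delta t>0$ and an integer $M$, put $t_m=m\Delta t$. A Crank–Nicolson solution is a sequence $U^0,\dots,U^M$ of real-valued elements of $S_N$ such that, with $U^{m+1/2}=\frac12(U^m+U^{m+1})$, $$(U^{m+1}-U^m,\phi)+\Delta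 t\,\bigl(U^{m+1/2}U^{m+1/2}_x+U^{m+1/2}_{xxx}-U^{m+1/2}_{xxxxx},\phi\bigr)=0\qquad\text{for all }\phi\in S_N,\ 0\le m<M.$$ **Theorem.** (a) Every Crank–Nicolson solution satisfies $\|U^m\|=\|U^0\|$ for $0\le m\le M$. (b) Let $r\ge16$ be an integer, $u_0\in H^r$ real-valued, and $0<T<\infty$. Then there are constants $C_1>0$ and $C>0$, independent of $N$, $\Delta t$ and $M$, such that whenever $N\ge1$, $\Delta t>0$, $M\Delta t=T$ and $N\Delta t\le C_1$, the semi-discrete solution $U$ and every Crank–Nicolson solution $(U^m)$ with $U^0=U(0)$ satisfy $$\max_{0\le m\le M}\|U^m-U(t_m)\|\le C\,\Delta t^2,$$ and, if $u\in C([0,\infty);H^r)$ is the (classical) solution of the Kawahara problem with initial value $u_0$, also $$\max_{0\le m\le M}\|u(t_m)-U^m\|\le C\,(N^{-r}+\Delta t^2).$$ -/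

import Mathlib

open MeasureTheory Filter Topology

noncomputable section

namespace Kawahara

/-- The `L²` inner product `(f, g) = ∫_{-π}^{π} f(x) conj(g(x)) dx`. -/
def l2Inner (f g : ℝ → ℂ) : ℂ :=
  ∫ x in (-Real.pi)..Real.pi, f x * starRingEnd ℂ (g x)

/-- The `L²` norm over one period of a real-valued function. -/
def l2Norm (f : ℝ → ℝ) : ℝ :=
  Real.sqrt (∫ x in (-Real.pi)..Real.pi, (f x) ^ 2)

/-- The Fourier coefficient `(1 / 2π) ∫_{-π}^{π} e^{-ikx} f(x) dx`. -/
def fourierHat (f : ℝ → ℝ) (k : ℤ) : ℂ :=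
  fourierCoeffOn (neg_lt_self Real.pi_pos) (fun x => (f x : ℂ)) k

/-- The Sobolev norm `(∑ₖ (1 + k²)^r |f̂(k)|²)^{1/2}` (used only on members of `H^r`). -/
def sobolevNorm (r : ℕ) (f : ℝ → ℝ) : ℝ :=
  Real.sqrt (∑' k : ℤ, (1 + (k : ℝ) ^ 2) ^ r * ‖fourierHat f k‖ ^ 2)

/-- `f` is a real-valued member of the `2π`-periodic Sobolev space `H^r`. -/
structure MemH (r : ℕ) (f : ℝ → ℝ) : Prop where
  periodic : Function.Periodic f (2 * Real.pi)
  memL2 : MemLp f 2 (volume.restrict (Set.Icc (-Real.pi) Real.pi))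
  summable : Summable fun k : ℤ => (1 + (k : ℝ) ^ 2) ^ r * ‖fourierHat f k‖ ^ 2

/-- `S_N`, the complex span of the functions `x ↦ e^{ikx}` with `-N ≤ k ≤ N`. -/
def SN (N : ℕ) : Submodule ℂ (ℝ → ℂ) :=
  Submodule.span ℂ
    ((fun (k : ℤ) (x : ℝ) => Complex.exp (Complex.I * (k : ℂ) * (x : ℂ))) ''
      Set.Icc (-(N : ℤ)) (N : ℤ))

/-- `f` is a real-valued element of `S_N`. -/
def MemRealSN (N : ℕ) (f : ℝ → ℝ) : Prop :=
  (fun x => (f x : ℂ)) ∈ SN N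

/-- `g = P_N f`, with `P_N` the `L²`-orthogonal projection onto `S_N`. -/
def IsProj (N : ℕ) (f g : ℝ → ℝ) : Prop :=
  MemRealSN N g ∧ ∀ φ ∈ SN N, l2Inner (fun x => ((f x - g x : ℝ) : ℂ)) φ = 0

/-- The spatial part `w w_x + w_xxx - w_xxxxx` of the Kawahara equation. -/
def spatialPart (w : ℝ → ℝ) (x : ℝ) : ℝ :=
  w x * deriv w x + iteratedDeriv 3 w x - iteratedDeriv 5 w x

/-- `u t x` is the solution, in `C([0, ∞); H^r)`, of the `2π`-periodic problem
`u_t + u u_x + u_xxx = u_xxxxx`, `u(·, 0) = u₀`. -/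
structure IsSolution (r : ℕ) (u₀ : ℝ → ℝ) (u : ℝ → ℝ → ℝ) : Prop where
  memH : ∀ t, 0 ≤ t → MemH r (u t)
  continuous : ∀ t, 0 ≤ t →
    Tendsto (fun s => sobolevNorm r (fun x => u s x - u t x)) (𝓝[Set.Ici 0] t) (𝓝 0)
  contDiff : ∀ t, 0 ≤ t → ContDiff ℝ 5 (u t)
  equation : ∀ t, 0 ≤ t → ∀ x,
    HasDerivWithinAt (fun s => u s x) (-spatialPart (u t) x) (Set.Ici 0) t
  initial : u 0 =ᵐ[volume] u₀

/-- `U` is the Fourier-Galerkin semi-discretization: a map from `[0, ∞)` to the real-valued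
elements of `S_N` with `(U_t + U U_x + U_xxx - U_xxxxx, φ) = 0` for all `φ ∈ S_N` and all
`t ≥ 0`, and `U(0) = P_N u₀`. -/
structure IsSemiDiscrete (N : ℕ) (u₀ : ℝ → ℝ) (U : ℝ → ℝ → ℝ) : Prop where
  mem : ∀ t, 0 ≤ t → MemRealSN N (U t)
  equation : ∀ t, 0 ≤ t → ∃ Ut : ℝ → ℝ,
    (∀ x, HasDerivWithinAt (fun s => U s x) (Ut x) (Set.Ici 0) t) ∧
    ∀ φ ∈ SN N, l2Inner (fun x => ((Ut x + spatialPart (U t) x : ℝ) : ℂ)) φ = 0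
  initial : IsProj N u₀ (U 0)

/-- The average `(v + w) / 2`. -/
def halfSum (v w : ℝ → ℝ) : ℝ → ℝ := fun x => (v x + w x) / 2

/-- `V 0, …, V M` are real-valued elements of `S_N` satisfying the Crank-Nicolson scheme with
time step `τ`: for `0 ≤ m < M`, with `W = (V^m + V^{m+1}) / 2`,
`(V^{m+1} - V^m, φ) + τ (W W_x + W_xxx - W_xxxxx, φ) = 0` for all `φ ∈ S_N`. -/
structure IsCrankNicolson (N : ℕ) (τ : ℝ) (M : ℕ) (V : ℕ → ℝ → ℝ) : Prop where
  mem : ∀ m, m ≤ M → MemRealSN N (V m)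
  step : ∀ m, m < M → ∀ φ ∈ SN N,
    l2Inner (fun x => ((V (m + 1) x - V m x : ℝ) : ℂ)) φ
      + (τ : ℂ) * l2Inner
          (fun x => ((spatialPart (halfSum (V m) (V (m + 1))) x : ℝ) : ℂ)) φ = 0

end Kawahara

end

/-! Everything happens on Fourier coefficients. On `SN N` the equation is the finite system `a_k' =
disp k * a_k + bil N a a k`. The energy arguments rest on two facts: an odd multiplier is skew for
the pairing (`pairing_odd_eq_zero`), and the symbol of a trilinear form on `j + n + m = 0` may be
symmetrised in slots that hold the same sequence. In particular the vector field is orthogonal to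
the state (`pairing_galD₁_self`); testing the scheme with its midpoint then gives (a).

The `Δt²` bound is consistency plus stability. Consistency needs three time derivatives of the
semi-discrete solution, bounded uniformly in `N`. Each costs five space derivatives, so fifteen are
needed in weighted `ℓ¹`, and `H^16` controls those. The bound is `exists_wnorm_bound`: the Galerkin
flow conserves mass and Hamiltonian, which control `H²` and hence `wnorm N 1`; the commutator
estimate `norm_trilin_pow_le` and Gronwall then propagate `H^16`. Stability is `cn_error_step`: the
self-interaction of the error drops out, and its interaction with the smooth solution loses no
derivative after symmetrisation.

The `N^{-r}` bound is more delicate. Let `θ` be the error below frequency `N`, `η` the part of `u`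
above it, and `g` the sum of the two solutions. The forcing `-½ ∂ₓ(η g)`, tested against `θ`,
naively costs a factor `N`. But `η` lives outside the box and `θ` inside, so `g` enters at a nonzero
frequency, and the resonance function `disp j + disp n + disp m` equals `i j n m` times a positive
factor; it vanishes only with the factor `m` that the forcing carries too. Subtracting from `‖θ‖²` a
trilinear correction with symbol `nfSymbol` therefore cancels the forcing exactly, and the remainder
gains three derivatives (`modified_energy_deriv_le`, `exists_comparison_bound`). To keep all sums
finite, `u` is replaced by its truncation at `K = N²`, whose residual is `O(N^{-2(r-3)})`, hence
`O(N^{-r})`. The same comparison with `N = K → ∞` yields uniqueness, so the constants can be fixed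
before `u` is given. -/

noncomputable section

namespace Kawahara

/-! ### Algebra of truncated convolutions, pairings and trilinear forms. -/

/-- The frequencies `k` with `|k| ≤ K`. -/
def box (K : ℕ) : Finset ℤ := Finset.Icc (-(K : ℤ)) K

/-- The trilinear form `∑_{j+n+m=0} σ(j,n,m) a_j b_n c_m` over frequencies in the box. -/
def trilin {R : Type*} [CommRing R] (K : ℕ) (σ : ℤ → ℤ → ℤ → R) (a b c : ℤ → R) : R :=
  ∑ j ∈ box K, ∑ n ∈ box K, ∑ m ∈ box K,
    if j + n + m = 0 then σ j n m * (a j * b n * c m) else 0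

/-- The convolution `∑_{j+n=k} a_j b_n` over frequencies in the box. -/
def conv {R : Type*} [CommRing R] (K : ℕ) (a b : ℤ → R) (k : ℤ) : R :=
  ∑ j ∈ box K, ∑ n ∈ box K, if j + n = k then a j * b n else 0

/-- The bilinear pairing `∑ₖ a_k b_{-k}` over frequencies in the box. -/
def pairing {R : Type*} [CommRing R] (K : ℕ) (a b : ℤ → R) : R :=
  ∑ k ∈ box K, a k * b (-k)

lemma mem_box {K : ℕ} {k : ℤ} : k ∈ box K ↔ |k| ≤ K := by
  simp [box, abs_le]

lemma neg_mem_box {K : ℕ} {k : ℤ} : -k ∈ box K ↔ k ∈ box K := by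
  simp [mem_box]

lemma box_mono {N K : ℕ} (h : N ≤ K) : box N ⊆ box K := fun k hk => by
  rw [mem_box] at *; exact hk.trans (by exact_mod_cast h)

lemma sum_box_neg {M : Type*} [AddCommMonoid M] (K : ℕ) (f : ℤ → M) :
    ∑ k ∈ box K, f (-k) = ∑ k ∈ box K, f k :=
  Finset.sum_nbij' (fun k => -k) (fun k => -k) (fun _ h => neg_mem_box.2 h)
    (fun _ h => neg_mem_box.2 h) (fun _ _ => neg_neg _) (fun _ _ => neg_neg _) (fun _ _ => rfl)

section Algebra
variable {R : Type*} [CommRing R] (K : ℕ)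

lemma trilin_congr {σ σ' : ℤ → ℤ → ℤ → R} {a b c a' b' c' : ℤ → R}
    (h : ∀ j ∈ box K, ∀ n ∈ box K, ∀ m ∈ box K, j + n + m = 0 →
      σ j n m * (a j * b n * c m) = σ' j n m * (a' j * b' n * c' m)) :
    trilin K σ a b c = trilin K σ' a' b' c' := by
  refine Finset.sum_congr rfl fun j hj => Finset.sum_congr rfl fun n hn =>
    Finset.sum_congr rfl fun m hm => ?_
  split_ifs with h0
  · exact h j hj n hn m hm h0
  · rfl

lemma trilin_swap₁₂ (σ : ℤ → ℤ → ℤ → R) (a b c : ℤ → R) :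
    trilin K σ a b c = trilin K (fun j n m => σ n j m) b a c := by
  unfold trilin
  rw [Finset.sum_comm]
  refine Finset.sum_congr rfl fun j _ => Finset.sum_congr rfl fun n _ =>
    Finset.sum_congr rfl fun m _ => ?_
  rw [add_comm n j, mul_comm (a n)]

lemma trilin_swap₂₃ (σ : ℤ → ℤ → ℤ → R) (a b c : ℤ → R) :
    trilin K σ a b c = trilin K (fun j n m => σ j m n) a c b := by
  unfold trilin
  refine Finset.sum_congr rfl fun j _ => ?_
  rw [Finset.sum_comm]
  refine Finset.sum_congr rfl fun n _ => Finset.sum_congr rfl fun m _ => ?_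
  rw [add_right_comm, mul_right_comm]

lemma trilin_swap₁₃ (σ : ℤ → ℤ → ℤ → R) (a b c : ℤ → R) :
    trilin K σ a b c = trilin K (fun j n m => σ m n j) c b a := by
  rw [trilin_swap₁₂, trilin_swap₂₃, trilin_swap₁₂]

lemma trilin_add_symbol (σ σ' : ℤ → ℤ → ℤ → R) (a b c : ℤ → R) :
    trilin K (fun j n m => σ j n m + σ' j n m) a b c = trilin K σ a b c + trilin K σ' a b c := by
  simp only [trilin, ← Finset.sum_add_distrib]
  refine Finset.sum_congr rfl fun j _ => Finset.sum_congr rfl fun n _ =>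
    Finset.sum_congr rfl fun m _ => ?_
  split_ifs <;> ring

lemma trilin_smul_symbol (r : R) (σ : ℤ → ℤ → ℤ → R) (a b c : ℤ → R) :
    trilin K (fun j n m => r * σ j n m) a b c = r * trilin K σ a b c := by
  simp only [trilin, Finset.mul_sum]
  refine Finset.sum_congr rfl fun j _ => Finset.sum_congr rfl fun n _ =>
    Finset.sum_congr rfl fun m _ => ?_
  split_ifs <;> ring

lemma trilin_add_left (σ : ℤ → ℤ → ℤ → R) (a a' b c : ℤ → R) :
    trilin K σ (fun k => a k + a' k) b c = trilin K σ a b c + trilin K σ a' b c := by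
  simp only [trilin, ← Finset.sum_add_distrib]
  refine Finset.sum_congr rfl fun j _ => Finset.sum_congr rfl fun n _ =>
    Finset.sum_congr rfl fun m _ => ?_
  split_ifs <;> ring

lemma conv_comm (a b : ℤ → R) (k : ℤ) : conv K a b k = conv K b a k := by
  unfold conv
  rw [Finset.sum_comm]
  refine Finset.sum_congr rfl fun j _ => Finset.sum_congr rfl fun n _ => ?_
  rw [add_comm, mul_comm]

lemma conv_add_left (a a' b : ℤ → R) (k : ℤ) :
    conv K (fun k => a k + a' k) b k = conv K a b k + conv K a' b k := by
  simp only [conv, ← Finset.sum_add_distrib]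
  refine Finset.sum_congr rfl fun j _ => Finset.sum_congr rfl fun n _ => ?_
  split_ifs <;> ring

lemma conv_add_right (a b b' : ℤ → R) (k : ℤ) :
    conv K a (fun k => b k + b' k) k = conv K a b k + conv K a b' k := by
  rw [conv_comm, conv_add_left, conv_comm K b, conv_comm K b']

lemma conv_sub_left (a a' b : ℤ → R) (k : ℤ) :
    conv K (fun k => a k - a' k) b k = conv K a b k - conv K a' b k := by
  simp only [conv, ← Finset.sum_sub_distrib]
  refine Finset.sum_congr rfl fun j _ => Finset.sum_congr rfl fun n _ => ?_
  split_ifs <;> ring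

lemma conv_sub_right (a b b' : ℤ → R) (k : ℤ) :
    conv K a (fun k => b k - b' k) k = conv K a b k - conv K a b' k := by
  rw [conv_comm, conv_sub_left, conv_comm K b, conv_comm K b']

lemma conv_smul_left (r : R) (a b : ℤ → R) (k : ℤ) :
    conv K (fun k => r * a k) b k = r * conv K a b k := by
  simp only [conv, Finset.mul_sum]
  refine Finset.sum_congr rfl fun j _ => Finset.sum_congr rfl fun n _ => ?_
  split_ifs <;> ring

lemma conv_smul_right (r : R) (a b : ℤ → R) (k : ℤ) :
    conv K a (fun k => r * b k) k = r * conv K a b k := by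
  rw [conv_comm, conv_smul_left, conv_comm]

lemma conv_congr {a b a' b' : ℤ → R} (ha : ∀ k ∈ box K, a k = a' k)
    (hb : ∀ k ∈ box K, b k = b' k) (k : ℤ) : conv K a b k = conv K a' b' k :=
  Finset.sum_congr rfl fun j hj => Finset.sum_congr rfl fun n hn => by rw [ha j hj, hb n hn]

lemma pairing_comm (a b : ℤ → R) : pairing K a b = pairing K b a := by
  unfold pairing
  rw [← sum_box_neg]
  refine Finset.sum_congr rfl fun k _ => ?_
  rw [neg_neg, mul_comm]

/-- The substitution `k ↦ -k` reverses the sign. This is skew-adjointness of odd-order derivatives,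
and it removes the dispersion from every energy identity. -/
lemma pairing_odd_eq_zero [IsDomain R] [CharZero R] {ω : ℤ → R} (hω : ∀ k, ω (-k) = -ω k)
    (a : ℤ → R) : pairing K (fun k => ω k * a k) a = 0 := by
  have h : pairing K (fun k => ω k * a k) a = - pairing K (fun k => ω k * a k) a := by
    conv_lhs => unfold pairing; rw [← sum_box_neg]
    unfold pairing
    rw [← Finset.sum_neg_distrib]
    refine Finset.sum_congr rfl fun k _ => ?_
    simp only [neg_neg, hω]; ring
  exact self_eq_neg.1 h

/-- The third slot carries `m = -k`, so a multiplier at the output frequency turns into a symbol in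
`m`. Energy identities thus become trilinear forms, where symmetrisation is available. -/
lemma pairing_mul_conv (ω : ℤ → R) (a b c : ℤ → R) :
    pairing K (fun k => ω k * conv K a b k) c = trilin K (fun _ _ m => ω (-m)) a b c := by
  unfold pairing
  rw [← sum_box_neg]
  simp only [conv, trilin, neg_neg, Finset.mul_sum, Finset.sum_mul]
  rw [Finset.sum_comm]
  refine Finset.sum_congr rfl fun j _ => ?_
  rw [Finset.sum_comm]
  refine Finset.sum_congr rfl fun n _ => Finset.sum_congr rfl fun m _ => ?_
  simp only [eq_neg_iff_add_eq_zero]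
  split_ifs <;> ring

end Algebra

lemma HasDerivWithinAt.trilin {K : ℕ} {a b c : ℝ → ℤ → ℂ} {a' b' c' : ℤ → ℂ} {s : Set ℝ} {t : ℝ}
    (σ : ℤ → ℤ → ℤ → ℂ)
    (ha : ∀ k ∈ box K, HasDerivWithinAt (fun t => a t k) (a' k) s t)
    (hb : ∀ k ∈ box K, HasDerivWithinAt (fun t => b t k) (b' k) s t)
    (hc : ∀ k ∈ box K, HasDerivWithinAt (fun t => c t k) (c' k) s t) :
    HasDerivWithinAt (fun t => trilin K σ (a t) (b t) (c t))
      (trilin K σ a' (b t) (c t) + trilin K σ (a t) b' (c t) + trilin K σ (a t) (b t) c') s t := by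
  simp only [Kawahara.trilin, ← Finset.sum_add_distrib]
  refine HasDerivWithinAt.fun_sum fun j hj => HasDerivWithinAt.fun_sum fun n hn =>
    HasDerivWithinAt.fun_sum fun m hm => ?_
  split_ifs
  · exact ((((ha j hj).mul (hb n hn)).mul (hc m hm)).const_mul (σ j n m)).congr_deriv
      (by simp only [Pi.mul_apply]; ring)
  · simpa using hasDerivWithinAt_const t s (0 : ℂ)

lemma HasDerivWithinAt.conv {K : ℕ} {a b : ℝ → ℤ → ℂ} {a' b' : ℤ → ℂ} {s : Set ℝ} {t : ℝ}
    (ha : ∀ k ∈ box K, HasDerivWithinAt (fun t => a t k) (a' k) s t)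
    (hb : ∀ k ∈ box K, HasDerivWithinAt (fun t => b t k) (b' k) s t) (k : ℤ) :
    HasDerivWithinAt (fun t => conv K (a t) (b t) k)
      (conv K a' (b t) k + conv K (a t) b' k) s t := by
  simp only [Kawahara.conv, ← Finset.sum_add_distrib]
  refine HasDerivWithinAt.fun_sum fun j hj => HasDerivWithinAt.fun_sum fun n hn => ?_
  split_ifs
  · exact (ha j hj).mul (hb n hn)
  · simpa using hasDerivWithinAt_const t s (0 : ℂ)

/-! ### Weighted norms and Young-type inequalities. -/

/-- The Japanese bracket `1 + |k|`. -/
def bra (k : ℤ) : ℝ := 1 + |(k : ℝ)|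

lemma one_le_bra (k : ℤ) : 1 ≤ bra k := by unfold bra; linarith [abs_nonneg (k : ℝ)]
lemma bra_pos (k : ℤ) : 0 < bra k := lt_of_lt_of_le one_pos (one_le_bra k)
lemma abs_le_bra (k : ℤ) : |(k : ℝ)| ≤ bra k := by unfold bra; linarith
lemma bra_add_le (j n : ℤ) : bra (j + n) ≤ bra j * bra n := by
  unfold bra
  push_cast
  nlinarith [abs_add_le (j : ℝ) n, abs_nonneg (j : ℝ), abs_nonneg (n : ℝ),
    mul_nonneg (abs_nonneg (j : ℝ)) (abs_nonneg (n : ℝ))]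

/-- The weighted `ℓ¹` norm `∑ₖ (1 + |k|)^s |a_k|` over the box. -/
def wnorm (K s : ℕ) (a : ℤ → ℂ) : ℝ := ∑ k ∈ box K, bra k ^ s * ‖a k‖

/-- The `ℓ²` norm over the box. -/
def l2 (K : ℕ) (a : ℤ → ℂ) : ℝ := Real.sqrt (∑ k ∈ box K, ‖a k‖ ^ 2)

lemma wnorm_nonneg (K s : ℕ) (a : ℤ → ℂ) : 0 ≤ wnorm K s a :=
  Finset.sum_nonneg fun k _ => mul_nonneg (pow_nonneg (bra_pos k).le _) (norm_nonneg _)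

lemma wnorm_mono (K : ℕ) {s s' : ℕ} (h : s ≤ s') (a : ℤ → ℂ) : wnorm K s a ≤ wnorm K s' a :=
  Finset.sum_le_sum fun k _ =>
    mul_le_mul_of_nonneg_right (pow_le_pow_right₀ (one_le_bra k) h) (norm_nonneg _)

lemma wnorm_add_le (K s : ℕ) (a b : ℤ → ℂ) :
    wnorm K s (fun k => a k + b k) ≤ wnorm K s a + wnorm K s b := by
  simp only [wnorm, ← Finset.sum_add_distrib, ← mul_add]
  exact Finset.sum_le_sum fun k _ =>
    mul_le_mul_of_nonneg_left (norm_add_le _ _) (pow_nonneg (bra_pos k).le _)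

lemma l2_nonneg (K : ℕ) (a : ℤ → ℂ) : 0 ≤ l2 K a := Real.sqrt_nonneg _

lemma l2_sq (K : ℕ) (a : ℤ → ℂ) : l2 K a ^ 2 = ∑ k ∈ box K, ‖a k‖ ^ 2 :=
  Real.sq_sqrt (Finset.sum_nonneg fun _ _ => sq_nonneg _)

lemma norm_le_l2 {K : ℕ} (a : ℤ → ℂ) {k : ℤ} (hk : k ∈ box K) : ‖a k‖ ≤ l2 K a := by
  refine Real.le_sqrt_of_sq_le ?_
  exact Finset.single_le_sum (f := fun k => ‖a k‖ ^ 2) (fun _ _ => sq_nonneg _) hk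

lemma l2_congr {K : ℕ} {a b : ℤ → ℂ} (h : ∀ k ∈ box K, ‖a k‖ = ‖b k‖) : l2 K a = l2 K b := by
  unfold l2
  rw [Finset.sum_congr rfl fun k hk => by rw [h k hk]]

lemma l2_le_of_norm_le {K : ℕ} {a b : ℤ → ℂ} (h : ∀ k ∈ box K, ‖a k‖ ≤ ‖b k‖) :
    l2 K a ≤ l2 K b :=
  Real.sqrt_le_sqrt (Finset.sum_le_sum fun k hk => pow_le_pow_left₀ (norm_nonneg _) (h k hk) 2)

lemma l2_add_le (K : ℕ) (a b : ℤ → ℂ) : l2 K (fun k => a k + b k) ≤ l2 K a + l2 K b := by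
  have h1 : l2 K (fun k => a k + b k) ^ 2 ≤ (l2 K a + l2 K b) ^ 2 := by
    have hcs := Real.sum_mul_le_sqrt_mul_sqrt (box K) (fun k => ‖a k‖) (fun k => ‖b k‖)
    have : (l2 K a + l2 K b) ^ 2 = l2 K a ^ 2 + 2 * (l2 K a * l2 K b) + l2 K b ^ 2 := by ring
    rw [this, l2_sq, l2_sq, l2_sq]
    have h2 : ∑ k ∈ box K, ‖a k + b k‖ ^ 2
        ≤ ∑ k ∈ box K, (‖a k‖ ^ 2 + 2 * (‖a k‖ * ‖b k‖) + ‖b k‖ ^ 2) :=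
      Finset.sum_le_sum fun k _ => by
        have := pow_le_pow_left₀ (norm_nonneg _) (norm_add_le (a k) (b k)) 2
        nlinarith
    rw [Finset.sum_add_distrib, Finset.sum_add_distrib, ← Finset.mul_sum] at h2
    unfold l2
    linarith
  exact le_of_sq_le_sq h1 (by positivity [l2_nonneg K a, l2_nonneg K b])

lemma l2_smul (K : ℕ) (r : ℂ) (a : ℤ → ℂ) : l2 K (fun k => r * a k) = ‖r‖ * l2 K a := by
  unfold l2
  simp only [norm_mul, mul_pow, ← Finset.mul_sum]
  rw [Real.sqrt_mul (sq_nonneg _), Real.sqrt_sq (norm_nonneg _)]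

lemma l2_le_wnorm (K s : ℕ) (a : ℤ → ℂ) : l2 K a ≤ wnorm K s a := by
  refine le_trans ?_ (wnorm_mono K (Nat.zero_le s) a)
  refine Real.sqrt_le_iff.2 ⟨wnorm_nonneg _ _ _, ?_⟩
  simp only [wnorm, pow_zero, one_mul]
  exact Finset.sum_sq_le_sq_sum_of_nonneg fun _ _ => norm_nonneg _

lemma norm_pairing_le (K : ℕ) (a b : ℤ → ℂ) : ‖pairing K a b‖ ≤ l2 K a * l2 K b := by
  have hb : l2 K b = Real.sqrt (∑ k ∈ box K, ‖b (-k)‖ ^ 2) := by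
    rw [sum_box_neg K fun k => ‖b k‖ ^ 2, l2]
  rw [hb]
  refine (norm_sum_le _ _).trans ?_
  simp only [norm_mul]
  exact Real.sum_mul_le_sqrt_mul_sqrt (box K) (fun k => ‖a k‖) (fun k => ‖b (-k)‖)

/-- Young's inequality for the real trilinear form. -/
lemma trilin_one_le (K : ℕ) {x y z : ℤ → ℝ} (hy : ∀ k, 0 ≤ y k) :
    trilin K 1 x y z ≤
      Real.sqrt (∑ k ∈ box K, x k ^ 2) * (∑ k ∈ box K, y k) *
        Real.sqrt (∑ k ∈ box K, z k ^ 2) := by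
  -- For fixed `n` the constraint leaves a single sum over `j`, a shifted correlation of `x` and
  -- `z`, to which Cauchy–Schwarz applies.
  have hin : ∀ n : ℤ, ∑ j ∈ box K, ∑ m ∈ box K, (if j + n + m = 0 then x j * z m else 0)
      ≤ Real.sqrt (∑ k ∈ box K, x k ^ 2) * Real.sqrt (∑ k ∈ box K, z k ^ 2) := by
    intro n
    have h1 : ∀ j, ∑ m ∈ box K, (if j + n + m = 0 then x j * z m else 0)
        = x j * (if -(j + n) ∈ box K then z (-(j + n)) else 0) := by
      intro j
      have : ∀ m, (if j + n + m = 0 then x j * z m else 0)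
          = if -(j + n) = m then x j * z m else 0 := fun m => by
        congr 1
        exact propext ⟨fun h => by omega, fun h => by omega⟩
      simp only [this, Finset.sum_ite_eq]
      split_ifs <;> simp
    simp only [h1]
    refine (Real.sum_mul_le_sqrt_mul_sqrt _ _ _).trans ?_
    refine mul_le_mul_of_nonneg_left (Real.sqrt_le_sqrt ?_) (Real.sqrt_nonneg _)
    have h2 : ∀ j, (if -(j + n) ∈ box K then z (-(j + n)) else 0) ^ 2
        = if -(j + n) ∈ box K then z (-(j + n)) ^ 2 else 0 := fun j => by split_ifs <;> simp
    simp only [h2]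
    rw [← Finset.sum_filter]
    rw [← Finset.sum_image (f := fun k => z k ^ 2) (g := fun j => -(j + n))]
    · refine Finset.sum_le_sum_of_subset_of_nonneg ?_ fun _ _ _ => sq_nonneg _
      intro k hk
      obtain ⟨j, hj, rfl⟩ := Finset.mem_image.1 hk
      exact (Finset.mem_filter.1 hj).2
    · intro j _ j' _ h
      simp only at h
      omega
  have : trilin K 1 x y z = ∑ n ∈ box K, y n *
      ∑ j ∈ box K, ∑ m ∈ box K, (if j + n + m = 0 then x j * z m else 0) := by
    unfold trilin
    rw [Finset.sum_comm]
    simp only [Finset.mul_sum]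
    refine Finset.sum_congr rfl fun n _ => Finset.sum_congr rfl fun j _ =>
      Finset.sum_congr rfl fun m _ => ?_
    split_ifs
    · simp only [Pi.one_apply]; ring
    · simp
  rw [this]
  calc _ ≤ ∑ n ∈ box K, y n *
        (Real.sqrt (∑ k ∈ box K, x k ^ 2) * Real.sqrt (∑ k ∈ box K, z k ^ 2)) :=
        Finset.sum_le_sum fun n _ => mul_le_mul_of_nonneg_left (hin n) (hy n)
    _ = _ := by rw [← Finset.sum_mul]; ring

lemma norm_trilin_le_trilin (K : ℕ) {σ : ℤ → ℤ → ℤ → ℂ} {a b c : ℤ → ℂ} {τ : ℤ → ℤ → ℤ → ℝ}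
    {x y z : ℤ → ℝ}
    (h : ∀ j ∈ box K, ∀ n ∈ box K, ∀ m ∈ box K, j + n + m = 0 →
      ‖σ j n m * (a j * b n * c m)‖ ≤ τ j n m * (x j * y n * z m)) :
    ‖trilin K σ a b c‖ ≤ trilin K τ x y z := by
  unfold trilin
  refine (norm_sum_le _ _).trans (Finset.sum_le_sum fun j hj => ?_)
  refine (norm_sum_le _ _).trans (Finset.sum_le_sum fun n hn => ?_)
  refine (norm_sum_le _ _).trans (Finset.sum_le_sum fun m hm => ?_)
  split_ifs with h0
  · exact h j hj n hn m hm h0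
  · simp

lemma norm_trilin_le (K : ℕ) {σ : ℤ → ℤ → ℤ → ℂ} {a b c : ℤ → ℂ} {x y z : ℤ → ℝ}
    (hy : ∀ k, 0 ≤ y k)
    (h : ∀ j ∈ box K, ∀ n ∈ box K, ∀ m ∈ box K, j + n + m = 0 →
      ‖σ j n m * (a j * b n * c m)‖ ≤ x j * y n * z m) :
    ‖trilin K σ a b c‖ ≤ Real.sqrt (∑ k ∈ box K, x k ^ 2) * (∑ k ∈ box K, y k) *
        Real.sqrt (∑ k ∈ box K, z k ^ 2) :=
  (norm_trilin_le_trilin K (τ := 1) fun j hj n hn m hm h0 => by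
    simpa using h j hj n hn m hm h0).trans (trilin_one_le K hy)

/-- The bracket is submultiplicative, so the weight of the output is at most the product of the
weights of the inputs: weighted `ℓ¹` is an algebra. -/
lemma wnorm_conv_le (K s : ℕ) (a b : ℤ → ℂ) :
    wnorm K s (conv K a b) ≤ wnorm K s a * wnorm K s b := by
  have h : ∀ k ∈ box K, bra k ^ s * ‖conv K a b k‖ ≤ ∑ j ∈ box K, ∑ n ∈ box K,
      if j + n = k then (bra j ^ s * ‖a j‖) * (bra n ^ s * ‖b n‖) else 0 := by
    intro k _
    calc _ ≤ bra k ^ s * ∑ j ∈ box K, ∑ n ∈ box K, if j + n = k then ‖a j‖ * ‖b n‖ else 0 := by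
          refine mul_le_mul_of_nonneg_left ?_ (pow_nonneg (bra_pos k).le _)
          refine (norm_sum_le _ _).trans (Finset.sum_le_sum fun j _ => ?_)
          refine (norm_sum_le _ _).trans (Finset.sum_le_sum fun n _ => ?_)
          split_ifs <;> simp
      _ ≤ _ := by
          simp only [Finset.mul_sum]
          refine Finset.sum_le_sum fun j _ => Finset.sum_le_sum fun n _ => ?_
          split_ifs with h0
          · subst h0
            calc bra (j + n) ^ s * (‖a j‖ * ‖b n‖)
                ≤ (bra j * bra n) ^ s * (‖a j‖ * ‖b n‖) := by
                  have := pow_le_pow_left₀ (bra_pos (j + n)).le (bra_add_le j n) s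
                  gcongr
              _ = _ := by rw [mul_pow]; ring
          · simp
  refine (Finset.sum_le_sum h).trans ?_
  rw [Finset.sum_comm]
  unfold wnorm
  rw [Finset.sum_mul_sum]
  refine Finset.sum_le_sum fun j _ => ?_
  rw [Finset.sum_comm]
  refine Finset.sum_le_sum fun n _ => ?_
  rw [Finset.sum_ite_eq]
  have : 0 ≤ bra j ^ s * ‖a j‖ * (bra n ^ s * ‖b n‖) := by
    have := bra_pos j; have := bra_pos n; positivity
  split_ifs <;> simp [this]

/-- By duality: the convolution is tested against its own reflected conjugate, and the trilinear
Young inequality leaves one factor of its norm to cancel. -/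
lemma l2_conv_le (K : ℕ) (a b : ℤ → ℂ) : l2 K (conv K a b) ≤ l2 K a * wnorm K 0 b := by
  set f := conv K a b
  have h1 : (l2 K f ^ 2) ≤ l2 K a * wnorm K 0 b * l2 K f := by
    have h2 : ((l2 K f ^ 2 : ℝ) : ℂ)
        = trilin K 1 a b (fun k => starRingEnd ℂ (f (-k))) := by
      have := pairing_mul_conv K (fun _ => (1 : ℂ)) a b (fun k => starRingEnd ℂ (f (-k)))
      simp only [one_mul] at this
      rw [show (1 : ℤ → ℤ → ℤ → ℂ) = fun _ _ _ => 1 from rfl, ← this, l2_sq, pairing]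
      push_cast
      refine Finset.sum_congr rfl fun k _ => ?_
      rw [neg_neg, Complex.mul_conj, Complex.normSq_eq_norm_sq]
      push_cast; rfl
    have h3 := norm_trilin_le K (σ := 1) (a := a) (b := b)
      (c := fun k => starRingEnd ℂ (f (-k))) (x := fun k => ‖a k‖) (y := fun k => ‖b k‖)
      (z := fun k => ‖f (-k)‖) (fun _ => norm_nonneg _) (fun j _ n _ m _ _ => by simp)
    rw [← h2, sum_box_neg K (fun k => ‖f k‖ ^ 2)] at h3
    rw [Complex.norm_real, Real.norm_of_nonneg (sq_nonneg _)] at h3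
    simpa [l2, wnorm] using h3
  by_cases h0 : l2 K f = 0
  · rw [h0]; exact mul_nonneg (l2_nonneg _ _) (wnorm_nonneg _ _ _)
  · have : 0 < l2 K f := lt_of_le_of_ne (l2_nonneg _ _) (Ne.symm h0)
    nlinarith

/-! ### Real sequences, dispersion and nonlinearity in Fourier variables. -/

/-- Coefficients of a real-valued function. -/
def IsRealCoeff (a : ℤ → ℂ) : Prop := ∀ k, a (-k) = starRingEnd ℂ (a k)

lemma IsRealCoeff.sub {a b : ℤ → ℂ} (ha : IsRealCoeff a) (hb : IsRealCoeff b) :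
    IsRealCoeff fun k => a k - b k := fun k => by simp [ha k, hb k]

lemma IsRealCoeff.pairing_self {a : ℤ → ℂ} (ha : IsRealCoeff a) (K : ℕ) :
    pairing K a a = ((l2 K a ^ 2 : ℝ) : ℂ) := by
  rw [l2_sq, pairing]
  push_cast
  refine Finset.sum_congr rfl fun k _ => ?_
  rw [ha k, Complex.mul_conj, Complex.normSq_eq_norm_sq]
  push_cast; rfl

/-- Reality replaces the conjugate of `a_k` by `a_{-k}`, so the derivative of a quadratic energy is
a bilinear pairing with no conjugation. -/
lemma hasDerivWithinAt_weighted_sum {K : ℕ} {a : ℝ → ℤ → ℂ} {a' : ℤ → ℂ} {s : Set ℝ} {t : ℝ}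
    (w : ℤ → ℝ) (hr : IsRealCoeff (a t))
    (ha : ∀ k ∈ box K, HasDerivWithinAt (fun t => a t k) (a' k) s t) :
    HasDerivWithinAt (fun t => ∑ k ∈ box K, w k * ‖a t k‖ ^ 2)
      (2 * (pairing K (fun k => w k * a' k) (a t)).re) s t := by
  have h : ∀ k ∈ box K, HasDerivWithinAt (fun t => w k * ‖a t k‖ ^ 2)
      (w k * (2 * (a' k * a t (-k)).re)) s t := fun k hk => by
    refine ((ha k hk).norm_sq.const_mul (w k)).congr_deriv ?_
    rw [hr k, Complex.inner]
  refine (HasDerivWithinAt.fun_sum h).congr_deriv ?_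
  rw [pairing, Complex.re_sum, Finset.mul_sum]
  refine Finset.sum_congr rfl fun k _ => ?_
  rw [mul_assoc, Complex.re_ofReal_mul]
  ring

/-- The symbol `i (k³ + k⁵)` of `-(∂³ - ∂⁵)`. -/
def disp (k : ℤ) : ℂ := Complex.I * ((k : ℂ) ^ 3 + (k : ℂ) ^ 5)

/-- The coefficients of `-½ ∂ₓ (f g)`. -/
def bil (K : ℕ) (a b : ℤ → ℂ) (k : ℤ) : ℂ := -(Complex.I * k / 2) * conv K a b k

lemma disp_neg (k : ℤ) : disp (-k) = -disp k := by
  simp only [disp]; push_cast; ring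

lemma pairing_bil (K : ℕ) (a b c : ℤ → ℂ) :
    pairing K (bil K a b) c = Complex.I / 2 * trilin K (fun _ _ m => (m : ℂ)) a b c := by
  rw [← trilin_smul_symbol]
  have := pairing_mul_conv K (fun k => -(Complex.I * k / 2)) a b c
  unfold bil
  rw [this]
  congr 1
  funext _ _ m
  push_cast; ring

/-- With one sequence in all three slots, the variable carrying the symbol can be permuted freely.
-/
lemma three_mul_trilin_self {R : Type*} [CommRing R] (K : ℕ) (f : ℤ → R) (a : ℤ → R) :
    3 * trilin K (fun _ _ m => f m) a a a = trilin K (fun j n m => f j + f n + f m) a a a := by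
  have h := trilin_add_symbol K (fun j n _ => f j + f n) (fun _ _ m => f m) a a a
  have h' := trilin_add_symbol K (fun j _ _ => f j) (fun _ n _ => f n) a a a
  rw [h, h', trilin_swap₁₃ K (fun j _ _ => f j), trilin_swap₂₃ K (fun _ n _ => f n)]
  ring

lemma trilin_zero_symbol {R : Type*} [CommRing R] {K : ℕ} {σ : ℤ → ℤ → ℤ → R}
    (h : ∀ j n m, j + n + m = 0 → σ j n m = 0) (a b c : ℤ → R) : trilin K σ a b c = 0 := by
  refine Finset.sum_eq_zero fun j _ => Finset.sum_eq_zero fun n _ =>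
    Finset.sum_eq_zero fun m _ => ?_
  split_ifs with h0
  · rw [h j n m h0, zero_mul]
  · rfl

/-! ### The commutator estimate on the plane `x + y + z = 0`. -/

/-- The powers of `y` and `z` nearly cancel: their sum is a difference of odd powers at `y` and
`-z`, which are `|x|` apart. This extracts one factor of the smallest frequency and leaves `2s`
powers to share between the two large ones. -/
lemma pow_add_pow_add_pow_le_of_abs_le {x y z : ℝ} (s : ℕ) (h : x + y + z = 0)
    (hy : |x| ≤ |y|) (hz : |x| ≤ |z|) :
    |x ^ (2 * s + 1) + y ^ (2 * s + 1) + z ^ (2 * s + 1)|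
      ≤ ((2 * s + 1) * 2 ^ s + 1) * (|x| * |y| ^ s * |z| ^ s) := by
  have hodd : Odd (2 * s + 1) := ⟨s, rfl⟩
  have hz' : z ^ (2 * s + 1) = -(-z) ^ (2 * s + 1) := by rw [hodd.neg_pow, neg_neg]
  have h1 := abs_pow_sub_pow_le y (-z) (2 * s + 1)
  rw [show y - -z = -x by linarith, abs_neg, abs_neg, Nat.add_sub_cancel] at h1
  -- As `x` is smallest, `|y|` and `|z|` agree within a factor two, so the square of their maximum
  -- is at most `2|y||z|`.
  have hmax : max |y| |z| ^ (2 * s) ≤ 2 ^ s * (|y| ^ s * |z| ^ s) := by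
    rw [pow_mul, ← mul_pow, ← mul_pow]
    refine pow_le_pow_left₀ (sq_nonneg _) ?_ s
    have h2 : |y| ≤ |x| + |z| := by
      rw [show y = -(x + z) by linarith, abs_neg]; exact abs_add_le _ _
    have h3 : |z| ≤ |x| + |y| := by
      rw [show z = -(x + y) by linarith, abs_neg]; exact abs_add_le _ _
    rcases max_cases |y| |z| with ⟨e, _⟩ | ⟨e, _⟩ <;> rw [e] <;>
      nlinarith [abs_nonneg y, abs_nonneg z]
  have h4 : |x ^ (2 * s + 1)| ≤ |x| * |y| ^ s * |z| ^ s := by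
    rw [abs_pow, show |x| ^ (2 * s + 1) = |x| * |x| ^ s * |x| ^ s by ring]
    gcongr
  calc _ ≤ |x ^ (2 * s + 1)| + |y ^ (2 * s + 1) - (-z) ^ (2 * s + 1)| := by
        rw [hz', add_assoc, ← sub_eq_add_neg]; exact abs_add_le _ _
    _ ≤ |x| * |y| ^ s * |z| ^ s + |x| * (2 * s + 1) * (2 ^ s * (|y| ^ s * |z| ^ s)) := by
        refine add_le_add h4 (h1.trans ?_)
        push_cast
        gcongr
    _ = _ := by ring

lemma pow_add_pow_add_pow_le {x y z : ℝ} (s : ℕ) (h : x + y + z = 0) :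
    |x ^ (2 * s + 1) + y ^ (2 * s + 1) + z ^ (2 * s + 1)|
      ≤ ((2 * s + 1) * 2 ^ s + 1) * (|x| * |y| ^ s * |z| ^ s) +
        (((2 * s + 1) * 2 ^ s + 1) * (|x| ^ s * |y| * |z| ^ s) +
         ((2 * s + 1) * 2 ^ s + 1) * (|x| ^ s * |y| ^ s * |z|)) := by
  set C : ℝ := (2 * s + 1) * 2 ^ s + 1
  have hC : 0 ≤ C := by positivity
  have p1 : 0 ≤ C * (|x| * |y| ^ s * |z| ^ s) := by positivity
  have p2 : 0 ≤ C * (|x| ^ s * |y| * |z| ^ s) := by positivity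
  have p3 : 0 ≤ C * (|x| ^ s * |y| ^ s * |z|) := by positivity
  rcases le_total |x| |y| with hxy | hxy
  · rcases le_total |x| |z| with hxz | hxz
    · have := pow_add_pow_add_pow_le_of_abs_le s h hxy hxz
      linarith
    · have := pow_add_pow_add_pow_le_of_abs_le s (show z + x + y = 0 by linarith) hxz
        (hxz.trans hxy)
      rw [show x ^ (2 * s + 1) + y ^ (2 * s + 1) + z ^ (2 * s + 1)
        = z ^ (2 * s + 1) + x ^ (2 * s + 1) + y ^ (2 * s + 1) by ring]
      have e : |z| * |x| ^ s * |y| ^ s = |x| ^ s * |y| ^ s * |z| := by ring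
      rw [e] at this
      linarith
  · rcases le_total |y| |z| with hyz | hyz
    · have := pow_add_pow_add_pow_le_of_abs_le s (show y + x + z = 0 by linarith) hxy hyz
      rw [show x ^ (2 * s + 1) + y ^ (2 * s + 1) + z ^ (2 * s + 1)
        = y ^ (2 * s + 1) + x ^ (2 * s + 1) + z ^ (2 * s + 1) by ring]
      have e : |y| * |x| ^ s * |z| ^ s = |x| ^ s * |y| * |z| ^ s := by ring
      rw [e] at this
      linarith
    · have := pow_add_pow_add_pow_le_of_abs_le s (show z + x + y = 0 by linarith)
        (hyz.trans hxy) hyz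
      rw [show x ^ (2 * s + 1) + y ^ (2 * s + 1) + z ^ (2 * s + 1)
        = z ^ (2 * s + 1) + x ^ (2 * s + 1) + y ^ (2 * s + 1) by ring]
      have e : |z| * |x| ^ s * |y| ^ s = |x| ^ s * |y| ^ s * |z| := by ring
      rw [e] at this
      linarith

lemma trilin_mul_symbol {R : Type*} [CommRing R] (K : ℕ) (f g h a b c : ℤ → R) :
    trilin K (fun j n m => f j * g n * h m) a b c
      = trilin K 1 (fun j => f j * a j) (fun n => g n * b n) (fun m => h m * c m) :=
  trilin_congr K fun j _ n _ m _ _ => by simp only [Pi.one_apply]; ring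

lemma sum_abs_mul_le_wnorm (K : ℕ) (a : ℤ → ℂ) :
    ∑ k ∈ box K, |(k : ℝ)| * ‖a k‖ ≤ wnorm K 1 a :=
  Finset.sum_le_sum fun k _ => by
    rw [pow_one]; exact mul_le_mul_of_nonneg_right (abs_le_bra k) (norm_nonneg _)

/-- The commutator estimate behind the `H^s` energy estimate. -/
lemma norm_trilin_pow_le (K s : ℕ) (a : ℤ → ℂ) :
    ‖trilin K (fun j n m => (j : ℂ) ^ (2 * s + 1) + (n : ℂ) ^ (2 * s + 1)
        + (m : ℂ) ^ (2 * s + 1)) a a a‖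
      ≤ 3 * ((2 * s + 1) * 2 ^ s + 1) * wnorm K 1 a
          * ∑ k ∈ box K, (k : ℝ) ^ (2 * s) * ‖a k‖ ^ 2 := by
  set C : ℝ := (2 * s + 1) * 2 ^ s + 1 with hC
  have hC0 : 0 ≤ C := by positivity
  set x : ℤ → ℝ := fun k => ‖a k‖
  set f : ℤ → ℝ := fun k => |(k : ℝ)|
  set g : ℤ → ℝ := fun k => |(k : ℝ)| ^ s
  have h1 := norm_trilin_le_trilin K (a := a) (b := a) (c := a) (x := x) (y := x) (z := x)
    (σ := fun j n m => (j : ℂ) ^ (2 * s + 1) + (n : ℂ) ^ (2 * s + 1) + (m : ℂ) ^ (2 * s + 1))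
    (τ := fun j n m => C * (f j * g n * g m) + (C * (g j * f n * g m) + C * (g j * g n * f m)))
    (fun j _ n _ m _ h0 => by
      rw [norm_mul, norm_mul, norm_mul]
      refine mul_le_mul_of_nonneg_right ?_ (by positivity)
      have := pow_add_pow_add_pow_le (x := j) (y := n) (z := m) s (by exact_mod_cast h0)
      rw [← Real.norm_eq_abs, ← Complex.norm_real] at this
      push_cast at this
      exact this)
  refine h1.trans ?_
  rw [trilin_add_symbol, trilin_add_symbol, trilin_smul_symbol, trilin_smul_symbol,
    trilin_smul_symbol, trilin_mul_symbol, trilin_mul_symbol, trilin_mul_symbol]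
  -- The slot with a single derivative is moved to the middle, where Young's inequality takes an
  -- `ℓ¹` norm; the three terms become equal.
  rw [trilin_swap₁₂ K 1 (fun j => f j * x j), trilin_swap₂₃ K 1 _ _ (fun j => f j * x j)]
  have hmid : trilin K 1 (fun j => g j * x j) (fun j => f j * x j) (fun j => g j * x j)
      ≤ wnorm K 1 a * ∑ k ∈ box K, (k : ℝ) ^ (2 * s) * ‖a k‖ ^ 2 := by
    refine (trilin_one_le K fun k => by positivity).trans ?_
    have : ∑ k ∈ box K, (g k * x k) ^ 2 = ∑ k ∈ box K, (k : ℝ) ^ (2 * s) * ‖a k‖ ^ 2 :=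
      Finset.sum_congr rfl fun k _ => by
        simp only [g, x]
        rw [mul_pow, ← pow_mul, mul_comm s 2, pow_mul, sq_abs, pow_mul]
    rw [mul_right_comm, Real.mul_self_sqrt (Finset.sum_nonneg fun _ _ => sq_nonneg _), this,
      mul_comm]
    refine mul_le_mul_of_nonneg_right (sum_abs_mul_le_wnorm K a) ?_
    exact Finset.sum_nonneg fun k _ => mul_nonneg (by rw [pow_mul]; positivity) (sq_nonneg _)
  have e : (fun (j n m : ℤ) => (1 : ℤ → ℤ → ℤ → ℝ) n j m) = 1 := rfl
  have e' : (fun (j n m : ℤ) => (1 : ℤ → ℤ → ℤ → ℝ) j m n) = 1 := rfl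
  rw [e, e']
  have := mul_le_mul_of_nonneg_left hmid hC0
  linarith

/-- Gronwall: `exp (-c t) * f t` is nonincreasing. The derivative is needed only in the open
interval. -/
lemma le_exp_mul_of_deriv_le {f f' : ℝ → ℝ} {c T : ℝ} (hc : ContinuousOn f (Set.Icc 0 T))
    (hd : ∀ t ∈ Set.Ioo 0 T, HasDerivAt f (f' t) t) (hle : ∀ t ∈ Set.Ioo 0 T, f' t ≤ c * f t)
    {t : ℝ} (ht : t ∈ Set.Icc 0 T) : f t ≤ Real.exp (c * t) * f 0 := by
  have hE : ∀ t : ℝ, HasDerivAt (fun t => Real.exp (-(c * t))) (Real.exp (-(c * t)) * -c) t :=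
    fun t => by
      simpa using ((hasDerivAt_id t).const_mul c).neg.exp
  have hanti : AntitoneOn (fun t => Real.exp (-(c * t)) * f t) (Set.Icc 0 T) := by
    refine antitoneOn_of_deriv_nonpos (convex_Icc 0 T)
      (ContinuousOn.mul (by fun_prop) hc) ?_ ?_
    · rw [interior_Icc]
      exact fun t ht => ((hE t).mul (hd t ht)).differentiableAt.differentiableWithinAt
    · rw [interior_Icc]
      intro t ht
      have := ((hE t).mul (hd t ht)).deriv
      rw [show (fun t => Real.exp (-(c * t)) * f t) = (fun t => Real.exp (-(c * t))) * f from rfl,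
        this]
      nlinarith [hle t ht, Real.exp_pos (-(c * t))]
  have h := hanti ⟨le_rfl, ht.1.trans ht.2⟩ ht ht.1
  simp only [mul_zero, neg_zero, Real.exp_zero, one_mul] at h
  calc f t = Real.exp (c * t) * (Real.exp (-(c * t)) * f t) := by
        rw [← mul_assoc, ← Real.exp_add]; simp
    _ ≤ _ := mul_le_mul_of_nonneg_left h (Real.exp_pos _).le

/-! ### A priori bounds for Galerkin solutions, uniform in the number of modes. -/

/-- Coefficients of a solution of the Fourier-Galerkin equations. -/
structure IsGalerkin (N : ℕ) (a : ℝ → ℤ → ℂ) : Prop where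
  real : ∀ t, 0 ≤ t → IsRealCoeff (a t)
  deriv : ∀ t, 0 ≤ t → ∀ k ∈ box N, HasDerivWithinAt (fun s => a s k)
    (disp k * a t k + bil N (a t) (a t) k) (Set.Ici 0) t

lemma summable_inv_bra_sq : Summable fun k : ℤ => (bra k ^ 2)⁻¹ := by
  have h : Summable fun k : ℤ => 1 / (k : ℝ) ^ 2 := Real.summable_one_div_int_pow.2 one_lt_two
  refine Summable.of_norm_bounded_eventually h ?_
  rw [Filter.eventually_cofinite]
  refine Set.Finite.subset (Set.finite_singleton 0) fun k hk => ?_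
  by_contra hk0
  refine hk ?_
  have hk1 : (0 : ℝ) < |(k : ℝ)| := by simpa using hk0
  rw [Real.norm_of_nonneg (by have := bra_pos k; positivity), one_div, ← sq_abs (k : ℝ)]
  exact inv_anti₀ (by positivity) (pow_le_pow_left₀ hk1.le (abs_le_bra k) 2)

/-- The constant `∑ₖ (1 + |k|)⁻²`. -/
def braConst : ℝ := ∑' k : ℤ, (bra k ^ 2)⁻¹

lemma sum_inv_bra_sq_le (s : Finset ℤ) : ∑ k ∈ s, (bra k ^ 2)⁻¹ ≤ braConst :=
  summable_inv_bra_sq.sum_le_tsum s fun k _ => by have := bra_pos k; positivity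

lemma braConst_pos : 0 < braConst := by
  have := sum_inv_bra_sq_le {0}
  simp [bra] at this
  linarith

/-- Cauchy–Schwarz against the square-summable `(1 + |k|)⁻¹`: one extra derivative in `ℓ²` buys a
weighted `ℓ¹` bound. -/
lemma sum_bra_mul_sq_le (S : Finset ℤ) (s : ℕ) (a : ℤ → ℂ) :
    (∑ k ∈ S, bra k ^ s * ‖a k‖) ^ 2
      ≤ braConst * ∑ k ∈ S, bra k ^ (2 * s + 2) * ‖a k‖ ^ 2 := by
  have h := Finset.sum_mul_sq_le_sq_mul_sq S (fun k => (bra k)⁻¹)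
    (fun k => bra k ^ (s + 1) * ‖a k‖)
  have e : ∑ k ∈ S, bra k ^ s * ‖a k‖ = ∑ k ∈ S, (bra k)⁻¹ * (bra k ^ (s + 1) * ‖a k‖) :=
    Finset.sum_congr rfl fun k _ => by
      have := (bra_pos k).ne'
      field_simp
      ring
  rw [e]
  refine h.trans ?_
  have e2 : ∑ k ∈ S, (bra k ^ (s + 1) * ‖a k‖) ^ 2
      = ∑ k ∈ S, bra k ^ (2 * s + 2) * ‖a k‖ ^ 2 :=
    Finset.sum_congr rfl fun k _ => by ring
  rw [e2]
  simp only [inv_pow]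
  exact mul_le_mul_of_nonneg_right (sum_inv_bra_sq_le _)
    (Finset.sum_nonneg fun k _ => by have := bra_pos k; positivity)

lemma wnorm_sq_le (K s : ℕ) (a : ℤ → ℂ) :
    wnorm K s a ^ 2 ≤ braConst * ∑ k ∈ box K, bra k ^ (2 * s + 2) * ‖a k‖ ^ 2 :=
  sum_bra_mul_sq_le (box K) s a

lemma bra_pow_le (k : ℤ) (s : ℕ) : bra k ^ (2 * s) ≤ 2 ^ (2 * s) * (1 + (k : ℝ) ^ (2 * s)) := by
  have e : (k : ℝ) ^ (2 * s) = |(k : ℝ)| ^ (2 * s) := by rw [pow_mul, pow_mul, sq_abs]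
  rw [e]
  unfold bra
  have h0 := abs_nonneg (k : ℝ)
  rcases le_total |(k : ℝ)| 1 with h | h
  · calc (1 + |(k : ℝ)|) ^ (2 * s) ≤ 2 ^ (2 * s) * 1 := by
          rw [mul_one]; exact pow_le_pow_left₀ (by positivity) (by linarith) _
      _ ≤ _ := by gcongr; linarith [pow_nonneg h0 (2 * s)]
  · calc (1 + |(k : ℝ)|) ^ (2 * s) ≤ (2 * |(k : ℝ)|) ^ (2 * s) :=
          pow_le_pow_left₀ (by positivity) (by linarith) _
      _ ≤ _ := by rw [mul_pow]; gcongr; linarith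

lemma sum_bra_pow_le (K s : ℕ) (a : ℤ → ℂ) :
    ∑ k ∈ box K, bra k ^ (2 * s) * ‖a k‖ ^ 2
      ≤ 2 ^ (2 * s) * (∑ k ∈ box K, ‖a k‖ ^ 2 + ∑ k ∈ box K, (k : ℝ) ^ (2 * s) * ‖a k‖ ^ 2) := by
  rw [← Finset.sum_add_distrib, Finset.mul_sum]
  refine Finset.sum_le_sum fun k _ => ?_
  have := mul_le_mul_of_nonneg_right (bra_pow_le k s) (sq_nonneg ‖a k‖)
  linarith

lemma sum_pow_le_sum_bra_pow (K : ℕ) {s s' : ℕ} (h : 2 * s ≤ s') (a : ℤ → ℂ) :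
    ∑ k ∈ box K, (k : ℝ) ^ (2 * s) * ‖a k‖ ^ 2 ≤ ∑ k ∈ box K, bra k ^ s' * ‖a k‖ ^ 2 := by
  refine Finset.sum_le_sum fun k _ => mul_le_mul_of_nonneg_right ?_ (sq_nonneg _)
  calc (k : ℝ) ^ (2 * s) = |(k : ℝ)| ^ (2 * s) := by rw [pow_mul, pow_mul, sq_abs]
    _ ≤ bra k ^ (2 * s) := pow_le_pow_left₀ (abs_nonneg _) (abs_le_bra k) _
    _ ≤ bra k ^ s' := pow_le_pow_right₀ (one_le_bra k) h

lemma pairing_add_left {R : Type*} [CommRing R] (K : ℕ) (a a' b : ℤ → R) :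
    pairing K (fun k => a k + a' k) b = pairing K a b + pairing K a' b := by
  simp only [pairing, ← Finset.sum_add_distrib, add_mul]

lemma pairing_congr {R : Type*} [CommRing R] {K : ℕ} {a a' : ℤ → R} (b : ℤ → R)
    (h : ∀ k ∈ box K, a k = a' k) : pairing K a b = pairing K a' b :=
  Finset.sum_congr rfl fun k hk => by rw [h k hk]

lemma pairing_smul_left {R : Type*} [CommRing R] (K : ℕ) (r : R) (a b : ℤ → R) :
    pairing K (fun k => r * a k) b = r * pairing K a b := by
  simp only [pairing, Finset.mul_sum, mul_assoc]

/-- Multiplying the odd `disp` by the even weight keeps it odd, so dispersion disappears. The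
nonlinear symbol is `i/2 * m^(2s+1)`, and symmetrising it brings the remaining third. -/
lemma energy_pairing (K s : ℕ) (a : ℤ → ℂ) :
    pairing K (fun k => (((k : ℝ) ^ (2 * s) : ℝ) : ℂ) * (disp k * a k + bil K a a k)) a
      = Complex.I / 6 * trilin K (fun j n m => (j : ℂ) ^ (2 * s + 1) + (n : ℂ) ^ (2 * s + 1)
        + (m : ℂ) ^ (2 * s + 1)) a a a := by
  have h1 : pairing K (fun k => ((k : ℂ) ^ (2 * s) * disp k) * a k) a = 0 := by
    refine pairing_odd_eq_zero K (fun k => ?_) a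
    rw [disp_neg]
    push_cast
    rw [(even_two_mul s).neg_pow]; ring
  have h2 := pairing_mul_conv K (fun k => (k : ℂ) ^ (2 * s) * -(Complex.I * k / 2)) a a a
  have h3 := three_mul_trilin_self K (fun m => (m : ℂ) ^ (2 * s + 1)) a
  rw [← h3]
  have e : pairing K (fun k => (((k : ℝ) ^ (2 * s) : ℝ) : ℂ) * (disp k * a k + bil K a a k)) a
      = pairing K (fun k => ((k : ℂ) ^ (2 * s) * disp k) * a k) a
        + pairing K (fun k => ((k : ℂ) ^ (2 * s) * -(Complex.I * k / 2)) * conv K a a k) a := by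
    rw [← pairing_add_left]
    refine pairing_congr a fun k _ => ?_
    simp only [bil]; push_cast; ring
  rw [e, h1, h2, zero_add]
  have e2 : (fun _ _ m => ((-m : ℤ) : ℂ) ^ (2 * s) * -(Complex.I * ((-m : ℤ) : ℂ) / 2))
      = fun _ _ m : ℤ => Complex.I / 2 * ((m : ℂ) ^ (2 * s + 1)) := by
    funext j n m
    push_cast
    rw [(even_two_mul s).neg_pow]; ring
  have e3 := trilin_smul_symbol K (Complex.I / 2) (fun _ _ m => (m : ℂ) ^ (2 * s + 1)) a a a
  calc _ = trilin K (fun _ _ m : ℤ => Complex.I / 2 * ((m : ℂ) ^ (2 * s + 1))) a a a :=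
        congrArg (fun σ => trilin K σ a a a) e2
    _ = _ := by rw [e3]; ring

lemma IsGalerkin.hasDerivWithinAt_energy {N : ℕ} {a : ℝ → ℤ → ℂ} (h : IsGalerkin N a) (s : ℕ)
    {t : ℝ} (ht : 0 ≤ t) :
    HasDerivWithinAt (fun t => ∑ k ∈ box N, (k : ℝ) ^ (2 * s) * ‖a t k‖ ^ 2)
      (2 * (Complex.I / 6 * trilin N (fun j n m => (j : ℂ) ^ (2 * s + 1) + (n : ℂ) ^ (2 * s + 1)
        + (m : ℂ) ^ (2 * s + 1)) (a t) (a t) (a t)).re) (Set.Ici 0) t := by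
  rw [← energy_pairing]
  exact hasDerivWithinAt_weighted_sum (fun k => (k : ℝ) ^ (2 * s)) (h.real t ht) (h.deriv t ht)

lemma eq_of_hasDerivWithinAt_zero {f : ℝ → ℝ}
    (h : ∀ t, 0 ≤ t → HasDerivWithinAt f 0 (Set.Ici 0) t) {t : ℝ} (ht : 0 ≤ t) : f t = f 0 := by
  refine constant_of_has_deriv_right_zero (a := 0) (b := t)
    (fun x hx => (h x hx.1).continuousWithinAt.mono Set.Icc_subset_Ici_self)
    (fun x hx => (h x hx.1).mono (Set.Ici_subset_Ici.2 hx.1)) t ⟨ht, le_rfl⟩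

/-- For `s = 0` the symmetrised symbol is `j + n + m = 0`. -/
lemma IsGalerkin.mass_eq {N : ℕ} {a : ℝ → ℤ → ℂ} (h : IsGalerkin N a) {t : ℝ} (ht : 0 ≤ t) :
    ∑ k ∈ box N, ‖a t k‖ ^ 2 = ∑ k ∈ box N, ‖a 0 k‖ ^ 2 := by
  refine eq_of_hasDerivWithinAt_zero (f := fun t => ∑ k ∈ box N, ‖a t k‖ ^ 2) (fun t ht => ?_) ht
  have h1 := h.hasDerivWithinAt_energy 0 ht
  rw [trilin_zero_symbol] at h1
  · simpa using h1
  · intro j n m h0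
    simp only [mul_zero, zero_add, pow_one]
    exact_mod_cast h0

lemma IsGalerkin.energy_le {N : ℕ} {a : ℝ → ℤ → ℂ} (h : IsGalerkin N a) (s : ℕ) {M T t : ℝ}
    (hM : ∀ t ∈ Set.Icc 0 T, wnorm N 1 (a t) ≤ M) (ht : t ∈ Set.Icc 0 T) :
    ∑ k ∈ box N, (k : ℝ) ^ (2 * s) * ‖a t k‖ ^ 2
      ≤ Real.exp (((2 * s + 1) * 2 ^ s + 1) * M * t)
        * ∑ k ∈ box N, (k : ℝ) ^ (2 * s) * ‖a 0 k‖ ^ 2 := by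
  have hd := fun t ht => h.hasDerivWithinAt_energy s (t := t) ht
  refine le_exp_mul_of_deriv_le (f := fun t => ∑ k ∈ box N, (k : ℝ) ^ (2 * s) * ‖a t k‖ ^ 2)
    (fun x hx => (hd x hx.1).continuousWithinAt.mono Set.Icc_subset_Ici_self)
    (fun t ht => (hd t ht.1.le).hasDerivAt (Ici_mem_nhds ht.1)) (fun t ht => ?_) ht
  have h1 := norm_trilin_pow_le N s (a t)
  set X := trilin N (fun j n m => (j : ℂ) ^ (2 * s + 1) + (n : ℂ) ^ (2 * s + 1)
        + (m : ℂ) ^ (2 * s + 1)) (a t) (a t) (a t)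
  have h2 : (Complex.I / 6 * X).re ≤ ‖X‖ / 6 := by
    refine (Complex.re_le_norm _).trans_eq ?_
    rw [norm_mul, norm_div, Complex.norm_I]
    norm_num; ring
  have hE : 0 ≤ ∑ k ∈ box N, (k : ℝ) ^ (2 * s) * ‖a t k‖ ^ 2 :=
    Finset.sum_nonneg fun k _ => mul_nonneg (by rw [pow_mul]; positivity) (sq_nonneg _)
  have h3 := mul_le_mul_of_nonneg_left (mul_le_mul_of_nonneg_right
    (hM t (Set.Ioo_subset_Icc_self ht)) hE)
    (show (0 : ℝ) ≤ (2 * s + 1) * 2 ^ s + 1 by positivity)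
  linarith

/-- The Hamiltonian `∑ (a_j a_n a_m) / 6 - ½ ∑ (k² + k⁴) |a_k|²`. -/
def hamiltonian (N : ℕ) (a : ℤ → ℂ) : ℝ :=
  (trilin N 1 a a a).re / 6 - (∑ k ∈ box N, ((k : ℝ) ^ 2 + (k : ℝ) ^ 4) * ‖a k‖ ^ 2) / 2

/-- The truncated system is still Hamiltonian: `b' = -i k g` inside the box, with `g` the gradient
of the Hamiltonian, and `-i k` is skew. -/
lemma IsGalerkin.hamiltonian_eq {N : ℕ} {a : ℝ → ℤ → ℂ} (h : IsGalerkin N a) {t : ℝ}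
    (ht : 0 ≤ t) : hamiltonian N (a t) = hamiltonian N (a 0) := by
  refine eq_of_hasDerivWithinAt_zero (f := fun t => hamiltonian N (a t)) (fun t ht => ?_) ht
  set b := a t with hb
  set b' : ℤ → ℂ := fun k => disp k * b k + bil N b b k with hb'
  have h1 := HasDerivWithinAt.trilin (s := Set.Ici 0) (t := t) 1 (h.deriv t ht) (h.deriv t ht)
    (h.deriv t ht)
  have h2 := hasDerivWithinAt_weighted_sum (fun k => (k : ℝ) ^ 2 + (k : ℝ) ^ 4) (h.real t ht)
    (h.deriv t ht)
  have h3 := (Complex.reCLM.hasFDerivAt.comp_hasDerivWithinAt t h1)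
  refine ((h3.div_const 6).sub (h2.div_const 2)).congr_deriv ?_
  rw [← hb] at *
  change (trilin N 1 b' b b + trilin N 1 b b' b + trilin N 1 b b b').re / 6 - _ = 0
  have e1 : trilin N 1 b' b b = trilin N 1 b b b' := trilin_swap₁₃ N 1 b' b b
  have e2 : trilin N 1 b b' b = trilin N 1 b b b' := trilin_swap₂₃ N 1 b b' b
  have e3 : trilin N 1 b b b' = pairing N (conv N b b) b' := by
    have := pairing_mul_conv N (fun _ => (1 : ℂ)) b b b'
    simp only [one_mul] at this
    exact this.symm
  have e4 : pairing N (fun k => (((k : ℝ) ^ 2 + (k : ℝ) ^ 4 : ℝ) : ℂ) * b' k) b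
      = pairing N (fun k => ((k : ℂ) ^ 2 + (k : ℂ) ^ 4) * b k) b' := by
    rw [pairing_comm N _ b']
    refine Finset.sum_congr rfl fun k _ => ?_
    push_cast; ring
  set g : ℤ → ℂ := fun k => (1 / 2) * conv N b b k + (-1) * (((k : ℂ) ^ 2 + (k : ℂ) ^ 4) * b k)
  have e5 : (1 / 2) * pairing N (conv N b b) b'
      + (-1) * pairing N (fun k => ((k : ℂ) ^ 2 + (k : ℂ) ^ 4) * b k) b' = 0 := by
    rw [← pairing_smul_left, ← pairing_smul_left, ← pairing_add_left, pairing_comm]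
    have : pairing N b' g = pairing N (fun k => -(Complex.I * k) * g k) g :=
      pairing_congr g fun k _ => by simp only [hb', g, disp, bil]; ring
    rw [show (fun k => (1 / 2) * conv N b b k + (-1) * (((k : ℂ) ^ 2 + (k : ℂ) ^ 4) * b k)) = g
      from rfl, this]
    exact pairing_odd_eq_zero N (fun k => by push_cast; ring) g
  rw [e1, e2, e3]
  have e6 := congrArg Complex.re e5
  change _ - 2 * (pairing N (fun k => (((k : ℝ) ^ 2 + (k : ℝ) ^ 4 : ℝ) : ℂ) * b' k) b).re / 2 = 0
  rw [e4]
  have e7 : ((1 / 2 : ℂ) * pairing N (conv N b b) b').re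
      = (1 / 2) * (pairing N (conv N b b) b').re := by
    have := Complex.re_ofReal_mul (1 / 2) (pairing N (conv N b b) b')
    push_cast at this; exact this
  rw [Complex.add_re, e7, neg_one_mul, Complex.neg_re, Complex.zero_re] at e6
  simp only [Complex.add_re]
  linarith

lemma norm_trilin_one_le (N : ℕ) (a : ℤ → ℂ) :
    ‖trilin N 1 a a a‖ ≤ wnorm N 0 a * ∑ k ∈ box N, ‖a k‖ ^ 2 := by
  have := norm_trilin_le N (σ := 1) (a := a) (b := a) (c := a) (x := fun k => ‖a k‖)
    (y := fun k => ‖a k‖) (z := fun k => ‖a k‖) (fun _ => norm_nonneg _)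
    (fun j _ n _ m _ _ => by simp)
  refine this.trans_eq ?_
  rw [mul_right_comm, Real.mul_self_sqrt (Finset.sum_nonneg fun _ _ => sq_nonneg _), mul_comm]
  simp [wnorm]

/-- The quadratic part of the Hamiltonian dominates its cubic part once the mass is fixed, so the
two conservation laws bound two derivatives for all time. -/
lemma IsGalerkin.sum_pow_four_le {N : ℕ} {a : ℝ → ℤ → ℂ} (h : IsGalerkin N a) {D t : ℝ}
    (hD : ∑ k ∈ box N, bra k ^ 4 * ‖a 0 k‖ ^ 2 ≤ D) (ht : 0 ≤ t) :
    ∑ k ∈ box N, (k : ℝ) ^ 4 * ‖a t k‖ ^ 2 ≤ braConst * D ^ 2 + 8 * D := by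
  set κ := braConst
  have hκ : 0 < κ := braConst_pos
  have key : ∀ b : ℤ → ℂ, ‖trilin N 1 b b b‖ ≤ (∑ k ∈ box N, ‖b k‖ ^ 2
      + ∑ k ∈ box N, (k : ℝ) ^ 2 * ‖b k‖ ^ 2) * 2 + κ * (∑ k ∈ box N, ‖b k‖ ^ 2) ^ 2 / 2 := by
    intro b
    set Z := ∑ k ∈ box N, ‖b k‖ ^ 2
    have h1 := wnorm_sq_le N 0 b
    have h2 := sum_bra_pow_le N 1 b
    simp only [mul_zero, zero_add, mul_one] at h1 h2
    have h3 := norm_trilin_one_le N b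
    set A := wnorm N 0 b
    have h4 := h1.trans (mul_le_mul_of_nonneg_left h2 hκ.le)
    -- Young's weight is chosen so that the `k²` energy has coefficient 2; after the factor 1/6 in
    -- the Hamiltonian it is 1/3, below the available 1/2.
    have h5 : A * Z ≤ A ^ 2 / (2 * κ) + κ * Z ^ 2 / 2 := by
      have e : A ^ 2 / (2 * κ) + κ * Z ^ 2 / 2 - A * Z = (A - κ * Z) ^ 2 / (2 * κ) := by
        field_simp; ring
      have : 0 ≤ (A - κ * Z) ^ 2 / (2 * κ) := by positivity
      linarith
    have h6 : A ^ 2 / (2 * κ) ≤ (Z + ∑ k ∈ box N, (k : ℝ) ^ 2 * ‖b k‖ ^ 2) * 2 := by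
      rw [div_le_iff₀ (by positivity)]
      linarith
    linarith
  have hsum : ∀ b : ℤ → ℂ, ∑ k ∈ box N, ((k : ℝ) ^ 2 + (k : ℝ) ^ 4) * ‖b k‖ ^ 2
      = ∑ k ∈ box N, (k : ℝ) ^ 2 * ‖b k‖ ^ 2 + ∑ k ∈ box N, (k : ℝ) ^ 4 * ‖b k‖ ^ 2 := fun b => by
    rw [← Finset.sum_add_distrib]
    exact Finset.sum_congr rfl fun k _ => by ring
  have hZ := h.mass_eq ht
  have hH := h.hamiltonian_eq ht
  unfold hamiltonian at hH
  rw [hsum, hsum] at hH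
  have k1 := key (a t)
  have k0 := key (a 0)
  rw [hZ] at k1
  have d0 := (sum_pow_le_sum_bra_pow N (s := 0) (s' := 4) (by norm_num) (a 0)).trans hD
  have d2 := (sum_pow_le_sum_bra_pow N (s := 1) (s' := 4) (by norm_num) (a 0)).trans hD
  have d4 := (sum_pow_le_sum_bra_pow N (s := 2) (s' := 4) (by norm_num) (a 0)).trans hD
  norm_num at d0 d2 d4
  have r1 := (Complex.re_le_norm (trilin N 1 (a t) (a t) (a t)))
  have r0 := (abs_le.1 (Complex.abs_re_le_norm (trilin N 1 (a 0) (a 0) (a 0)))).1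
  set Z := ∑ k ∈ box N, ‖a 0 k‖ ^ 2
  have hZ0 : 0 ≤ Z := Finset.sum_nonneg fun _ _ => sq_nonneg _
  have hZ2 : κ * Z ^ 2 ≤ κ * D ^ 2 := by gcongr
  have hZ3 : 0 ≤ κ * Z ^ 2 := by positivity
  have hY : 0 ≤ ∑ k ∈ box N, (k : ℝ) ^ 2 * ‖a t k‖ ^ 2 :=
    Finset.sum_nonneg fun _ _ => by positivity
  linarith

/-- Uniform `A_15` bound for Galerkin solutions with data bounded in `H^16`. -/
lemma exists_wnorm_bound (D T : ℝ) : ∃ M : ℝ, 0 < M ∧ ∀ (N : ℕ) (a : ℝ → ℤ → ℂ),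
    IsGalerkin N a → ∑ k ∈ box N, bra k ^ 32 * ‖a 0 k‖ ^ 2 ≤ D →
      ∀ t ∈ Set.Icc 0 T, wnorm N 15 (a t) ≤ M := by
  set κ := braConst
  have hκ : 0 < κ := braConst_pos
  -- `M₁` bounds `wnorm N 1` by means of the conserved quantities alone; it is the Gronwall rate for
  -- the energy with `s = 16` inside `Q`.
  set M₁ := Real.sqrt (κ * (2 ^ 4 * (D + (κ * D ^ 2 + 8 * D))))
  set Q := κ * (2 ^ 32 * (D + Real.exp (((2 * (16 : ℕ) + 1) * 2 ^ 16 + 1) * M₁ * T) * D))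
  refine ⟨Real.sqrt Q + 1, by positivity, fun N a h hD t ht => ?_⟩
  have hD0 : 0 ≤ D := (Finset.sum_nonneg fun k _ => by
    have := bra_pos k; positivity).trans hD
  have hD4 : ∑ k ∈ box N, bra k ^ 4 * ‖a 0 k‖ ^ 2 ≤ D :=
    (Finset.sum_le_sum fun k _ => mul_le_mul_of_nonneg_right
      (pow_le_pow_right₀ (one_le_bra k) (by norm_num)) (sq_nonneg _)).trans hD
  have d0 := (sum_pow_le_sum_bra_pow N (s := 0) (s' := 32) (by norm_num) (a 0)).trans hD
  have d16 := (sum_pow_le_sum_bra_pow N (s := 16) (s' := 32) (by norm_num) (a 0)).trans hD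
  simp only [mul_zero, pow_zero, one_mul] at d0
  have hM₁ : ∀ t ∈ Set.Icc 0 T, wnorm N 1 (a t) ≤ M₁ := fun t ht => by
    refine Real.le_sqrt_of_sq_le ((wnorm_sq_le N 1 (a t)).trans
      (mul_le_mul_of_nonneg_left ((sum_bra_pow_le N 2 (a t)).trans ?_) hκ.le))
    refine mul_le_mul_of_nonneg_left (add_le_add ?_ (h.sum_pow_four_le hD4 ht.1)) (by positivity)
    rw [h.mass_eq ht.1]; exact d0
  refine (Real.le_sqrt_of_sq_le ((wnorm_sq_le N 15 (a t)).trans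
    (mul_le_mul_of_nonneg_left ((sum_bra_pow_le N 16 (a t)).trans ?_) hκ.le))).trans
    (le_add_of_nonneg_right zero_le_one)
  refine mul_le_mul_of_nonneg_left (add_le_add ?_ ?_) (by positivity)
  · rw [h.mass_eq ht.1]; exact d0
  · refine (h.energy_le 16 hM₁ ht).trans ?_
    have hs : 0 ≤ ∑ k ∈ box N, (k : ℝ) ^ (2 * 16) * ‖a 0 k‖ ^ 2 :=
      Finset.sum_nonneg fun k _ => mul_nonneg (by rw [pow_mul]; positivity) (sq_nonneg _)
    have hM0 : 0 ≤ M₁ := Real.sqrt_nonneg _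
    have := ht.2
    gcongr

/-! ### Estimates for the dispersion and the bilinear term. -/

lemma norm_intCast_complex (k : ℤ) : ‖(k : ℂ)‖ = |(k : ℝ)| := by
  rw [← Complex.ofReal_intCast, Complex.norm_real, Real.norm_eq_abs]

lemma norm_bil_le (K : ℕ) (a b : ℤ → ℂ) (k : ℤ) : ‖bil K a b k‖ ≤ bra k / 2 * ‖conv K a b k‖ := by
  unfold bil
  rw [norm_mul, norm_neg, norm_div, norm_mul, Complex.norm_I, one_mul, norm_intCast_complex]
  norm_num
  have := abs_le_bra k
  gcongr

lemma wnorm_bil_le (K s : ℕ) (a b : ℤ → ℂ) :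
    wnorm K s (bil K a b) ≤ wnorm K (s + 1) a * wnorm K (s + 1) b := by
  refine le_trans (Finset.sum_le_sum fun k _ => ?_) (wnorm_conv_le K (s + 1) a b)
  have h := norm_bil_le K a b k
  have h1 := bra_pos k
  calc bra k ^ s * ‖bil K a b k‖ ≤ bra k ^ s * (bra k * ‖conv K a b k‖) := by
        gcongr
        refine h.trans ?_
        have := norm_nonneg (conv K a b k)
        gcongr
        linarith
    _ = _ := by ring

lemma norm_disp_le (k : ℤ) : ‖disp k‖ ≤ 2 * bra k ^ 5 := by
  unfold disp
  rw [norm_mul, Complex.norm_I, one_mul]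
  refine (norm_add_le _ _).trans ?_
  rw [norm_pow, norm_pow, norm_intCast_complex]
  have h3 := (pow_le_pow_left₀ (abs_nonneg _) (abs_le_bra k) 3).trans
    (pow_le_pow_right₀ (one_le_bra k) (show 3 ≤ 5 by norm_num))
  have h5 := pow_le_pow_left₀ (abs_nonneg _) (abs_le_bra k) 5
  linarith

lemma wnorm_disp_le (K s : ℕ) (a : ℤ → ℂ) :
    wnorm K s (fun k => disp k * a k) ≤ 2 * wnorm K (s + 5) a := by
  unfold wnorm
  rw [Finset.mul_sum]
  refine Finset.sum_le_sum fun k _ => ?_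
  rw [norm_mul]
  have h := norm_disp_le k
  have h1 := bra_pos k
  calc _ ≤ bra k ^ s * ((2 * bra k ^ 5) * ‖a k‖) := by gcongr
    _ = _ := by ring

lemma bil_comm (K : ℕ) (a b : ℤ → ℂ) (k : ℤ) : bil K a b k = bil K b a k := by
  rw [bil, bil, conv_comm]

lemma bil_add_left (K : ℕ) (a a' b : ℤ → ℂ) (k : ℤ) :
    bil K (fun k => a k + a' k) b k = bil K a b k + bil K a' b k := by
  rw [bil, bil, bil, conv_add_left, mul_add]

lemma bil_add_right (K : ℕ) (a b b' : ℤ → ℂ) (k : ℤ) :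
    bil K a (fun k => b k + b' k) k = bil K a b k + bil K a b' k := by
  rw [bil, bil, bil, conv_add_right, mul_add]

lemma bil_sub_left (K : ℕ) (a a' b : ℤ → ℂ) (k : ℤ) :
    bil K (fun k => a k - a' k) b k = bil K a b k - bil K a' b k := by
  rw [bil, bil, bil, conv_sub_left, mul_sub]

lemma bil_sub_right (K : ℕ) (a b b' : ℤ → ℂ) (k : ℤ) :
    bil K a (fun k => b k - b' k) k = bil K a b k - bil K a b' k := by
  rw [bil, bil, bil, conv_sub_right, mul_sub]

lemma bil_smul_left (K : ℕ) (r : ℂ) (a b : ℤ → ℂ) (k : ℤ) :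
    bil K (fun k => r * a k) b k = r * bil K a b k := by
  rw [bil, bil, conv_smul_left]; ring

lemma bil_smul_right (K : ℕ) (r : ℂ) (a b : ℤ → ℂ) (k : ℤ) :
    bil K a (fun k => r * b k) k = r * bil K a b k := by
  rw [bil, bil, conv_smul_right]; ring

lemma bil_congr {K : ℕ} {a b a' b' : ℤ → ℂ} (ha : ∀ k ∈ box K, a k = a' k)
    (hb : ∀ k ∈ box K, b k = b' k) (k : ℤ) : bil K a b k = bil K a' b' k := by
  rw [bil, bil, conv_congr K ha hb]

lemma HasDerivWithinAt.bil {K : ℕ} {a b : ℝ → ℤ → ℂ} {a' b' : ℤ → ℂ} {s : Set ℝ} {t : ℝ}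
    (ha : ∀ k ∈ box K, HasDerivWithinAt (fun t => a t k) (a' k) s t)
    (hb : ∀ k ∈ box K, HasDerivWithinAt (fun t => b t k) (b' k) s t) (k : ℤ) :
    HasDerivWithinAt (fun t => bil K (a t) (b t) k)
      (bil K a' (b t) k + bil K (a t) b' k) s t :=
  ((HasDerivWithinAt.conv ha hb k).const_mul _).congr_deriv (by
    simp only [Kawahara.bil]; ring)

lemma HasDerivWithinAt.pairing_const {K : ℕ} {a : ℝ → ℤ → ℂ} {a' : ℤ → ℂ} {s : Set ℝ} {t : ℝ}
    (ha : ∀ k ∈ box K, HasDerivWithinAt (fun t => a t k) (a' k) s t) (e : ℤ → ℂ) :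
    HasDerivWithinAt (fun t => pairing K (a t) e) (pairing K a' e) s t :=
  HasDerivWithinAt.fun_sum fun k hk => (ha k hk).mul_const _

lemma trilin_self_eq_zero (K : ℕ) (a : ℤ → ℂ) : trilin K (fun _ _ m => (m : ℂ)) a a a = 0 := by
  have h := three_mul_trilin_self K (fun m => (m : ℂ)) a
  rw [trilin_zero_symbol (σ := fun j n m : ℤ => (j : ℂ) + n + m)
    (fun j n m h0 => by exact_mod_cast h0)] at h
  simpa using h

/-- Integration by parts: with `e` in two slots the symbol `m` averages to `(n + m)/2 = -j/2`, so
the derivative falls on `b` and `e` loses none. -/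
lemma norm_pairing_bil_self_le (K : ℕ) (b e : ℤ → ℂ) :
    ‖pairing K (bil K b e) e‖ ≤ wnorm K 1 b * l2 K e ^ 2 / 4 := by
  have h1 : 2 * trilin K (fun _ _ m => (m : ℂ)) b e e = trilin K (fun j _ _ => -(j : ℂ)) b e e := by
    have h2 := trilin_swap₂₃ K (fun _ _ m => (m : ℂ)) b e e
    have h3 := trilin_add_symbol K (fun _ n _ => (n : ℂ)) (fun _ _ m => (m : ℂ)) b e e
    rw [two_mul]
    nth_rw 1 [h2]
    rw [← h3]
    refine trilin_congr K fun j _ n _ m _ h0 => ?_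
    have : (j : ℂ) + n + m = 0 := by exact_mod_cast h0
    rw [show (n : ℂ) + m = -j by linear_combination this]
  have h4 : ‖trilin K (fun j _ _ => -(j : ℂ)) b e e‖ ≤ wnorm K 1 b * l2 K e ^ 2 := by
    rw [trilin_swap₁₂]
    refine (norm_trilin_le K (x := fun k => ‖e k‖) (y := fun k => bra k ^ 1 * ‖b k‖)
      (z := fun k => ‖e k‖) (fun k => by have := bra_pos k; positivity)
      (fun j _ n _ m _ _ => ?_)).trans_eq ?_
    · rw [norm_mul, norm_mul, norm_mul, norm_neg, norm_intCast_complex, pow_one]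
      have := abs_le_bra n
      calc _ ≤ bra n * (‖e j‖ * ‖b n‖ * ‖e m‖) := by gcongr
        _ = _ := by ring
    · rw [mul_right_comm, ← l2, wnorm]; ring
  rw [pairing_bil, norm_mul, norm_div, Complex.norm_I]
  have h5 : ‖trilin K (fun _ _ m => (m : ℂ)) b e e‖
      = ‖trilin K (fun j _ _ => -(j : ℂ)) b e e‖ / 2 := by
    rw [← h1, norm_mul]; norm_num
  rw [h5]
  norm_num
  linarith

/-! ### Consistency of the Crank–Nicolson scheme. -/

lemma trapezoid_error {φ φ₁ φ₂ φ₃ : ℝ → ℂ} {t₀ τ C : ℝ} (hτ : 0 ≤ τ)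
    (h1 : ∀ t ∈ Set.Icc t₀ (t₀ + τ), HasDerivWithinAt φ (φ₁ t) (Set.Icc t₀ (t₀ + τ)) t)
    (h2 : ∀ t ∈ Set.Icc t₀ (t₀ + τ), HasDerivWithinAt φ₁ (φ₂ t) (Set.Icc t₀ (t₀ + τ)) t)
    (h3 : ∀ t ∈ Set.Icc t₀ (t₀ + τ), HasDerivWithinAt φ₂ (φ₃ t) (Set.Icc t₀ (t₀ + τ)) t)
    (hC : ∀ t ∈ Set.Icc t₀ (t₀ + τ), ‖φ₃ t‖ ≤ C) :
    ‖φ (t₀ + τ) - φ t₀ - τ / 2 * (φ₁ t₀ + φ₁ (t₀ + τ))‖ ≤ C / 2 * τ ^ 3 := by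
  set I := Set.Icc t₀ (t₀ + τ)
  have hC0 : 0 ≤ C := (norm_nonneg _).trans (hC t₀ ⟨le_rfl, by linarith⟩)
  have hid : ∀ t ∈ I, HasDerivWithinAt (fun t : ℝ => ((t - t₀ : ℝ) : ℂ)) 1 I t := fun t _ => by
    simpa using (((hasDerivAt_id t).sub_const t₀).ofReal_comp).hasDerivWithinAt
  -- `g` is the trapezoidal error as a function of the right endpoint. It and `g₁` vanish at `t₀`,
  -- so two mean value bounds starting from `g₂` suffice.
  set g : ℝ → ℂ := fun t => φ t - φ t₀ - ((t - t₀ : ℝ) : ℂ) * (φ₁ t₀ + φ₁ t) / 2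
  set g₁ : ℝ → ℂ := fun t => (φ₁ t - φ₁ t₀) / 2 - ((t - t₀ : ℝ) : ℂ) * φ₂ t / 2
  set g₂ : ℝ → ℂ := fun t => -(((t - t₀ : ℝ) : ℂ) * φ₃ t / 2)
  have hg : ∀ t ∈ I, HasDerivWithinAt g (g₁ t) I t := fun t ht =>
    (((h1 t ht).sub_const _).sub ((((hid t ht).mul ((h2 t ht).const_add _))).div_const 2)).congr_deriv
      (by simp only [g₁]; ring)
  have hg₁ : ∀ t ∈ I, HasDerivWithinAt g₁ (g₂ t) I t := fun t ht =>
    ((((h2 t ht).sub_const _).div_const 2).sub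
      ((((hid t ht).mul (h3 t ht))).div_const 2)).congr_deriv (by simp only [g₂]; ring)
  have b2 : ∀ t ∈ I, ‖g₂ t‖ ≤ C / 2 * τ := fun t ht => by
    simp only [g₂]
    rw [norm_neg, norm_div, norm_mul, Complex.norm_real, Real.norm_of_nonneg (by linarith [ht.1])]
    norm_num
    have := hC t ht
    have h4 : t - t₀ ≤ τ := by linarith [ht.2]
    have h5 : 0 ≤ t - t₀ := by linarith [ht.1]
    calc (t - t₀) * ‖φ₃ t‖ / 2 ≤ τ * C / 2 := by gcongr
      _ = _ := by ring
  have b1 : ∀ t ∈ I, ‖g₁ t‖ ≤ C / 2 * τ * τ := fun t ht => by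
    have := norm_image_sub_le_of_norm_deriv_le_segment' hg₁
      (fun x hx => b2 x (Set.Ico_subset_Icc_self hx)) t ht
    have h0 : g₁ t₀ = 0 := by simp [g₁]
    rw [h0, sub_zero] at this
    refine this.trans (mul_le_mul_of_nonneg_left (by linarith [ht.2]) (by positivity))
  have := norm_image_sub_le_of_norm_deriv_le_segment' hg
      (fun x hx => b1 x (Set.Ico_subset_Icc_self hx)) (t₀ + τ) ⟨by linarith, le_rfl⟩
  have h0 : g t₀ = 0 := by simp [g]
  rw [h0, sub_zero] at this
  calc _ = ‖g (t₀ + τ)‖ := by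
        congr 1; simp only [g]; push_cast; ring
    _ ≤ _ := this
    _ = _ := by ring

/-- First time derivative of a Galerkin solution. -/
def galD₁ (N : ℕ) (a : ℤ → ℂ) (k : ℤ) : ℂ := disp k * a k + bil N a a k

/-- Second time derivative of a Galerkin solution. -/
def galD₂ (N : ℕ) (a : ℤ → ℂ) (k : ℤ) : ℂ :=
  disp k * galD₁ N a k + (bil N (galD₁ N a) a k + bil N a (galD₁ N a) k)

/-- Third time derivative of a Galerkin solution. -/
def galD₃ (N : ℕ) (a : ℤ → ℂ) (k : ℤ) : ℂ :=
  disp k * galD₂ N a k + ((bil N (galD₂ N a) a k + bil N (galD₁ N a) (galD₁ N a) k)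
    + (bil N (galD₁ N a) (galD₁ N a) k + bil N a (galD₂ N a) k))

/-- A time derivative costs five weights through `disp` and only one through `bil`; hence the ladder
15, 10, 5, 0 in this and the next two lemmas. -/
lemma wnorm_galD₁_le {N : ℕ} {a : ℤ → ℂ} {M : ℝ} (h : wnorm N 15 a ≤ M) :
    wnorm N 10 (galD₁ N a) ≤ 2 * M + M ^ 2 := by
  have hM : 0 ≤ M := (wnorm_nonneg _ _ _).trans h
  have h1 := wnorm_disp_le N 10 a
  have h2 := wnorm_bil_le N 10 a a
  have h3 := (wnorm_mono N (show 11 ≤ 15 by norm_num) a).trans h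
  have h4 := mul_le_mul h3 h3 (wnorm_nonneg _ _ _) hM
  norm_num at h1 h2
  refine (wnorm_add_le N 10 _ _).trans ?_
  linarith [sq M]

lemma wnorm_galD₂_le {N : ℕ} {a : ℤ → ℂ} {M M₁ : ℝ} (h : wnorm N 15 a ≤ M)
    (h' : wnorm N 10 (galD₁ N a) ≤ M₁) :
    wnorm N 5 (galD₂ N a) ≤ 2 * M₁ + 2 * M * M₁ := by
  have hM : 0 ≤ M := (wnorm_nonneg _ _ _).trans h
  have hM₁ : 0 ≤ M₁ := (wnorm_nonneg _ _ _).trans h'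
  have h1 := wnorm_disp_le N 5 (galD₁ N a)
  have h2 := wnorm_bil_le N 5 a (galD₁ N a)
  have h2' := wnorm_bil_le N 5 (galD₁ N a) a
  have h3 := (wnorm_mono N (show 6 ≤ 15 by norm_num) a).trans h
  have h3' := (wnorm_mono N (show 6 ≤ 10 by norm_num) (galD₁ N a)).trans h'
  have h4 := mul_le_mul h3 h3' (wnorm_nonneg _ _ _) hM
  norm_num at h1 h2 h2'
  refine (wnorm_add_le N 5 _ _).trans ?_
  have := wnorm_add_le N 5 (bil N (galD₁ N a) a) (bil N a (galD₁ N a))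
  linarith

lemma wnorm_galD₃_le {N : ℕ} {a : ℤ → ℂ} {M M₁ M₂ : ℝ} (h : wnorm N 15 a ≤ M)
    (h' : wnorm N 10 (galD₁ N a) ≤ M₁) (h'' : wnorm N 5 (galD₂ N a) ≤ M₂) :
    wnorm N 0 (galD₃ N a) ≤ 2 * M₂ + 2 * M * M₂ + 2 * M₁ ^ 2 := by
  have hM : 0 ≤ M := (wnorm_nonneg _ _ _).trans h
  have hM₁ : 0 ≤ M₁ := (wnorm_nonneg _ _ _).trans h'
  have h1 := wnorm_disp_le N 0 (galD₂ N a)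
  have h2 := wnorm_bil_le N 0 a (galD₂ N a)
  have h2' := wnorm_bil_le N 0 (galD₂ N a) a
  have h2'' := wnorm_bil_le N 0 (galD₁ N a) (galD₁ N a)
  have h3 := (wnorm_mono N (show 1 ≤ 15 by norm_num) a).trans h
  have h3' := (wnorm_mono N (show 1 ≤ 10 by norm_num) (galD₁ N a)).trans h'
  have h3'' := (wnorm_mono N (show 1 ≤ 5 by norm_num) (galD₂ N a)).trans h''
  have h4 := mul_le_mul h3 h3'' (wnorm_nonneg _ _ _) hM
  have h4' := mul_le_mul h3' h3' (wnorm_nonneg _ _ _) hM₁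
  norm_num at h1 h2 h2' h2''
  refine (wnorm_add_le N 0 _ _).trans ?_
  have e1 := wnorm_add_le N 0
    (fun k => bil N (galD₂ N a) a k + bil N (galD₁ N a) (galD₁ N a) k)
    (fun k => bil N (galD₁ N a) (galD₁ N a) k + bil N a (galD₂ N a) k)
  have e2 := wnorm_add_le N 0 (bil N (galD₂ N a) a) (bil N (galD₁ N a) (galD₁ N a))
  have e3 := wnorm_add_le N 0 (bil N (galD₁ N a) (galD₁ N a)) (bil N a (galD₂ N a))
  linarith [sq M₁]

lemma IsGalerkin.hasDerivWithinAt₁ {N : ℕ} {a : ℝ → ℤ → ℂ} (h : IsGalerkin N a) {t : ℝ}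
    (ht : 0 ≤ t) : ∀ k ∈ box N, HasDerivWithinAt (fun s => galD₁ N (a s) k) (galD₂ N (a t) k)
      (Set.Ici 0) t := fun k hk =>
  ((h.deriv t ht k hk).const_mul _).add (HasDerivWithinAt.bil (h.deriv t ht) (h.deriv t ht) k)

lemma IsGalerkin.hasDerivWithinAt₂ {N : ℕ} {a : ℝ → ℤ → ℂ} (h : IsGalerkin N a) {t : ℝ}
    (ht : 0 ≤ t) : ∀ k ∈ box N, HasDerivWithinAt (fun s => galD₂ N (a s) k) (galD₃ N (a t) k)
      (Set.Ici 0) t := fun k hk =>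
  ((h.hasDerivWithinAt₁ ht k hk).const_mul _).add
    ((HasDerivWithinAt.bil (h.hasDerivWithinAt₁ ht) (h.deriv t ht) k).add
      (HasDerivWithinAt.bil (h.deriv t ht) (h.hasDerivWithinAt₁ ht) k))

/-- The residual of a sequence in the Crank-Nicolson scheme. -/
def cnResidual (N : ℕ) (τ : ℝ) (a₀ a₁ : ℤ → ℂ) (k : ℤ) : ℂ :=
  a₁ k - a₀ k - τ * galD₁ N (fun k => 1 / 2 * (a₀ k + a₁ k)) k

/-- For a quadratic nonlinearity the midpoint and trapezoidal values differ exactly by a quarter of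
the form at the increment, and the increment is itself `O(τ)`. -/
lemma cnResidual_eq (N : ℕ) (τ : ℝ) (a₀ a₁ : ℤ → ℂ) (k : ℤ) :
    cnResidual N τ a₀ a₁ k = (a₁ k - a₀ k - τ / 2 * (galD₁ N a₀ k + galD₁ N a₁ k))
      + τ / 4 * bil N (fun k => a₁ k - a₀ k) (fun k => a₁ k - a₀ k) k := by
  simp only [cnResidual, galD₁, bil_smul_left, bil_smul_right, bil_add_left, bil_add_right,
    bil_sub_left, bil_sub_right]
  rw [bil_comm N a₁ a₀]
  ring

/-- Pairing with a fixed `e` makes the trapezoidal estimate scalar; the bound is linear in `l2 N e`,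
as the energy argument for the error requires. -/
lemma exists_cnResidual_bound (M : ℝ) : ∃ R : ℝ, 0 < R ∧ ∀ (N : ℕ) (a : ℝ → ℤ → ℂ) (T : ℝ),
    IsGalerkin N a → (∀ t ∈ Set.Icc 0 T, wnorm N 15 (a t) ≤ M) →
      ∀ t₀ τ : ℝ, 0 ≤ t₀ → 0 < τ → t₀ + τ ≤ T → ∀ e : ℤ → ℂ,
        ‖pairing N (cnResidual N τ (a t₀) (a (t₀ + τ))) e‖ ≤ R * τ ^ 3 * l2 N e := by
  set M₁ := 2 * M + M ^ 2
  set M₂ := 2 * M₁ + 2 * M * M₁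
  set M₃ := 2 * M₂ + 2 * M * M₂ + 2 * M₁ ^ 2
  set κ := braConst
  refine ⟨|M₃| / 2 + (M₁ * κ) ^ 2 / 4 + 1, by positivity, fun N a T h hM t₀ τ ht₀ hτ hT e => ?_⟩
  have hI : ∀ t ∈ Set.Icc t₀ (t₀ + τ), t ∈ Set.Icc 0 T := fun t ht =>
    ⟨ht₀.trans ht.1, ht.2.trans hT⟩
  have hsub : Set.Icc t₀ (t₀ + τ) ⊆ Set.Ici 0 := fun t ht => ht₀.trans ht.1
  have B₁ := fun t ht => wnorm_galD₁_le (hM t (hI t ht))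
  have B₂ := fun t ht => wnorm_galD₂_le (hM t (hI t ht)) (B₁ t ht)
  have B₃ := fun t ht => wnorm_galD₃_le (hM t (hI t ht)) (B₁ t ht) (B₂ t ht)
  have htrap := trapezoid_error (φ := fun t => pairing N (a t) e)
    (φ₁ := fun t => pairing N (galD₁ N (a t)) e) (φ₂ := fun t => pairing N (galD₂ N (a t)) e)
    (φ₃ := fun t => pairing N (galD₃ N (a t)) e) (C := M₃ * l2 N e) hτ.le
    (fun t ht => (HasDerivWithinAt.pairing_const (h.deriv t (hsub ht)) e).mono hsub)
    (fun t ht => (HasDerivWithinAt.pairing_const (h.hasDerivWithinAt₁ (hsub ht)) e).mono hsub)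
    (fun t ht => (HasDerivWithinAt.pairing_const (h.hasDerivWithinAt₂ (hsub ht)) e).mono hsub)
    (fun t ht => (norm_pairing_le N _ _).trans
      (mul_le_mul_of_nonneg_right ((l2_le_wnorm N 0 _).trans (B₃ t ht)) (l2_nonneg _ _)))
  set d : ℤ → ℂ := fun k => a (t₀ + τ) k - a t₀ k
  have hM₁ : 0 ≤ M₁ := (wnorm_nonneg _ _ _).trans (B₁ t₀ ⟨le_rfl, by linarith⟩)
  have hd : wnorm N 1 d ≤ τ * (M₁ * κ) := by
    have hk : ∀ k ∈ box N, bra k ^ 1 * ‖d k‖ ≤ τ * M₁ * (bra k ^ 2)⁻¹ := fun k hk => by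
      have hb := bra_pos k
      have h1 := norm_image_sub_le_of_norm_deriv_le_segment' (f := fun t => a t k)
        (f' := fun t => galD₁ N (a t) k) (C := M₁ * (bra k ^ 10)⁻¹) (a := t₀) (b := t₀ + τ)
        (fun t ht => (h.deriv t (hsub ht) k hk).mono hsub)
        (fun t ht => by
          rw [← div_eq_mul_inv, le_div_iff₀ (by positivity), mul_comm]
          exact (Finset.single_le_sum (f := fun k => bra k ^ 10 * ‖galD₁ N (a t) k‖)
            (fun k _ => by have := bra_pos k; positivity) hk).trans
            (B₁ t (Set.Ico_subset_Icc_self ht))) (t₀ + τ) ⟨by linarith, le_rfl⟩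
      rw [add_sub_cancel_left] at h1
      -- Three powers are enough: one pays for the weight in `wnorm N 1`, two make the sum over
      -- frequencies converge.
      have h2 : (bra k ^ 10)⁻¹ ≤ (bra k ^ 3)⁻¹ :=
        inv_anti₀ (by positivity) (pow_le_pow_right₀ (one_le_bra k) (by norm_num))
      calc bra k ^ 1 * ‖d k‖ ≤ bra k ^ 1 * (M₁ * (bra k ^ 3)⁻¹ * τ) := by
            have := h1.trans (mul_le_mul_of_nonneg_right
              (mul_le_mul_of_nonneg_left h2 hM₁) hτ.le)
            gcongr
        _ = _ := by field_simp
    refine (Finset.sum_le_sum hk).trans ?_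
    rw [← Finset.mul_sum, mul_assoc]
    have := sum_inv_bra_sq_le (box N)
    gcongr
  have hbil : ‖pairing N (bil N d d) e‖ ≤ (τ * (M₁ * κ)) ^ 2 * l2 N e := by
    refine (norm_pairing_le N _ _).trans (mul_le_mul_of_nonneg_right ?_ (l2_nonneg _ _))
    refine (l2_le_wnorm N 0 _).trans ((wnorm_bil_le N 0 d d).trans ?_)
    rw [sq]
    exact mul_le_mul hd hd (wnorm_nonneg _ _ _) ((wnorm_nonneg _ _ _).trans hd)
  have hsplit : pairing N (cnResidual N τ (a t₀) (a (t₀ + τ))) e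
      = (pairing N (a (t₀ + τ)) e - pairing N (a t₀) e
        - τ / 2 * (pairing N (galD₁ N (a t₀)) e + pairing N (galD₁ N (a (t₀ + τ))) e))
        + τ / 4 * pairing N (bil N d d) e := by
    simp only [pairing, ← Finset.sum_sub_distrib, ← Finset.sum_add_distrib, Finset.mul_sum]
    refine Finset.sum_congr rfl fun k _ => ?_
    rw [cnResidual_eq]; ring
  rw [hsplit]
  refine (norm_add_le _ _).trans ?_
  have e1 : ‖(τ : ℂ) / 4 * pairing N (bil N d d) e‖ ≤ τ / 4 * ((τ * (M₁ * κ)) ^ 2 * l2 N e) := by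
    rw [norm_mul, norm_div, Complex.norm_real, Real.norm_of_nonneg hτ.le]
    norm_num
    gcongr
  have e2 : M₃ * l2 N e / 2 * τ ^ 3 ≤ |M₃| * l2 N e / 2 * τ ^ 3 := by
    have := l2_nonneg N e
    have := le_abs_self M₃
    gcongr
  have e3 : 0 ≤ τ ^ 3 * l2 N e := mul_nonneg (by positivity) (l2_nonneg _ _)
  calc _ ≤ |M₃| * l2 N e / 2 * τ ^ 3 + τ / 4 * ((τ * (M₁ * κ)) ^ 2 * l2 N e) :=
        add_le_add (htrap.trans e2) e1
    _ = (|M₃| / 2 + (M₁ * κ) ^ 2 / 4) * (τ ^ 3 * l2 N e) := by ring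
    _ ≤ _ := by nlinarith

/-! ### Conservation and convergence of the Crank–Nicolson scheme. -/

/-- Coefficients of a Crank-Nicolson solution. -/
structure IsCNCoeff (N : ℕ) (τ : ℝ) (M : ℕ) (v : ℕ → ℤ → ℂ) : Prop where
  real : ∀ m, m ≤ M → IsRealCoeff (v m)
  step : ∀ m, m < M → ∀ k ∈ box N, cnResidual N τ (v m) (v (m + 1)) k = 0

lemma pairing_sub_half_add {K : ℕ} {a b : ℤ → ℂ} (ha : IsRealCoeff a) (hb : IsRealCoeff b) :
    pairing K (fun k => b k - a k) (fun k => 1 / 2 * (a k + b k))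
      = (((l2 K b ^ 2 - l2 K a ^ 2) / 2 : ℝ) : ℂ) := by
  have h1 : pairing K (fun k => b k - a k) (fun k => 1 / 2 * (a k + b k))
      = 1 / 2 * (pairing K b b + pairing K b a - pairing K a b - pairing K a a) := by
    simp only [pairing, ← Finset.sum_sub_distrib, ← Finset.sum_add_distrib, Finset.mul_sum]
    exact Finset.sum_congr rfl fun k _ => by ring
  rw [h1, pairing_comm K b a, ha.pairing_self, hb.pairing_self]
  push_cast; ring

lemma pairing_galD₁_self (N : ℕ) (a : ℤ → ℂ) : pairing N (galD₁ N a) a = 0 := by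
  unfold galD₁
  rw [pairing_add_left, pairing_odd_eq_zero N disp_neg, pairing_bil, trilin_self_eq_zero]
  simp

/-- Testing the step with the midpoint `w` turns the increment into half the difference of the
squared norms, while the vector field at `w` is orthogonal to `w`. -/
lemma IsCNCoeff.l2_eq {N : ℕ} {τ : ℝ} {M : ℕ} {v : ℕ → ℤ → ℂ} (h : IsCNCoeff N τ M v) :
    ∀ m, m ≤ M → l2 N (v m) = l2 N (v 0)
  | 0, _ => rfl
  | m + 1, hm => by
    rw [← h.l2_eq m (by omega)]
    have h1 := pairing_sub_half_add (K := N) (h.real m (by omega)) (h.real (m + 1) hm)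
    set w : ℤ → ℂ := fun k => 1 / 2 * (v m k + v (m + 1) k) with hw
    rw [pairing_congr (a' := fun k => (τ : ℂ) * galD₁ N w k) w (fun k hk => by
      have := h.step m (by omega) k hk
      rw [cnResidual, ← hw] at this
      linear_combination this), pairing_smul_left, pairing_galD₁_self, mul_zero] at h1
    have h2 : (l2 N (v (m + 1)) ^ 2 - l2 N (v m) ^ 2) / 2 = 0 := by exact_mod_cast h1.symm
    exact (pow_left_inj₀ (l2_nonneg _ _) (l2_nonneg _ _) two_ne_zero).1 (by linarith)

/-- One step of the error recursion for the Crank-Nicolson scheme. -/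
lemma cn_error_step {N : ℕ} {τ A R : ℝ} (hτ : 0 < τ) {a₀ a₁ v₀ v₁ : ℤ → ℂ}
    (ha₀ : IsRealCoeff a₀) (ha₁ : IsRealCoeff a₁) (hv₀ : IsRealCoeff v₀) (hv₁ : IsRealCoeff v₁)
    (hA₀ : wnorm N 1 a₀ ≤ A) (hA₁ : wnorm N 1 a₁ ≤ A) (hR : 0 ≤ R) (hτA : τ * A ≤ 2)
    (hv : ∀ k ∈ box N, cnResidual N τ v₀ v₁ k = 0)
    (ha : ∀ e : ℤ → ℂ, ‖pairing N (cnResidual N τ a₀ a₁) e‖ ≤ R * l2 N e) :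
    l2 N (fun k => v₁ k - a₁ k) ≤ (1 + τ * A) * l2 N (fun k => v₀ k - a₀ k) + 2 * R := by
  set e₀ : ℤ → ℂ := fun k => v₀ k - a₀ k
  set e₁ : ℤ → ℂ := fun k => v₁ k - a₁ k
  set x₀ := l2 N e₀
  set x₁ := l2 N e₁
  set α : ℤ → ℂ := fun k => 1 / 2 * (a₀ k + a₁ k) with hα
  set ε : ℤ → ℂ := fun k => 1 / 2 * (e₀ k + e₁ k) with hε
  have hA0 : 0 ≤ A := (wnorm_nonneg _ _ _).trans hA₀
  have h1 := pairing_sub_half_add (K := N) (hv₀.sub ha₀) (hv₁.sub ha₁)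
  have hvw : (fun k => 1 / 2 * (v₀ k + v₁ k)) = fun k => α k + ε k := by
    funext k; simp only [α, ε, e₀, e₁]; ring
  have h2 : ∀ k ∈ box N, e₁ k - e₀ k = τ * (disp k * ε k) + ((2 * τ) * bil N α ε k
      + (τ * bil N ε ε k + (-1) * cnResidual N τ a₀ a₁ k)) := fun k hk => by
    have := hv k hk
    simp only [cnResidual, hvw, galD₁, bil_add_left, bil_add_right, ← hα] at this ⊢
    rw [bil_comm N ε α] at this
    simp only [e₀, e₁]
    linear_combination this
  -- Dispersion and the self-interaction `bil N ε ε` pair to zero with `ε`, so no smallness of the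
  -- Crank–Nicolson error is needed.
  have h3 : pairing N (fun k => e₁ k - e₀ k) ε
      = (2 * τ) * pairing N (bil N α ε) ε - pairing N (cnResidual N τ a₀ a₁) ε := by
    rw [pairing_congr ε h2, pairing_add_left, pairing_add_left, pairing_add_left,
      pairing_smul_left, pairing_smul_left, pairing_smul_left, pairing_smul_left,
      pairing_odd_eq_zero N disp_neg, pairing_bil N ε ε ε, trilin_self_eq_zero]
    ring
  have hαA : wnorm N 1 α ≤ A := by
    have h4 : wnorm N 1 α = 1 / 2 * wnorm N 1 (fun k => a₀ k + a₁ k) := by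
      simp only [wnorm, α, Finset.mul_sum]
      refine Finset.sum_congr rfl fun k _ => ?_
      rw [norm_mul]; norm_num; ring
    have := wnorm_add_le N 1 a₀ a₁
    rw [h4]; linarith
  have hεx : l2 N ε ≤ (x₀ + x₁) / 2 := by
    have h4 := l2_smul N (1 / 2) (fun k => e₀ k + e₁ k)
    have := l2_add_le N e₀ e₁
    rw [show ‖(1 / 2 : ℂ)‖ = 1 / 2 by norm_num] at h4
    rw [hε, h4]; linarith
  have hx₀ : 0 ≤ x₀ := l2_nonneg _ _
  have hx₁ : 0 ≤ x₁ := l2_nonneg _ _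
  have hε0 := l2_nonneg N ε
  have h5 : (x₁ ^ 2 - x₀ ^ 2) / 2 ≤ τ * A / 2 * l2 N ε ^ 2 + R * l2 N ε := by
    have h6 : ‖pairing N (fun k => e₁ k - e₀ k) ε‖ ≤ τ * A / 2 * l2 N ε ^ 2 + R * l2 N ε := by
      rw [h3]
      refine (norm_sub_le _ _).trans (add_le_add ?_ (ha ε))
      rw [norm_mul, norm_mul, Complex.norm_real, Real.norm_of_nonneg hτ.le]
      norm_num
      have h7 := norm_pairing_bil_self_le N α ε
      calc 2 * τ * ‖pairing N (bil N α ε) ε‖ ≤ 2 * τ * (A * l2 N ε ^ 2 / 4) := by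
            gcongr
            refine h7.trans ?_
            gcongr
        _ = _ := by ring
    rw [h1, Complex.norm_real] at h6
    exact (le_abs_self _).trans h6
  by_cases h0 : x₀ + x₁ = 0
  · have : x₁ = 0 := by linarith
    rw [this]; positivity
  · have hpos : 0 < x₀ + x₁ := lt_of_le_of_ne (by positivity) (Ne.symm h0)
    have h8 : x₁ - x₀ ≤ τ * A / 4 * (x₀ + x₁) + R := by
      have h9 : (x₁ ^ 2 - x₀ ^ 2) / 2
          ≤ τ * A / 2 * ((x₀ + x₁) / 2) ^ 2 + R * ((x₀ + x₁) / 2) := by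
        refine h5.trans ?_
        gcongr
      have h10 : (x₀ + x₁) * (x₁ - x₀) ≤ (x₀ + x₁) * (τ * A / 4 * (x₀ + x₁) + R) := by
        nlinarith
      exact le_of_mul_le_mul_left h10 hpos
    set y := τ * A
    have hy : 0 ≤ y := by positivity
    -- With `y ≤ 2`, dividing by `1 - y/4 ≥ 1/2` turns `1 + y/4` into at most `1 + y` and at most
    -- doubles `R`.
    nlinarith [mul_nonneg hy hx₀, mul_nonneg hy hx₁, mul_nonneg hy hR]

/-- Second order convergence of the Crank-Nicolson scheme to the Galerkin solution. -/
lemma exists_cn_bound (A T : ℝ) (hA : 0 < A) (hT : 0 < T) : ∃ C : ℝ, 0 < C ∧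
    ∀ (N : ℕ) (a : ℝ → ℤ → ℂ) (τ : ℝ) (M : ℕ) (v : ℕ → ℤ → ℂ), IsGalerkin N a →
      (∀ t ∈ Set.Icc 0 T, wnorm N 15 (a t) ≤ A) → 0 < τ → τ * A ≤ 2 → M * τ = T →
      IsCNCoeff N τ M v → (∀ k ∈ box N, v 0 k = a 0 k) →
        ∀ m : ℕ, m ≤ M → l2 N (fun k => v m k - a (m * τ) k) ≤ C * τ ^ 2 := by
  obtain ⟨R, hR, hres⟩ := exists_cnResidual_bound A
  refine ⟨Real.exp (A * T) * (2 * R) * T, by positivity, ?_⟩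
  intro N a τ M v ha hbd hτ hτA hMT hv hinit
  have hmem : ∀ m : ℕ, m ≤ M → (m : ℝ) * τ ∈ Set.Icc 0 T := fun m hm =>
    ⟨by positivity, by rw [← hMT]; gcongr⟩
  have hrec : ∀ m : ℕ, m ≤ M → l2 N (fun k => v m k - a (m * τ) k)
      ≤ Real.exp (A * (m * τ)) * (m * (2 * (R * τ ^ 3))) := by
    intro m
    induction m with
    | zero =>
      intro _
      have : l2 N (fun k => v 0 k - a ((0 : ℕ) * τ) k) = l2 N (fun _ => 0) :=
        l2_congr fun k hk => by simp [hinit k hk]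
      rw [this]; simp [l2]
    | succ m ih =>
      intro hm
      have e : ((m + 1 : ℕ) : ℝ) * τ = m * τ + τ := by push_cast; ring
      have h1 := hmem m (by omega)
      have h2 := hmem (m + 1) hm
      have h15 := fun t ht => (wnorm_mono N (show 1 ≤ 15 by norm_num) (a t)).trans (hbd t ht)
      have hs := cn_error_step (N := N) (R := R * τ ^ 3) hτ (ha.real _ h1.1) (ha.real _ h2.1)
        (hv.real m (by omega)) (hv.real (m + 1) hm) (h15 _ h1) (h15 _ h2) (by positivity) hτA
        (hv.step m (by omega)) (fun f => by
          rw [e]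
          exact hres N a T ha hbd _ τ h1.1 hτ (by rw [← e]; exact h2.2) f)
      have hexp : 1 + τ * A ≤ Real.exp (τ * A) := by
        rw [add_comm]; exact Real.add_one_le_exp _
      have hS : 0 ≤ 2 * (R * τ ^ 3) := by positivity
      have h1e : 1 ≤ Real.exp (A * ((m + 1 : ℕ) * τ)) := Real.one_le_exp (by positivity)
      calc _ ≤ (1 + τ * A) * (Real.exp (A * (m * τ)) * (m * (2 * (R * τ ^ 3))))
              + 2 * (R * τ ^ 3) := hs.trans (by have := ih (by omega); gcongr)
        _ ≤ Real.exp (τ * A) * (Real.exp (A * (m * τ)) * (m * (2 * (R * τ ^ 3))))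
              + Real.exp (A * ((m + 1 : ℕ) * τ)) * (2 * (R * τ ^ 3)) := by
            refine add_le_add (mul_le_mul_of_nonneg_right hexp (by positivity)) ?_
            exact le_mul_of_one_le_left hS h1e
        _ = _ := by
            rw [← mul_assoc (Real.exp (τ * A)), ← Real.exp_add,
              show τ * A + A * (m * τ) = A * ((m + 1 : ℕ) * τ) by push_cast; ring]
            push_cast; ring
  intro m hm
  refine (hrec m hm).trans ?_
  have h1 := hmem m hm
  calc _ ≤ Real.exp (A * T) * (m * (2 * (R * τ ^ 3))) := by
        gcongr; exact h1.2
    _ = Real.exp (A * T) * (2 * R) * (m * τ) * τ ^ 2 := by ring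
    _ ≤ _ := by gcongr; exact h1.2

/-! ### Approximate Galerkin solutions and splitting at frequency `N`. -/

/-- Coefficients of an approximate Galerkin solution on `[0, T]` with residual `r`. -/
structure IsApproxGalerkin (N : ℕ) (T : ℝ) (a r : ℝ → ℤ → ℂ) : Prop where
  real : ∀ t ∈ Set.Icc 0 T, IsRealCoeff (a t)
  support : ∀ t ∈ Set.Icc 0 T, ∀ k ∉ box N, a t k = 0
  cont : ∀ k ∈ box N, ContinuousOn (fun t => a t k) (Set.Icc 0 T)
  deriv : ∀ t ∈ Set.Ioo 0 T, ∀ k ∈ box N, HasDerivAt (fun s => a s k)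
    (disp k * a t k + bil N (a t) (a t) k + r t k) t

/-- The restriction of a sequence to the box. -/
def low (N : ℕ) (f : ℤ → ℂ) (k : ℤ) : ℂ := if k ∈ box N then f k else 0

/-- The restriction of a sequence to the complement of the box. -/
def high (N : ℕ) (f : ℤ → ℂ) (k : ℤ) : ℂ := if k ∈ box N then 0 else f k

lemma IsRealCoeff.low {N : ℕ} {a : ℤ → ℂ} (ha : IsRealCoeff a) : IsRealCoeff (low N a) := by
  intro k
  simp only [Kawahara.low, neg_mem_box]
  split_ifs
  · exact ha k
  · simp

lemma norm_low_le (N : ℕ) (f : ℤ → ℂ) (k : ℤ) : ‖low N f k‖ ≤ ‖f k‖ := by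
  unfold low; split_ifs <;> simp

lemma wnorm_le_of_norm_le {K s : ℕ} {a b : ℤ → ℂ} (h : ∀ k ∈ box K, ‖a k‖ ≤ ‖b k‖) :
    wnorm K s a ≤ wnorm K s b :=
  Finset.sum_le_sum fun k hk =>
    mul_le_mul_of_nonneg_left (h k hk) (pow_nonneg (bra_pos k).le _)

lemma sum_box_eq_of_support {M : Type*} [AddCommMonoid M] {N K : ℕ} (h : N ≤ K) {f : ℤ → M}
    (hf : ∀ k ∉ box N, f k = 0) : ∑ k ∈ box K, f k = ∑ k ∈ box N, f k :=
  (Finset.sum_subset (box_mono h) fun k _ hk => hf k hk).symm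

lemma conv_eq_of_support {N K : ℕ} (h : N ≤ K) {a b : ℤ → ℂ} (ha : ∀ k ∉ box N, a k = 0)
    (hb : ∀ k ∉ box N, b k = 0) (k : ℤ) : conv K a b k = conv N a b k := by
  unfold conv
  rw [sum_box_eq_of_support h fun j hj => by simp [ha j hj]]
  exact Finset.sum_congr rfl fun j _ => sum_box_eq_of_support h fun n hn => by simp [hb n hn]

lemma l2_eq_of_support {N K : ℕ} (h : N ≤ K) {a : ℤ → ℂ} (ha : ∀ k ∉ box N, a k = 0) :
    l2 K a = l2 N a := by
  unfold l2
  rw [sum_box_eq_of_support h fun k hk => by simp [ha k hk]]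

lemma wnorm_eq_of_support {N K s : ℕ} (h : N ≤ K) {a : ℤ → ℂ} (ha : ∀ k ∉ box N, a k = 0) :
    wnorm K s a = wnorm N s a :=
  sum_box_eq_of_support h fun k hk => by simp [ha k hk]

/-! ### The normal form: nonresonance and smoothing. -/

/-- The symbol of the normal form transformation. -/
def nfSymbol (j n m : ℤ) : ℂ :=
  1 / ((j : ℂ) * n * (3 + 5 / 2 * ((j : ℂ) ^ 2 + (n : ℂ) ^ 2 + (m : ℂ) ^ 2)))

lemma nf_denominator_ne_zero (j n m : ℤ) :
    (3 + 5 / 2 * ((j : ℂ) ^ 2 + (n : ℂ) ^ 2 + (m : ℂ) ^ 2)) ≠ 0 := by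
  have h : ((3 + 5 / 2 * ((j : ℝ) ^ 2 + (n : ℝ) ^ 2 + (m : ℝ) ^ 2) : ℝ) : ℂ) ≠ 0 := by
    have : (0 : ℝ) < 3 + 5 / 2 * ((j : ℝ) ^ 2 + (n : ℝ) ^ 2 + (m : ℝ) ^ 2) := by positivity
    exact_mod_cast this.ne'
  push_cast at h
  exact h

/-- When `j + n + m = 0`, the cubes sum to `3jnm` and the fifth powers to `(5/2) jnm (j² + n² +
m²)`. The resonance function therefore factors, and `m = 0` is harmless because both sides carry
that factor. -/
lemma nfSymbol_mul_disp {j n m : ℤ} (h : j + n + m = 0) (hj : j ≠ 0) (hn : n ≠ 0) :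
    nfSymbol j n m * (disp j + disp n + disp m) = Complex.I * m := by
  have hq := nf_denominator_ne_zero j n m
  have hj' : (j : ℂ) ≠ 0 := by exact_mod_cast hj
  have hn' : (n : ℂ) ≠ 0 := by exact_mod_cast hn
  have hm : (m : ℂ) = -(j + n) := by
    have : (j : ℂ) + n + m = 0 := by exact_mod_cast h
    linear_combination this
  have e : disp j + disp n + disp m = Complex.I * m *
      (j * n * (3 + 5 / 2 * ((j : ℂ) ^ 2 + (n : ℂ) ^ 2 + (m : ℂ) ^ 2))) := by
    simp only [disp, hm]; ring
  rw [e, nfSymbol, one_div, mul_comm (Complex.I * (m : ℂ)),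
    inv_mul_cancel_left₀ (mul_ne_zero (mul_ne_zero hj' hn') hq)]

/-- As `|n| ≥ 1`, the denominator is at least `|j|³`, and `bra j ≤ 2|j|` accounts for the 8. -/
lemma norm_nfSymbol_mul_le {j n m : ℤ} (hj : j ≠ 0) (hn : n ≠ 0) :
    ‖nfSymbol j n m‖ * bra j ^ 3 ≤ 8 := by
  have hj1 : (1 : ℝ) ≤ |(j : ℝ)| := by exact_mod_cast Int.one_le_abs hj
  have hn1 : (1 : ℝ) ≤ |(n : ℝ)| := by exact_mod_cast Int.one_le_abs hn
  have hq : (0 : ℝ) < 3 + 5 / 2 * ((j : ℝ) ^ 2 + (n : ℝ) ^ 2 + (m : ℝ) ^ 2) := by positivity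
  have e : ‖nfSymbol j n m‖
      = 1 / (|(j : ℝ)| * |(n : ℝ)| * (3 + 5 / 2 * ((j : ℝ) ^ 2 + (n : ℝ) ^ 2 + (m : ℝ) ^ 2))) := by
    have : nfSymbol j n m = ((1 / ((j : ℝ) * n *
        (3 + 5 / 2 * ((j : ℝ) ^ 2 + (n : ℝ) ^ 2 + (m : ℝ) ^ 2))) : ℝ) : ℂ) := by
      rw [nfSymbol]; push_cast; rfl
    rw [this, Complex.norm_real, Real.norm_eq_abs, abs_div, abs_one, abs_mul, abs_mul,
      abs_of_pos hq]
  rw [e, div_mul_eq_mul_div, one_mul, div_le_iff₀ (by positivity)]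
  have h1 : bra j ≤ 2 * |(j : ℝ)| := by unfold bra; linarith
  calc bra j ^ 3 ≤ (2 * |(j : ℝ)|) ^ 3 := pow_le_pow_left₀ (bra_pos j).le h1 3
    _ = 8 * (|(j : ℝ)| * 1 * (j : ℝ) ^ 2) := by rw [← sq_abs (j : ℝ)]; ring
    _ ≤ _ := by
      gcongr
      nlinarith [sq_nonneg (j : ℝ), sq_nonneg (n : ℝ), sq_nonneg (m : ℝ)]

/-- A frequency outside the box cannot be cancelled by one inside, so the middle frequency is
nonzero. Since `|m| ≤ |j|`, smoothing at `j` can also be spent at `m`. -/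
lemma ne_zero_of_box {N : ℕ} {j n m : ℤ} (h : j + n + m = 0) (hj : j ∉ box N) (hm : m ∈ box N) :
    j ≠ 0 ∧ n ≠ 0 ∧ bra m ≤ bra j := by
  rw [mem_box] at hj hm
  refine ⟨?_, ?_, ?_⟩
  · rintro rfl; simp at hj
  · rintro rfl
    have : j = -m := by omega
    rw [this, abs_neg] at hj
    exact hj hm
  · unfold bra
    have : |m| ≤ |j| := by omega
    have : |(m : ℝ)| ≤ |(j : ℝ)| := by exact_mod_cast this
    linarith

/-- The weight `(1 + |k|)⁻³` applied to a sequence. -/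
def smooth (f : ℤ → ℂ) (k : ℤ) : ℂ := (((bra k ^ 3)⁻¹ : ℝ) : ℂ) * f k

lemma norm_smooth (f : ℤ → ℂ) (k : ℤ) : ‖smooth f k‖ = (bra k ^ 3)⁻¹ * ‖f k‖ := by
  have := bra_pos k
  rw [smooth, norm_mul, Complex.norm_real, Real.norm_of_nonneg (by positivity)]

lemma norm_smooth_le (f : ℤ → ℂ) (k : ℤ) : ‖smooth f k‖ ≤ ‖f k‖ := by
  rw [norm_smooth]
  exact mul_le_of_le_one_left (norm_nonneg _) (inv_le_one_of_one_le₀ (one_le_pow₀ (one_le_bra k)))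

/-- Two forms of the same gain: the three derivatives go to the high slot or to the low slot,
whichever contains the unbounded term. -/
lemma norm_nf_term_le {N : ℕ} {x y z : ℤ → ℂ} (hx : ∀ k ∈ box N, x k = 0)
    (hz : ∀ k ∉ box N, z k = 0) {j n m : ℤ} (h0 : j + n + m = 0) :
    ‖nfSymbol j n m * (x j * y n * z m)‖ ≤ (8 * ‖smooth x j‖) * ‖y n‖ * ‖z m‖ ∧
    ‖nfSymbol j n m * (x j * y n * z m)‖ ≤ (8 * ‖x j‖) * ‖y n‖ * ‖smooth z m‖ := by
  by_cases hj : j ∈ box N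
  · rw [hx j hj]
    simp only [zero_mul, mul_zero, norm_zero]
    exact ⟨by positivity, by positivity⟩
  by_cases hm : m ∈ box N
  swap
  · rw [hz m hm]
    simp only [mul_zero, norm_zero]
    exact ⟨by positivity, by positivity⟩
  obtain ⟨h1, h2, h3⟩ := ne_zero_of_box h0 hj hm
  have h4 := norm_nfSymbol_mul_le (m := m) h1 h2
  have hbj := bra_pos j
  have hbm := bra_pos m
  have h5 : ‖nfSymbol j n m‖ ≤ 8 * (bra j ^ 3)⁻¹ := by
    rw [← div_eq_mul_inv, le_div_iff₀ (by positivity)]; exact h4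
  have h6 : (bra j ^ 3)⁻¹ ≤ (bra m ^ 3)⁻¹ :=
    inv_anti₀ (by positivity) (pow_le_pow_left₀ hbm.le h3 3)
  rw [norm_smooth, norm_smooth, norm_mul, norm_mul, norm_mul]
  constructor
  · calc _ ≤ (8 * (bra j ^ 3)⁻¹) * (‖x j‖ * ‖y n‖ * ‖z m‖) := by gcongr
      _ = _ := by ring
  · calc _ ≤ (8 * (bra m ^ 3)⁻¹) * (‖x j‖ * ‖y n‖ * ‖z m‖) := by
          gcongr; exact h5.trans (by gcongr)
      _ = _ := by ring

lemma norm_trilin_nf_le_left {N : ℕ} (K : ℕ) {x y z : ℤ → ℂ} (hx : ∀ k ∈ box N, x k = 0)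
    (hz : ∀ k ∉ box N, z k = 0) :
    ‖trilin K nfSymbol x y z‖ ≤ 8 * l2 K (smooth x) * wnorm K 0 y * l2 K z := by
  refine (norm_trilin_le K (x := fun j => 8 * ‖smooth x j‖) (y := fun n => ‖y n‖)
    (z := fun m => ‖z m‖) (fun _ => norm_nonneg _)
    (fun j _ n _ m _ h0 => (norm_nf_term_le hx hz h0).1)).trans_eq ?_
  simp only [mul_pow, ← Finset.mul_sum]
  rw [Real.sqrt_mul (by norm_num), Real.sqrt_sq (by norm_num)]
  simp [l2, wnorm]

lemma norm_trilin_nf_le_right {N : ℕ} (K : ℕ) {x y z : ℤ → ℂ} (hx : ∀ k ∈ box N, x k = 0)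
    (hz : ∀ k ∉ box N, z k = 0) :
    ‖trilin K nfSymbol x y z‖ ≤ 8 * l2 K x * wnorm K 0 y * l2 K (smooth z) := by
  refine (norm_trilin_le K (x := fun j => 8 * ‖x j‖) (y := fun n => ‖y n‖)
    (z := fun m => ‖smooth z m‖) (fun _ => norm_nonneg _)
    (fun j _ n _ m _ h0 => (norm_nf_term_le hx hz h0).2)).trans_eq ?_
  simp only [mul_pow, ← Finset.mul_sum]
  rw [Real.sqrt_mul (by norm_num), Real.sqrt_sq (by norm_num)]
  simp [l2, wnorm]

/-- The linear flow differentiates each slot by `disp`, so the linear part of the derivative of the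
correction is exactly the forcing that has to be cancelled. -/
lemma trilin_nf_disp {N : ℕ} (K : ℕ) {x y z : ℤ → ℂ} (hx : ∀ k ∈ box N, x k = 0)
    (hz : ∀ k ∉ box N, z k = 0) :
    trilin K nfSymbol (fun k => disp k * x k) y z + trilin K nfSymbol x (fun k => disp k * y k) z
      + trilin K nfSymbol x y (fun k => disp k * z k)
      = Complex.I * trilin K (fun _ _ m => (m : ℂ)) x y z := by
  have e1 : trilin K nfSymbol (fun k => disp k * x k) y z
      = trilin K (fun j n m => nfSymbol j n m * disp j) x y z :=
    trilin_congr K fun j _ n _ m _ _ => by ring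
  have e2 : trilin K nfSymbol x (fun k => disp k * y k) z
      = trilin K (fun j n m => nfSymbol j n m * disp n) x y z :=
    trilin_congr K fun j _ n _ m _ _ => by ring
  have e3 : trilin K nfSymbol x y (fun k => disp k * z k)
      = trilin K (fun j n m => nfSymbol j n m * disp m) x y z :=
    trilin_congr K fun j _ n _ m _ _ => by ring
  rw [e1, e2, e3, ← trilin_add_symbol, ← trilin_add_symbol, ← trilin_smul_symbol]
  refine trilin_congr K fun j _ n _ m _ h0 => ?_
  by_cases hj : j ∈ box N
  · simp [hx j hj]
  by_cases hm : m ∈ box N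
  swap
  · simp [hz m hm]
  obtain ⟨h1, h2, _⟩ := ne_zero_of_box h0 hj hm
  rw [← nfSymbol_mul_disp h0 h1 h2]
  ring

lemma trilin_add_mid {R : Type*} [CommRing R] (K : ℕ) (σ : ℤ → ℤ → ℤ → R) (a b b' c : ℤ → R) :
    trilin K σ a (fun k => b k + b' k) c = trilin K σ a b c + trilin K σ a b' c := by
  rw [trilin_swap₁₂, trilin_add_left, trilin_swap₁₂ K _ b, trilin_swap₁₂ K _ b']

lemma trilin_add_right {R : Type*} [CommRing R] (K : ℕ) (σ : ℤ → ℤ → ℤ → R) (a b c c' : ℤ → R) :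
    trilin K σ a b (fun k => c k + c' k) = trilin K σ a b c + trilin K σ a b c' := by
  rw [trilin_swap₂₃, trilin_add_mid, trilin_swap₂₃ K _ a c, trilin_swap₂₃ K _ a c']

lemma pairing_low {N : ℕ} (K : ℕ) (f : ℤ → ℂ) {z : ℤ → ℂ} (hz : ∀ k ∉ box N, z k = 0) :
    pairing K (low N f) z = pairing K f z := by
  refine Finset.sum_congr rfl fun k _ => ?_
  unfold low
  split_ifs with h
  · rfl
  · rw [hz (-k) (by rwa [neg_mem_box])]; simp

/-! ### The modified energy and the comparison of approximate solutions. -/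

/-- The modified energy estimate at a fixed time. -/
lemma modified_energy_deriv_le {N K : ℕ} {A δ : ℝ} (hδA : δ ≤ A)
    {a b r R : ℤ → ℂ} (ha : ∀ k ∉ box N, a k = 0)
    (hA : wnorm K 1 a ≤ A) (hB : wnorm K 1 b ≤ A) (hη : l2 K (high N b) ≤ δ)
    (hr : wnorm K 0 r ≤ δ) (hR : wnorm K 0 R ≤ δ)
    (hconv : l2 K (high N fun k => (((bra k ^ 2)⁻¹ : ℝ) : ℂ) * conv K b b k) ≤ δ) :
    let a' : ℤ → ℂ := low N fun k => disp k * a k + bil K a a k + r k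
    let b' : ℤ → ℂ := fun k => disp k * b k + bil K b b k + R k
    let θ : ℤ → ℂ := low N fun k => b k - a k
    let θ' : ℤ → ℂ := low N fun k => b' k - a' k
    let g : ℤ → ℂ := fun k => a k + b k
    2 * (pairing K θ' θ).re
      - (trilin K nfSymbol (high N b') g θ + trilin K nfSymbol (high N b) (fun k => a' k + b' k) θ
        + trilin K nfSymbol (high N b) g θ').re
      ≤ (48 * A ^ 2 + 81 * A + 4) * (l2 K θ ^ 2 + δ ^ 2) := by
  intro a' b' θ θ' g
  set η := high N b with hηdef
  set x := l2 K θ with hx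
  have hx0 : 0 ≤ x := l2_nonneg _ _
  have hA0 : 0 ≤ A := (wnorm_nonneg _ _ _).trans hA
  have hδ0 : 0 ≤ δ := (l2_nonneg _ _).trans hη
  have hη0 : ∀ k ∈ box N, η k = 0 := fun k hk => by simp [η, high, hk]
  have hθ0 : ∀ k ∉ box N, θ k = 0 := fun k hk => by simp [θ, low, hk]
  have hsum : ∀ k, b k - a k = θ k + η k := fun k => by
    simp only [θ, η, low, high]
    split_ifs with h
    · simp
    · simp [ha k h]
  have hg1 : wnorm K 1 g ≤ 2 * A := (wnorm_add_le K 1 a b).trans (by linarith)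
  have hg0 : wnorm K 0 g ≤ 2 * A := (wnorm_mono K (Nat.zero_le 1) g).trans hg1
  -- The identity `b² - a² = (b - a)(b + a)`, with `b - a` split into its low part `θ` and high part
  -- `η`.
  have hdiff : ∀ k, bil K b b k - bil K a a k = bil K θ g k + bil K η g k := fun k => by
    have e1 : bil K θ g k + bil K η g k = bil K (fun k => b k - a k) g k := by
      rw [← bil_add_left]
      exact (bil_congr (fun k _ => hsum k) (fun _ _ => rfl) k).symm
    rw [e1, bil_sub_left, bil_add_right, bil_add_right, bil_comm K b a]
    ring
  set z₁ : ℤ → ℂ := low N fun k => (bil K θ g k + bil K η g k) + (R k - r k) with hz₁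
  set x₁ : ℤ → ℂ := high N fun k => bil K b b k + R k with hx₁
  set γ : ℤ → ℂ := fun k => low N (fun k => bil K a a k + r k) k + (bil K b b k + R k) with hγ
  have hz₁0 : ∀ k ∉ box N, z₁ k = 0 := fun k hk => by simp [z₁, low, hk]
  have hx₁0 : ∀ k ∈ box N, x₁ k = 0 := fun k hk => by simp [x₁, high, hk]
  have eθ' : θ' = fun k => disp k * θ k + z₁ k := by
    funext k
    simp only [θ', θ, z₁, low, a', b']
    split_ifs with h
    · linear_combination hdiff k
    · simp
  have eη' : high N b' = fun k => disp k * η k + x₁ k := by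
    funext k
    simp only [η, x₁, high, b']
    split_ifs with h
    · simp
    · ring
  have eg' : (fun k => a' k + b' k) = fun k => disp k * g k + γ k := by
    funext k
    simp only [g, γ, low, a', b']
    split_ifs with h
    · ring
    · rw [ha k h]; ring
  have hlin := trilin_nf_disp K (y := g) hη0 hθ0
  have hpair : pairing K θ' θ = pairing K (bil K θ g) θ
      + Complex.I / 2 * trilin K (fun _ _ m => (m : ℂ)) η g θ
      + pairing K (fun k => R k - r k) θ := by
    rw [eθ', pairing_add_left, pairing_odd_eq_zero K disp_neg, zero_add, hz₁,
      pairing_low K _ hθ0, pairing_add_left, pairing_add_left, pairing_bil K η]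
  set Q₁ := trilin K nfSymbol x₁ g θ with hQ₁
  set Q₂ := trilin K nfSymbol η γ θ with hQ₂
  set Q₃ := trilin K nfSymbol η g z₁ with hQ₃
  have hT : trilin K nfSymbol (high N b') g θ
        + trilin K nfSymbol η (fun k => a' k + b' k) θ + trilin K nfSymbol η g θ'
      = Complex.I * trilin K (fun _ _ m => (m : ℂ)) η g θ + (Q₁ + Q₂ + Q₃) := by
    rw [eη', eg', eθ', trilin_add_left, trilin_add_mid K nfSymbol η (fun k => disp k * g k) γ θ,
      trilin_add_right, ← hlin]
    ring
  -- The dangerous `η g θ` term cancels here; only symmetrised, residual and smoothed terms survive.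
  have hre : 2 * (pairing K θ' θ).re - (Complex.I * trilin K (fun _ _ m => (m : ℂ)) η g θ
      + (Q₁ + Q₂ + Q₃)).re = 2 * (pairing K (bil K θ g) θ).re
      + 2 * (pairing K (fun k => R k - r k) θ).re - Q₁.re - Q₂.re - Q₃.re := by
    have e : Complex.I * trilin K (fun _ _ m => (m : ℂ)) η g θ
      = 2 * (Complex.I / 2 * trilin K (fun _ _ m => (m : ℂ)) η g θ) := by ring
    rw [hpair, e]
    simp only [Complex.add_re, Complex.mul_re, Complex.re_ofNat, Complex.im_ofNat]
    ring
  rw [hT, hre]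
  have b1 : (pairing K (bil K θ g) θ).re ≤ A / 2 * x ^ 2 := by
    rw [pairing_congr (a' := bil K g θ) θ fun k _ => bil_comm K θ g k]
    refine (Complex.re_le_norm _).trans ((norm_pairing_bil_self_le K g θ).trans ?_)
    nlinarith [sq_nonneg x]
  have hRr : l2 K (fun k => R k - r k) ≤ 2 * δ := by
    have h1 := l2_add_le K R (fun k => -1 * r k)
    rw [l2_smul] at h1
    norm_num at h1
    have h2 := (l2_le_wnorm K 0 R).trans hR
    have h3 := (l2_le_wnorm K 0 r).trans hr
    simp only [sub_eq_add_neg]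
    linarith
  have b2 : (pairing K (fun k => R k - r k) θ).re ≤ 2 * δ * x :=
    (Complex.re_le_norm _).trans ((norm_pairing_le K _ θ).trans
      (mul_le_mul_of_nonneg_right hRr hx0))
  -- The derivative in `x₁` uses one of the three smoothing powers; the remaining weight `bra⁻²` is
  -- the one in `hconv`.
  have c1 : ‖Q₁‖ ≤ 32 * A * (δ * x) := by
    have h1 : l2 K (smooth x₁) ≤ 2 * δ := by
      have h2 : l2 K (smooth x₁) ≤ l2 K (high N fun k => (((bra k ^ 2)⁻¹ : ℝ) : ℂ)
          * conv K b b k) + l2 K R := by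
        have h3 : l2 K (smooth x₁) ≤ l2 K (fun k =>
            ((‖high N (fun k => (((bra k ^ 2)⁻¹ : ℝ) : ℂ) * conv K b b k) k‖ : ℝ) : ℂ)
              + ((‖R k‖ : ℝ) : ℂ)) := by
          refine l2_le_of_norm_le fun k _ => ?_
          rw [← Complex.ofReal_add, Complex.norm_real, Real.norm_of_nonneg (by positivity),
            norm_smooth]
          simp only [x₁, high]
          split_ifs with h
          · simp
          · have hb := bra_pos k
            have h4 := norm_bil_le K b b k
            rw [norm_mul, Complex.norm_real, Real.norm_of_nonneg (by positivity)]
            have h5 : (bra k ^ 3)⁻¹ ≤ 1 := inv_le_one_of_one_le₀ (one_le_pow₀ (one_le_bra k))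
            calc (bra k ^ 3)⁻¹ * ‖bil K b b k + R k‖
                ≤ (bra k ^ 3)⁻¹ * (bra k / 2 * ‖conv K b b k‖ + ‖R k‖) := by
                  gcongr; exact (norm_add_le _ _).trans (by gcongr)
              _ = (bra k ^ 2)⁻¹ * ‖conv K b b k‖ / 2 + (bra k ^ 3)⁻¹ * ‖R k‖ := by
                  field_simp
              _ ≤ (bra k ^ 2)⁻¹ * ‖conv K b b k‖ + 1 * ‖R k‖ := by
                  refine add_le_add (half_le_self (by positivity)) ?_
                  gcongr
              _ = _ := by rw [one_mul]
        refine h3.trans ((l2_add_le K _ _).trans_eq ?_)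
        congr 1
        · exact l2_congr fun k _ => by simp
        · exact l2_congr fun k _ => by simp
      have h3 := (l2_le_wnorm K 0 R).trans hR
      linarith
    refine (norm_trilin_nf_le_left K hx₁0 hθ0).trans ?_
    calc _ ≤ 8 * (2 * δ) * (2 * A) * x := by
          have := wnorm_nonneg K 0 g
          gcongr
      _ = _ := by ring
  have c2 : ‖Q₂‖ ≤ 16 * (A ^ 2 + A) * (δ * x) := by
    have hba := wnorm_bil_le K 0 a a
    have hbb := wnorm_bil_le K 0 b b
    rw [zero_add] at hba hbb
    have hba' := hba.trans (mul_le_mul hA hA (wnorm_nonneg _ _ _) hA0)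
    have hbb' := hbb.trans (mul_le_mul hB hB (wnorm_nonneg _ _ _) hA0)
    have h1 : wnorm K 0 γ ≤ 2 * (A ^ 2 + A) := by
      have e1 := wnorm_add_le K 0 (low N fun k => bil K a a k + r k) (fun k => bil K b b k + R k)
      have e2 := wnorm_le_of_norm_le (K := K) (s := 0)
        (fun k _ => norm_low_le N (fun k => bil K a a k + r k) k)
      have e3 := wnorm_add_le K 0 (bil K a a) r
      have e4 := wnorm_add_le K 0 (bil K b b) R
      rw [sq]
      linarith
    refine (norm_trilin_nf_le_left K hη0 hθ0).trans ?_
    have h2 : l2 K (smooth η) ≤ δ := (l2_le_of_norm_le fun k _ => norm_smooth_le η k).trans hη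
    calc _ ≤ 8 * δ * (2 * (A ^ 2 + A)) * x := by
          have := wnorm_nonneg K 0 γ
          gcongr
      _ = _ := by ring
  -- The derivative now sits in the low slot `z₁`, so the smoothing is spent there and `η` supplies
  -- the factor `δ` directly.
  have c3 : ‖Q₃‖ ≤ 16 * A * δ * (A * (x + δ) + 2 * δ) := by
    have h1 : l2 K (smooth z₁) ≤ A * (x + δ) + 2 * δ := by
      set w : ℤ → ℂ := fun k => θ k + η k
      have h2 : l2 K (smooth z₁) ≤ l2 K (fun k =>
          ((‖(1 / 2 : ℂ) * conv K w g k‖ : ℝ) : ℂ) + ((‖R k - r k‖ : ℝ) : ℂ)) := by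
        refine l2_le_of_norm_le fun k _ => ?_
        rw [← Complex.ofReal_add, Complex.norm_real, Real.norm_of_nonneg (by positivity)]
        have hb := bra_pos k
        have h3 : ‖z₁ k‖ ≤ ‖bil K w g k + (R k - r k)‖ := by
          refine (norm_low_le _ _ _).trans_eq ?_
          rw [bil_add_left]
        have h4 := norm_bil_le K w g k
        have h5 : (bra k ^ 3)⁻¹ ≤ 1 := inv_le_one_of_one_le₀ (one_le_pow₀ (one_le_bra k))
        have h6 : (bra k ^ 2)⁻¹ ≤ 1 := inv_le_one_of_one_le₀ (one_le_pow₀ (one_le_bra k))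
        rw [norm_smooth, norm_mul]
        norm_num
        calc (bra k ^ 3)⁻¹ * ‖z₁ k‖
            ≤ (bra k ^ 3)⁻¹ * (bra k / 2 * ‖conv K w g k‖ + ‖R k - r k‖) := by
              gcongr; exact h3.trans ((norm_add_le _ _).trans (by gcongr))
          _ = (bra k ^ 2)⁻¹ * (1 / 2 * ‖conv K w g k‖) + (bra k ^ 3)⁻¹ * ‖R k - r k‖ := by
              field_simp
          _ ≤ 1 * (1 / 2 * ‖conv K w g k‖) + 1 * ‖R k - r k‖ := by gcongr
          _ = _ := by ring
      have h3 := h2.trans (l2_add_le K _ _)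
      have h4 : l2 K (fun k => ((‖(1 / 2 : ℂ) * conv K w g k‖ : ℝ) : ℂ))
          = 1 / 2 * l2 K (conv K w g) := by
        rw [show l2 K (fun k => ((‖(1 / 2 : ℂ) * conv K w g k‖ : ℝ) : ℂ))
          = l2 K (fun k => (1 / 2 : ℂ) * conv K w g k) from l2_congr fun k _ => by simp, l2_smul]
        norm_num
      have h5 : l2 K (fun k => ((‖R k - r k‖ : ℝ) : ℂ)) = l2 K (fun k => R k - r k) :=
        l2_congr fun k _ => by simp
      have h6 := l2_conv_le K w g
      have h7 : l2 K w ≤ x + δ := (l2_add_le K θ η).trans (by linarith)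
      have h8 := mul_le_mul h7 hg0 (wnorm_nonneg _ _ _) (by positivity)
      rw [h4, h5] at h3
      linarith
    refine (norm_trilin_nf_le_right K hη0 hz₁0).trans ?_
    calc _ ≤ 8 * δ * (2 * A) * (A * (x + δ) + 2 * δ) := by
          have := wnorm_nonneg K 0 g
          have := l2_nonneg K (smooth z₁)
          gcongr
      _ = _ := by ring
  have d1 := (abs_le.1 ((Complex.abs_re_le_norm Q₁).trans c1)).1
  have d2 := (abs_le.1 ((Complex.abs_re_le_norm Q₂).trans c2)).1
  have d3 := (abs_le.1 ((Complex.abs_re_le_norm Q₃).trans c3)).1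
  set P := x ^ 2 + δ ^ 2
  have p1 : x ^ 2 ≤ P := by simp only [P]; linarith [sq_nonneg δ]
  have p2 : δ * x ≤ P := by simp only [P]; nlinarith [sq_nonneg (δ - x), sq_nonneg x, sq_nonneg δ]
  have p3 : δ ^ 2 ≤ P := by simp only [P]; linarith [sq_nonneg x]
  -- The coefficients of `x²`, `δ x` and `δ²` in `q1`, `q2`, `q3` add up to `48 A² + 81 A + 4`.
  have q1 := mul_le_mul_of_nonneg_left p1 hA0
  have q2 := mul_le_mul_of_nonneg_left p2 (show 0 ≤ 4 + 32 * A + 16 * (A ^ 2 + A) + 16 * A ^ 2 by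
    positivity)
  have q3 := mul_le_mul_of_nonneg_left p3 (show 0 ≤ 16 * A ^ 2 + 32 * A by positivity)
  nlinarith

lemma ContinuousOn.trilin {K : ℕ} {a b c : ℝ → ℤ → ℂ} {s : Set ℝ} (σ : ℤ → ℤ → ℤ → ℂ)
    (ha : ∀ k ∈ box K, ContinuousOn (fun t => a t k) s)
    (hb : ∀ k ∈ box K, ContinuousOn (fun t => b t k) s)
    (hc : ∀ k ∈ box K, ContinuousOn (fun t => c t k) s) :
    ContinuousOn (fun t => trilin K σ (a t) (b t) (c t)) s := by
  refine continuousOn_finsetSum _ fun j hj => continuousOn_finsetSum _ fun n hn =>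
    continuousOn_finsetSum _ fun m hm => ?_
  split_ifs
  · exact continuousOn_const.mul (((ha j hj).mul (hb n hn)).mul (hc m hm))
  · exact continuousOn_const

lemma continuousOn_low {N : ℕ} {a : ℝ → ℤ → ℂ} {s : Set ℝ} {k : ℤ}
    (ha : ContinuousOn (fun t => a t k) s) : ContinuousOn (fun t => low N (a t) k) s := by
  unfold low; split_ifs
  · exact ha
  · exact continuousOn_const

lemma continuousOn_high {N : ℕ} {a : ℝ → ℤ → ℂ} {s : Set ℝ} {k : ℤ}
    (ha : ContinuousOn (fun t => a t k) s) : ContinuousOn (fun t => high N (a t) k) s := by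
  unfold high; split_ifs
  · exact continuousOn_const
  · exact ha

lemma HasDerivAt.low {N : ℕ} {a : ℝ → ℤ → ℂ} {a' : ℤ → ℂ} {t : ℝ} {k : ℤ}
    (ha : HasDerivAt (fun t => a t k) (a' k) t) :
    HasDerivAt (fun t => low N (a t) k) (low N a' k) t := by
  unfold Kawahara.low; split_ifs
  · exact ha
  · exact hasDerivAt_const _ _

lemma HasDerivAt.high {N : ℕ} {a : ℝ → ℤ → ℂ} {a' : ℤ → ℂ} {t : ℝ} {k : ℤ}
    (ha : HasDerivAt (fun t => a t k) (a' k) t) :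
    HasDerivAt (fun t => high N (a t) k) (high N a' k) t := by
  unfold Kawahara.high; split_ifs
  · exact hasDerivAt_const _ _
  · exact ha

lemma bil_eq_of_support {N K : ℕ} (h : N ≤ K) {a b : ℤ → ℂ} (ha : ∀ k ∉ box N, a k = 0)
    (hb : ∀ k ∉ box N, b k = 0) (k : ℤ) : bil K a b k = bil N a b k := by
  rw [bil, bil, conv_eq_of_support h ha hb]

/-- Extension of the coefficient equation to a larger box. -/
lemma IsApproxGalerkin.hasDerivAt_of_le {N K : ℕ} {T : ℝ} {a r : ℝ → ℤ → ℂ}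
    (h : IsApproxGalerkin N T a r) (hNK : N ≤ K) {t : ℝ} (ht : t ∈ Set.Ioo 0 T) (k : ℤ) :
    HasDerivAt (fun s => a s k)
      (low N (fun k => disp k * a t k + bil K (a t) (a t) k + r t k) k) t := by
  have hs := h.support t (Set.Ioo_subset_Icc_self ht)
  by_cases hk : k ∈ box N
  · have := h.deriv t ht k hk
    rw [low, if_pos hk, bil_eq_of_support hNK hs hs]
    exact this
  · rw [low, if_neg hk]
    refine (hasDerivAt_const t (0 : ℂ)).congr_of_eventuallyEq ?_
    filter_upwards [Ioo_mem_nhds ht.1 ht.2] with s hs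
    exact h.support s (Set.Ioo_subset_Icc_self hs) k hk

lemma IsApproxGalerkin.continuousOn {N : ℕ} {T : ℝ} {a r : ℝ → ℤ → ℂ}
    (h : IsApproxGalerkin N T a r) (k : ℤ) : ContinuousOn (fun t => a t k) (Set.Icc 0 T) := by
  by_cases hk : k ∈ box N
  · exact h.cont k hk
  · exact continuousOn_const.congr fun t ht => h.support t ht k hk

/-- Stability and consistency of Galerkin approximations, by a modified energy. -/
lemma exists_comparison_bound (A T : ℝ) (hA : 0 < A) : ∃ C : ℝ, 0 < C ∧
    ∀ (N K : ℕ) (δ : ℝ) (a r b R : ℝ → ℤ → ℂ), N ≤ K → δ ≤ A →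
      IsApproxGalerkin N T a r → IsApproxGalerkin K T b R →
      (∀ t ∈ Set.Icc 0 T, wnorm K 1 (a t) ≤ A) → (∀ t ∈ Set.Icc 0 T, wnorm K 1 (b t) ≤ A) →
      (∀ t ∈ Set.Icc 0 T, l2 K (high N (b t)) ≤ δ) →
      (∀ t ∈ Set.Icc 0 T, wnorm K 0 (r t) ≤ δ) → (∀ t ∈ Set.Icc 0 T, wnorm K 0 (R t) ≤ δ) →
      (∀ t ∈ Set.Icc 0 T, l2 K (high N fun k =>
        (((bra k ^ 2)⁻¹ : ℝ) : ℂ) * conv K (b t) (b t) k) ≤ δ) →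
      (∀ k ∈ box N, a 0 k = b 0 k) →
      ∀ t ∈ Set.Icc 0 T, l2 N (fun k => b t k - a t k) ≤ C * δ := by
  set c := 2 * (48 * A ^ 2 + 81 * A + 4) with hc
  -- Young gives `16 A δ x ≤ x²/2 + 128 A² δ²`: the correction takes at most half of `‖θ‖²`, and the
  -- additional 1 leaves a full `δ²` in the lower bound `hElow`.
  set L := 128 * A ^ 2 + 1 with hL
  refine ⟨Real.sqrt (2 * (Real.exp (c * T) * L)), by positivity, ?_⟩
  intro N K δ a r b R hNK hδA ha hb hA₁ hB₁ hη hr hR hconv hinit t ht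
  have h0T : (0 : ℝ) ∈ Set.Icc 0 T := ⟨le_rfl, ht.1.trans ht.2⟩
  have hδ0 : 0 ≤ δ := (l2_nonneg _ _).trans (hη t ht)
  set θ : ℝ → ℤ → ℂ := fun t => low N fun k => b t k - a t k with hθdef
  set g : ℝ → ℤ → ℂ := fun t k => a t k + b t k
  set E : ℝ → ℝ := fun t => (∑ k ∈ box K, (1 : ℝ) * ‖θ t k‖ ^ 2)
    - (trilin K nfSymbol (high N (b t)) (g t) (θ t)).re + L * δ ^ 2 with hE
  have hθl2 : ∀ t, ∑ k ∈ box K, (1 : ℝ) * ‖θ t k‖ ^ 2 = l2 K (θ t) ^ 2 := fun t => by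
    simp [l2_sq]
  have hθ0 : ∀ t, ∀ k ∉ box N, θ t k = 0 := fun t k hk => by simp [θ, low, hk]
  have hη0 : ∀ t, ∀ k ∈ box N, high N (b t) k = 0 := fun t k hk => by simp [high, hk]
  have hTbd : ∀ t ∈ Set.Icc 0 T, ‖trilin K nfSymbol (high N (b t)) (g t) (θ t)‖
      ≤ 16 * A * (δ * l2 K (θ t)) := fun t ht => by
    refine (norm_trilin_nf_le_left K (hη0 t) (hθ0 t)).trans ?_
    have h1 : l2 K (smooth (high N (b t))) ≤ δ :=
      (l2_le_of_norm_le fun k _ => norm_smooth_le _ k).trans (hη t ht)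
    have h2 : wnorm K 0 (g t) ≤ 2 * A := by
      refine (wnorm_mono K (Nat.zero_le 1) _).trans ((wnorm_add_le K 1 _ _).trans ?_)
      linarith [hA₁ t ht, hB₁ t ht]
    calc _ ≤ 8 * δ * (2 * A) * l2 K (θ t) := by
          have := wnorm_nonneg K 0 (g t)
          have := l2_nonneg K (θ t)
          gcongr
      _ = _ := by ring
  have hElow : ∀ t ∈ Set.Icc 0 T, 1 / 2 * l2 K (θ t) ^ 2 + δ ^ 2 ≤ E t := fun t ht => by
    have h1 := (Complex.re_le_norm _).trans (hTbd t ht)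
    simp only [hE, hθl2]
    nlinarith [sq_nonneg (l2 K (θ t) - 16 * A * δ)]
  have hgron := le_exp_mul_of_deriv_le (f := E) (c := c) (T := T)
    (f' := fun t => 2 * (pairing K (fun k => ((1 : ℝ) : ℂ) * low N (fun k =>
        (disp k * b t k + bil K (b t) (b t) k + R t k)
          - low N (fun k => disp k * a t k + bil K (a t) (a t) k + r t k) k) k) (θ t)).re
      - (trilin K nfSymbol (high N (fun k => disp k * b t k + bil K (b t) (b t) k + R t k))
          (g t) (θ t)
        + trilin K nfSymbol (high N (b t)) (fun k =>
          low N (fun k => disp k * a t k + bil K (a t) (a t) k + r t k) k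
            + (disp k * b t k + bil K (b t) (b t) k + R t k)) (θ t)
        + trilin K nfSymbol (high N (b t)) (g t) (low N (fun k =>
        (disp k * b t k + bil K (b t) (b t) k + R t k)
          - low N (fun k => disp k * a t k + bil K (a t) (a t) k + r t k) k))).re)
    ?_ ?_ ?_ ht
  · have hx := hElow t ht
    have hE0 : E 0 = L * δ ^ 2 := by
      have hz : θ 0 = fun _ => 0 := by
        funext k
        simp only [θ, low]
        split_ifs with hk
        · rw [hinit k hk, sub_self]
        · rfl
      simp [hE, hz, trilin]
    rw [hE0] at hgron
    have hexp : Real.exp (c * t) ≤ Real.exp (c * T) :=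
      Real.exp_le_exp.2 (mul_le_mul_of_nonneg_left ht.2 (by positivity))
    have h2 : l2 K (θ t) ^ 2 ≤ 2 * (Real.exp (c * T) * L) * δ ^ 2 := by
      have := mul_le_mul_of_nonneg_right hexp (show 0 ≤ L * δ ^ 2 by positivity)
      nlinarith [sq_nonneg δ]
    have h3 : l2 N (fun k => b t k - a t k) = l2 K (θ t) := by
      rw [l2_eq_of_support hNK (hθ0 t)]
      exact l2_congr fun k hk => by simp [θ, low, hk]
    rw [h3]
    refine le_of_sq_le_sq ?_ (by positivity)
    rw [mul_pow, Real.sq_sqrt (by positivity)]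
    exact h2
  · have cb := hb.continuousOn
    have ca := ha.continuousOn
    have cθ : ∀ k, ContinuousOn (fun t => θ t k) (Set.Icc 0 T) := fun k =>
      continuousOn_low (a := fun t k => b t k - a t k) ((cb k).sub (ca k))
    refine ContinuousOn.add (ContinuousOn.sub ?_ ?_) continuousOn_const
    · exact continuousOn_finsetSum _ fun k _ => continuousOn_const.mul ((cθ k).norm.pow 2)
    · exact Complex.continuous_re.comp_continuousOn (ContinuousOn.trilin _
        (fun k _ => continuousOn_high (cb k)) (fun k _ => (ca k).add (cb k)) fun k _ => cθ k)
  · intro t ht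
    have ht' := Set.Ioo_subset_Icc_self ht
    have da := fun k => ha.hasDerivAt_of_le hNK ht k
    have db := fun k hk => hb.deriv t ht k hk
    have dθ : ∀ k ∈ box K, HasDerivAt (fun t => θ t k) (low N (fun k =>
        (disp k * b t k + bil K (b t) (b t) k + R t k)
          - low N (fun k => disp k * a t k + bil K (a t) (a t) k + r t k) k) k) t := fun k hk =>
      HasDerivAt.low (a := fun t k => b t k - a t k) (a' := fun k =>
        (disp k * b t k + bil K (b t) (b t) k + R t k)
          - low N (fun k => disp k * a t k + bil K (a t) (a t) k + r t k) k)
        ((db k hk).sub (da k))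
    have hreal : IsRealCoeff (θ t) := IsRealCoeff.low ((hb.real t ht').sub (ha.real t ht'))
    have h1 := hasDerivWithinAt_weighted_sum (K := K) (a := θ) (s := Set.univ) (t := t)
      (fun _ => (1 : ℝ)) hreal (fun k hk => (dθ k hk).hasDerivWithinAt)
    have h2 := HasDerivWithinAt.trilin (K := K) (s := Set.univ) (t := t)
      (a := fun t => high N (b t)) (b := g) (c := θ) nfSymbol
      (fun k hk => (HasDerivAt.high (a' := fun k => disp k * b t k + bil K (b t) (b t) k + R t k)
        (db k hk)).hasDerivWithinAt)
      (b' := fun k => low N (fun k => disp k * a t k + bil K (a t) (a t) k + r t k) k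
            + (disp k * b t k + bil K (b t) (b t) k + R t k))
      (fun k hk => ((da k).add (db k hk)).hasDerivWithinAt)
      (fun k hk => (dθ k hk).hasDerivWithinAt)
    have h3 := Complex.reCLM.hasFDerivAt.comp_hasDerivWithinAt t h2
    have h4 := (h1.sub h3).add_const (L * δ ^ 2)
    rw [hasDerivWithinAt_univ] at h4
    exact h4
  · intro t ht
    have ht' := Set.Ioo_subset_Icc_self ht
    have h1 := modified_energy_deriv_le (N := N) (K := K) hδA (ha.support t ht') (hA₁ t ht')
      (hB₁ t ht') (hη t ht') (hr t ht') (hR t ht') (hconv t ht')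
    have h2 := hElow t ht'
    simp only [Complex.ofReal_one, one_mul]
    refine h1.trans ?_
    have h3 : (48 * A ^ 2 + 81 * A + 4) * (l2 K (θ t) ^ 2 + δ ^ 2)
        ≤ (48 * A ^ 2 + 81 * A + 4) * (2 * E t) := by
      refine mul_le_mul_of_nonneg_left ?_ (by positivity)
      nlinarith [sq_nonneg δ]
    refine h3.trans_eq ?_
    rw [hc]; ring

/-! ### Fourier coefficients and trigonometric polynomials. -/

/-- The exponential `x ↦ e^{ikx}`. -/
def expi (k : ℤ) (x : ℝ) : ℂ := Complex.exp (Complex.I * (k : ℂ) * (x : ℂ))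

/-- The Fourier coefficient of a complex-valued function. -/
def coef (f : ℝ → ℂ) (k : ℤ) : ℂ :=
  1 / (2 * Real.pi) * ∫ x in (-Real.pi)..Real.pi, f x * expi (-k) x

lemma expi_add (j k : ℤ) (x : ℝ) : expi (j + k) x = expi j x * expi k x := by
  rw [expi, expi, expi, ← Complex.exp_add]; push_cast; ring_nf

@[simp] lemma expi_zero (x : ℝ) : expi 0 x = 1 := by simp [expi]

lemma conj_expi (k : ℤ) (x : ℝ) : starRingEnd ℂ (expi k x) = expi (-k) x := by
  rw [expi, expi, ← Complex.exp_conj]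
  simp

lemma norm_expi (k : ℤ) (x : ℝ) : ‖expi k x‖ = 1 := by
  rw [expi, show Complex.I * (k : ℂ) * (x : ℂ) = ((k * x : ℝ) : ℂ) * Complex.I by push_cast; ring]
  exact Complex.norm_exp_ofReal_mul_I _

lemma hasDerivAt_expi (k : ℤ) (x : ℝ) :
    HasDerivAt (expi k) (Complex.I * k * expi k x) x := by
  have h := ((hasDerivAt_id x).ofReal_comp.const_mul (Complex.I * (k : ℂ))).cexp
  refine h.congr_deriv ?_
  simp only [expi, id, Complex.ofReal_one, mul_one]
  ring

lemma continuous_expi (k : ℤ) : Continuous (expi k) := by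
  unfold expi; fun_prop

lemma expi_periodic (k : ℤ) : Function.Periodic (expi k) (2 * Real.pi) := fun x => by
  simp only [expi]
  rw [Complex.exp_eq_exp_iff_exists_int]
  exact ⟨k, by push_cast; ring⟩

lemma integral_expi (k : ℤ) :
    ∫ x in (-Real.pi)..Real.pi, expi k x = if k = 0 then 2 * (Real.pi : ℂ) else 0 := by
  split_ifs with h
  · subst h
    simp only [expi_zero, intervalIntegral.integral_const, sub_neg_eq_add]
    rw [Complex.real_smul]; push_cast; ring
  · have hk : Complex.I * (k : ℂ) ≠ 0 := mul_ne_zero Complex.I_ne_zero (by exact_mod_cast h)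
    have := integral_exp_mul_complex (a := -Real.pi) (b := Real.pi) hk
    simp only [expi]
    rw [this, div_eq_zero_iff]
    left
    rw [sub_eq_zero, Complex.exp_eq_exp_iff_exists_int]
    exact ⟨k, by push_cast; ring⟩

lemma expi_mem_SN {N : ℕ} {k : ℤ} (hk : k ∈ box N) : expi k ∈ SN N :=
  Submodule.subset_span ⟨k, by simpa [box] using hk, rfl⟩

lemma coef_eq_l2Inner (f : ℝ → ℂ) (k : ℤ) : coef f k = 1 / (2 * Real.pi) * l2Inner f (expi k) := by
  simp only [coef, l2Inner, conj_expi]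

lemma coef_eq_zero_iff (f : ℝ → ℂ) (k : ℤ) : coef f k = 0 ↔ l2Inner f (expi k) = 0 := by
  rw [coef_eq_l2Inner, mul_eq_zero, or_iff_right]
  have : (Real.pi : ℂ) ≠ 0 := by exact_mod_cast Real.pi_ne_zero
  exact one_div_ne_zero (mul_ne_zero two_ne_zero this)

lemma fourierCoeffOn_eq_coef (f : ℝ → ℂ) (k : ℤ) :
    fourierCoeffOn (neg_lt_self Real.pi_pos) f k = coef f k := by
  rw [fourierCoeffOn_eq_integral, coef, Complex.real_smul]
  congr 1
  · push_cast; ring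
  · refine intervalIntegral.integral_congr fun x _ => ?_
    simp only [smul_eq_mul]
    rw [mul_comm, fourier_coe_apply, expi]
    congr 2
    have : (Real.pi : ℂ) ≠ 0 := by exact_mod_cast Real.pi_ne_zero
    push_cast
    field_simp
    ring

lemma fourierHat_eq_coef (f : ℝ → ℝ) (k : ℤ) : fourierHat f k = coef (fun x => (f x : ℂ)) k :=
  fourierCoeffOn_eq_coef _ _

lemma coef_add {f g : ℝ → ℂ} (hf : IntervalIntegrable f volume (-Real.pi) Real.pi)
    (hg : IntervalIntegrable g volume (-Real.pi) Real.pi) (k : ℤ) :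
    coef (fun x => f x + g x) k = coef f k + coef g k := by
  simp only [coef, add_mul]
  rw [intervalIntegral.integral_add (hf.mul_continuousOn (continuous_expi _).continuousOn)
    (hg.mul_continuousOn (continuous_expi _).continuousOn), mul_add]

lemma coef_sub {f g : ℝ → ℂ} (hf : IntervalIntegrable f volume (-Real.pi) Real.pi)
    (hg : IntervalIntegrable g volume (-Real.pi) Real.pi) (k : ℤ) :
    coef (fun x => f x - g x) k = coef f k - coef g k := by
  simp only [coef, sub_mul]
  rw [intervalIntegral.integral_sub (hf.mul_continuousOn (continuous_expi _).continuousOn)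
    (hg.mul_continuousOn (continuous_expi _).continuousOn), mul_sub]

lemma coef_const_mul (c : ℂ) (f : ℝ → ℂ) (k : ℤ) :
    coef (fun x => c * f x) k = c * coef f k := by
  simp only [coef, mul_assoc, intervalIntegral.integral_const_mul]
  ring

lemma coef_sum {ι : Type*} (s : Finset ι) (f : ι → ℝ → ℂ) (hf : ∀ i ∈ s, Continuous (f i)) (k : ℤ) :
    coef (fun x => ∑ i ∈ s, f i x) k = ∑ i ∈ s, coef (f i) k := by
  simp only [coef, Finset.sum_mul]
  rw [intervalIntegral.integral_finsetSum, Finset.mul_sum]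
  exact fun i hi => ((hf i hi).mul (continuous_expi _)).intervalIntegrable _ _

lemma coef_expi (j k : ℤ) : coef (expi j) k = if j = k then 1 else 0 := by
  simp only [coef, ← expi_add, integral_expi]
  have : (Real.pi : ℂ) ≠ 0 := by exact_mod_cast Real.pi_ne_zero
  rw [← sub_eq_add_neg]
  simp only [sub_eq_zero]
  split_ifs
  · field_simp
  · rw [mul_zero]

lemma norm_coef_le {f : ℝ → ℂ} {B : ℝ} (h : ∀ x, ‖f x‖ ≤ B) (k : ℤ) : ‖coef f k‖ ≤ B := by
  have h1 := intervalIntegral.norm_integral_le_of_norm_le_const (a := -Real.pi) (b := Real.pi)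
    (f := fun x => f x * expi (-k) x) (C := B) (fun x _ => by
      rw [norm_mul, norm_expi, mul_one]; exact h x)
  rw [coef, norm_mul, norm_div, norm_mul, Complex.norm_real, Real.norm_of_nonneg Real.pi_pos.le]
  rw [abs_of_pos (by linarith [Real.pi_pos])] at h1
  rw [norm_one, Complex.norm_ofNat, one_div, inv_mul_le_iff₀ (by positivity)]
  linarith

lemma isRealCoeff_fourierHat (f : ℝ → ℝ) : IsRealCoeff (fourierHat f) := by
  intro k
  rw [fourierHat_eq_coef, fourierHat_eq_coef, coef, coef, map_mul, neg_neg]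
  congr 1
  · simp only [map_div₀, map_one, map_mul, map_ofNat, Complex.conj_ofReal]
  · rw [intervalIntegral.integral_of_le (by linarith [Real.pi_pos]),
      intervalIntegral.integral_of_le (by linarith [Real.pi_pos]), ← integral_conj]
    simp [conj_expi]

/-- The trigonometric polynomial with coefficients `a`. -/
def trig (N : ℕ) (a : ℤ → ℂ) (x : ℝ) : ℂ := ∑ k ∈ box N, a k * expi k x

lemma continuous_trig (N : ℕ) (a : ℤ → ℂ) : Continuous (trig N a) :=
  continuous_finsetSum _ fun k _ => continuous_const.mul (continuous_expi k)

lemma hasDerivAt_trig (N : ℕ) (a : ℤ → ℂ) (x : ℝ) :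
    HasDerivAt (trig N a) (trig N (fun k => Complex.I * k * a k) x) x := by
  refine (HasDerivAt.fun_sum fun k _ => (hasDerivAt_expi k x).const_mul (a k)).congr_deriv ?_
  exact Finset.sum_congr rfl fun k _ => by ring

lemma coef_trig (N : ℕ) (a : ℤ → ℂ) (k : ℤ) : coef (trig N a) k = if k ∈ box N then a k else 0 := by
  unfold trig
  rw [coef_sum _ (fun k x => a k * expi k x) fun k _ => continuous_const.mul (continuous_expi k)]
  simp only [coef_const_mul, coef_expi, mul_ite, mul_one, mul_zero]
  rw [Finset.sum_ite_eq']

lemma exists_trig_of_mem_SN {N : ℕ} {f : ℝ → ℂ} (hf : f ∈ SN N) : ∃ a, f = trig N a := by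
  unfold SN at hf
  induction hf using Submodule.span_induction with
  | mem f hf =>
    obtain ⟨k, hk, rfl⟩ := hf
    refine ⟨fun j => if j = k then 1 else 0, ?_⟩
    funext x
    have : k ∈ box N := by simpa [box] using hk
    simp [trig, this, expi]
  | zero => exact ⟨0, by funext x; simp [trig]⟩
  | add f g _ _ hf hg =>
    obtain ⟨a, rfl⟩ := hf
    obtain ⟨b, rfl⟩ := hg
    exact ⟨a + b, by funext x; simp [trig, add_mul, Finset.sum_add_distrib]⟩
  | smul c f _ hf =>
    obtain ⟨a, rfl⟩ := hf
    exact ⟨c • a, by funext x; simp [trig, Finset.mul_sum, mul_assoc]⟩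

lemma MemRealSN.fourierHat_eq_zero {N : ℕ} {f : ℝ → ℝ} (hf : MemRealSN N f) {k : ℤ}
    (hk : k ∉ box N) : fourierHat f k = 0 := by
  obtain ⟨a, ha⟩ := exists_trig_of_mem_SN hf
  rw [fourierHat_eq_coef, ha, coef_trig, if_neg hk]

lemma MemRealSN.eq_trig {N : ℕ} {f : ℝ → ℝ} (hf : MemRealSN N f) (x : ℝ) :
    (f x : ℂ) = trig N (fourierHat f) x := by
  obtain ⟨a, ha⟩ := exists_trig_of_mem_SN hf
  have : (f x : ℂ) = trig N a x := congrFun ha x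
  rw [this]
  refine Finset.sum_congr rfl fun k hk => ?_
  rw [fourierHat_eq_coef, ha, coef_trig, if_pos hk]

lemma MemRealSN.continuous {N : ℕ} {f : ℝ → ℝ} (hf : MemRealSN N f) : Continuous f := by
  have : Continuous fun x => (f x : ℂ) := by
    simp only [hf.eq_trig]; exact continuous_trig _ _
  exact Complex.isometry_ofReal.isEmbedding.continuous_iff.2 this

lemma hasDerivAt_of_ofReal_eq {f : ℝ → ℝ} {F : ℝ → ℂ} {F' : ℂ} {x : ℝ}
    (h : ∀ x, (f x : ℂ) = F x) (hF : HasDerivAt F F' x) :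
    HasDerivAt f F'.re x ∧ ((F'.re : ℝ) : ℂ) = F' := by
  have h1 := Complex.reCLM.hasFDerivAt.comp_hasDerivAt x hF
  have h2 := Complex.imCLM.hasFDerivAt.comp_hasDerivAt x hF
  have e1 : (Complex.reCLM : ℂ → ℝ) ∘ F = f := by
    funext x; simp [← h x]
  have e2 : (Complex.imCLM : ℂ → ℝ) ∘ F = fun _ => 0 := by
    funext x; simp [← h x]
  rw [e1] at h1
  rw [e2] at h2
  have h3 : F'.im = 0 := h2.unique (hasDerivAt_const x 0)
  exact ⟨h1, Complex.ext (by simp) (by simp [h3])⟩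

lemma iteratedDeriv_eq_trig {N : ℕ} {f : ℝ → ℝ} {a : ℤ → ℂ} (h : ∀ x, (f x : ℂ) = trig N a x) :
    ∀ (n : ℕ) (x : ℝ),
      ((iteratedDeriv n f x : ℝ) : ℂ) = trig N (fun k => (Complex.I * k) ^ n * a k) x
  | 0, x => by simp [h x]
  | n + 1, x => by
    have h1 := hasDerivAt_of_ofReal_eq (iteratedDeriv_eq_trig h n) (hasDerivAt_trig N _ x)
    rw [iteratedDeriv_succ, h1.1.deriv, h1.2]
    congr 1
    funext k; ring

lemma two_mul_conv_deriv (N : ℕ) (a : ℤ → ℂ) (k : ℤ) :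
    2 * conv N a (fun n => Complex.I * n * a n) k = Complex.I * k * conv N a a k := by
  have h1 := conv_comm N a (fun n => Complex.I * n * a n) k
  rw [two_mul]
  nth_rw 1 [h1]
  simp only [conv, ← Finset.sum_add_distrib, Finset.mul_sum]
  refine Finset.sum_congr rfl fun j _ => Finset.sum_congr rfl fun n _ => ?_
  split_ifs with h
  · subst h; push_cast; ring
  · ring

lemma coef_trig_mul_trig (N : ℕ) (a b : ℤ → ℂ) (k : ℤ) :
    coef (fun x => trig N a x * trig N b x) k = conv N a b k := by
  have e : ∀ x, trig N a x * trig N b x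
      = ∑ j ∈ box N, ∑ n ∈ box N, (a j * b n) * expi (j + n) x := fun x => by
    rw [trig, trig, Finset.sum_mul_sum]
    refine Finset.sum_congr rfl fun j _ => Finset.sum_congr rfl fun n _ => ?_
    rw [expi_add]; ring
  simp only [e]
  rw [coef_sum _ (fun j x => ∑ n ∈ box N, (a j * b n) * expi (j + n) x)
    fun j _ => continuous_finsetSum _ fun n _ => continuous_const.mul (continuous_expi _)]
  refine Finset.sum_congr rfl fun j _ => ?_
  rw [coef_sum _ (fun n x => (a j * b n) * expi (j + n) x)
    fun n _ => continuous_const.mul (continuous_expi _)]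
  refine Finset.sum_congr rfl fun n _ => ?_
  rw [coef_const_mul, coef_expi]
  simp

lemma MemRealSN.ofReal_spatialPart {N : ℕ} {w : ℝ → ℝ} (hw : MemRealSN N w) (x : ℝ) :
    ((spatialPart w x : ℝ) : ℂ) = trig N (fourierHat w) x
        * trig N (fun k => Complex.I * k * fourierHat w k) x
      + trig N (fun k => -disp k * fourierHat w k) x := by
  have h1 := iteratedDeriv_eq_trig hw.eq_trig 1 x
  have h3 := iteratedDeriv_eq_trig hw.eq_trig 3 x
  have h5 := iteratedDeriv_eq_trig hw.eq_trig 5 x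
  rw [iteratedDeriv_one] at h1
  rw [spatialPart]
  push_cast
  rw [h1, h3, h5, hw.eq_trig x, add_sub_assoc]
  congr 1
  · simp
  · simp only [trig, ← Finset.sum_sub_distrib]
    refine Finset.sum_congr rfl fun k _ => ?_
    simp only [disp, mul_pow, Complex.I_pow_three, show Complex.I ^ 5 = Complex.I by
      rw [show 5 = 4 + 1 by rfl, pow_succ, Complex.I_pow_four, one_mul]]
    ring

lemma MemRealSN.coef_spatialPart {N : ℕ} {w : ℝ → ℝ} (hw : MemRealSN N w) {k : ℤ}
    (hk : k ∈ box N) :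
    coef (fun x => ((spatialPart w x : ℝ) : ℂ)) k = -galD₁ N (fourierHat w) k := by
  simp only [hw.ofReal_spatialPart]
  rw [coef_add (f := fun x => trig N (fourierHat w) x
      * trig N (fun k => Complex.I * k * fourierHat w k) x)
    (((continuous_trig _ _).mul (continuous_trig _ _)).intervalIntegrable _ _)
    ((continuous_trig _ _).intervalIntegrable _ _), coef_trig_mul_trig, coef_trig, if_pos hk,
    galD₁, bil]
  linear_combination (1 / 2) * two_mul_conv_deriv N (fourierHat w) k

lemma MemRealSN.continuous_spatialPart {N : ℕ} {w : ℝ → ℝ} (hw : MemRealSN N w) :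
    Continuous fun x => ((spatialPart w x : ℝ) : ℂ) := by
  simp only [hw.ofReal_spatialPart]
  exact ((continuous_trig _ _).mul (continuous_trig _ _)).add (continuous_trig _ _)

lemma MemRealSN.halfSum {N : ℕ} {v w : ℝ → ℝ} (hv : MemRealSN N v) (hw : MemRealSN N w) :
    MemRealSN N (halfSum v w) := by
  have := (SN N).smul_mem (1 / 2 : ℂ) ((SN N).add_mem hv hw)
  unfold MemRealSN
  convert this using 1
  funext x
  simp only [Kawahara.halfSum, Pi.smul_apply, Pi.add_apply, smul_eq_mul]
  push_cast; ring

lemma MemRealSN.sub {N : ℕ} {v w : ℝ → ℝ} (hv : MemRealSN N v) (hw : MemRealSN N w) :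
    MemRealSN N (fun x => v x - w x) := by
  have := (SN N).sub_mem hv hw
  unfold MemRealSN
  convert this using 1
  funext x
  simp

lemma Continuous.intervalIntegrable_ofReal {f : ℝ → ℝ} (hf : Continuous f) (a b : ℝ) :
    IntervalIntegrable (fun x => (f x : ℂ)) volume a b :=
  (Complex.continuous_ofReal.comp hf).intervalIntegrable _ _

lemma fourierHat_sub {f g : ℝ → ℝ}
    (hf : IntervalIntegrable (fun x => (f x : ℂ)) volume (-Real.pi) Real.pi)
    (hg : IntervalIntegrable (fun x => (g x : ℂ)) volume (-Real.pi) Real.pi) (k : ℤ) :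
    fourierHat (fun x => f x - g x) k = fourierHat f k - fourierHat g k := by
  simp only [fourierHat_eq_coef, Complex.ofReal_sub]
  exact coef_sub hf hg k

lemma fourierHat_halfSum {f g : ℝ → ℝ} (hf : Continuous f) (hg : Continuous g) (k : ℤ) :
    fourierHat (halfSum f g) k = 1 / 2 * (fourierHat f k + fourierHat g k) := by
  simp only [fourierHat_eq_coef, halfSum]
  rw [← coef_add (Continuous.intervalIntegrable_ofReal hf _ _)
    (Continuous.intervalIntegrable_ofReal hg _ _), ← coef_const_mul]
  congr 1
  funext x; push_cast; ring

/-! ### Passage from functions to coefficients. -/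

lemma IsCrankNicolson.isCNCoeff {N : ℕ} {τ : ℝ} {M : ℕ} {V : ℕ → ℝ → ℝ}
    (h : IsCrankNicolson N τ M V) : IsCNCoeff N τ M fun m => fourierHat (V m) where
  real m _ := isRealCoeff_fourierHat _
  step m hm k hk := by
    have h0 := h.mem m hm.le
    have h1 := h.mem (m + 1) hm
    have hs := h.step m hm (expi k) (expi_mem_SN hk)
    have e : coef (fun x => ((V (m + 1) x - V m x : ℝ) : ℂ)) k
        + τ * coef (fun x => ((spatialPart (halfSum (V m) (V (m + 1))) x : ℝ) : ℂ)) k = 0 := by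
      rw [coef_eq_l2Inner, coef_eq_l2Inner]
      linear_combination (1 / (2 * Real.pi : ℂ)) * hs
    rw [(h0.halfSum h1).coef_spatialPart hk, ← fourierHat_eq_coef (fun x => V (m + 1) x - V m x),
      fourierHat_sub (Continuous.intervalIntegrable_ofReal h1.continuous _ _)
      (Continuous.intervalIntegrable_ofReal h0.continuous _ _),
      show fourierHat (halfSum (V m) (V (m + 1)))
        = fun k => 1 / 2 * (fourierHat (V m) k + fourierHat (V (m + 1)) k) from
        funext (fourierHat_halfSum h0.continuous h1.continuous)] at e
    rw [cnResidual]
    linear_combination e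

/-- Parseval's identity. -/
lemma l2Norm_eq_of_memLp {f : ℝ → ℝ}
    (hf : MemLp (fun x => (f x : ℂ)) 2 (volume.restrict (Set.Ioc (-Real.pi) Real.pi))) :
    l2Norm f = Real.sqrt (2 * Real.pi * ∑' k, ‖fourierHat f k‖ ^ 2) ∧
      Summable fun k => ‖fourierHat f k‖ ^ 2 := by
  have h := hasSum_sq_fourierCoeffOn (neg_lt_self Real.pi_pos) hf
  refine ⟨?_, h.summable⟩
  unfold fourierHat
  rw [h.tsum_eq, l2Norm]
  congr 1
  simp only [Complex.norm_real, Real.norm_eq_abs, sq_abs, smul_eq_mul]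
  have := Real.pi_ne_zero
  field_simp
  ring

lemma Continuous.memLp_Ioc {f : ℝ → ℝ} (hf : Continuous f) :
    MemLp (fun x => (f x : ℂ)) 2 (volume.restrict (Set.Ioc (-Real.pi) Real.pi)) := by
  obtain ⟨C, hC⟩ := isCompact_Icc.exists_bound_of_continuousOn (s := Set.Icc (-Real.pi) Real.pi)
    (Complex.continuous_ofReal.comp hf).continuousOn
  refine MemLp.of_bound (Complex.continuous_ofReal.comp hf).aestronglyMeasurable C ?_
  rw [ae_restrict_iff' measurableSet_Ioc]
  exact Filter.Eventually.of_forall fun x hx => hC x (Set.Ioc_subset_Icc_self hx)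

lemma MemRealSN.l2Norm_eq {N : ℕ} {f : ℝ → ℝ} (hf : MemRealSN N f) :
    l2Norm f = Real.sqrt (2 * Real.pi) * l2 N (fourierHat f) := by
  rw [(l2Norm_eq_of_memLp (Continuous.memLp_Ioc hf.continuous)).1, Real.sqrt_mul (by positivity),
    l2, tsum_eq_sum (s := box N) fun k hk => by simp [hf.fourierHat_eq_zero hk]]

/-- The interpolation nodes `2πl / (2N + 1)`. -/
def node (N l : ℕ) : ℝ := 2 * Real.pi * l / (2 * N + 1)

/-- A geometric sum over a root of unity; `|d| ≤ 2N` stays below `2N + 1`, so the root is 1 only for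
`d = 0`. -/
lemma sum_expi_node {N : ℕ} {d : ℤ} (hd : |d| ≤ 2 * N) :
    ∑ l ∈ Finset.range (2 * N + 1), expi d (node N l)
      = if d = 0 then (2 * N + 1 : ℂ) else 0 := by
  split_ifs with h
  · subst h; simp
  · have hM : (2 * N + 1 : ℂ) ≠ 0 := by exact_mod_cast Nat.succ_ne_zero (2 * N)
    set ζ : ℂ := Complex.exp (2 * Real.pi * Complex.I * d / (2 * N + 1))
    have e : ∀ l : ℕ, expi d (node N l) = ζ ^ l := fun l => by
      rw [expi, node, ← Complex.exp_nat_mul]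
      congr 1; push_cast; ring
    have hζ : ζ ^ (2 * N + 1) = 1 := by
      rw [← Complex.exp_nat_mul, Complex.exp_eq_one_iff]
      exact ⟨d, by push_cast; field_simp⟩
    have hζ1 : ζ ≠ 1 := by
      intro h1
      obtain ⟨n, hn⟩ := Complex.exp_eq_one_iff.1 h1
      have hpi : (2 * Real.pi * Complex.I : ℂ) ≠ 0 := Complex.two_pi_I_ne_zero
      have h2 : (d : ℂ) = n * (2 * N + 1) := by
        have h3 : (2 * Real.pi * Complex.I : ℂ) * d
            = (2 * Real.pi * Complex.I : ℂ) * (n * (2 * N + 1)) := by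
          rw [div_eq_iff hM] at hn
          rw [hn]; ring
        exact mul_left_cancel₀ hpi h3
      have h4 : d = n * (2 * N + 1) := by exact_mod_cast h2
      have hn0 : n ≠ 0 := by rintro rfl; simp at h4; exact h h4
      have h5 : (1 : ℤ) ≤ |n| := Int.one_le_abs hn0
      rw [h4, abs_mul, abs_of_nonneg (by positivity : (0 : ℤ) ≤ 2 * N + 1)] at hd
      nlinarith
    simp only [e]
    rw [geom_sum_eq hζ1, hζ, sub_self, zero_div]

/-- The discrete Fourier transform recovers the coefficients of a trigonometric polynomial. -/
lemma sum_trig_node {N : ℕ} (a : ℤ → ℂ) {k : ℤ} (hk : k ∈ box N) :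
    1 / (2 * N + 1 : ℂ) * ∑ l ∈ Finset.range (2 * N + 1),
      trig N a (node N l) * expi (-k) (node N l) = a k := by
  have hM : (2 * N + 1 : ℂ) ≠ 0 := by exact_mod_cast Nat.succ_ne_zero (2 * N)
  have h : ∑ l ∈ Finset.range (2 * N + 1), trig N a (node N l) * expi (-k) (node N l)
      = ∑ j ∈ box N, a j * (if j = k then (2 * N + 1 : ℂ) else 0) := by
    simp only [trig, Finset.sum_mul]
    rw [Finset.sum_comm]
    refine Finset.sum_congr rfl fun j hj => ?_
    have hd : |j + -k| ≤ 2 * N := by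
      rw [mem_box] at hj hk
      have := abs_add_le j (-k)
      rw [abs_neg] at this
      linarith
    have hs := sum_expi_node hd
    simp only [← sub_eq_add_neg, sub_eq_zero] at hs
    rw [← hs, Finset.mul_sum]
    refine Finset.sum_congr rfl fun l _ => ?_
    rw [sub_eq_add_neg, expi_add]; ring
  rw [h]
  simp only [mul_ite, mul_zero, Finset.sum_ite_eq', if_pos hk]
  field_simp

/-- The time derivative is given only pointwise in `x`. Coefficients of elements of `SN N` are
finite combinations of values at `2N + 1` nodes, so they are differentiable without exchanging
derivative and integral. -/
lemma IsSemiDiscrete.isGalerkin {N : ℕ} {u₀ : ℝ → ℝ} {U : ℝ → ℝ → ℝ}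
    (h : IsSemiDiscrete N u₀ U) : IsGalerkin N fun t => fourierHat (U t) where
  real _ _ := isRealCoeff_fourierHat _
  deriv t ht k hk := by
    obtain ⟨Ut, hUt, heq⟩ := h.equation t ht
    set b : ℤ → ℂ := fun k => 1 / (2 * N + 1 : ℂ) * ∑ l ∈ Finset.range (2 * N + 1),
      (Ut (node N l) : ℂ) * expi (-k) (node N l) with hb
    have hd : ∀ k ∈ box N, HasDerivWithinAt (fun s => fourierHat (U s) k) (b k) (Set.Ici 0) t := by
      intro k hk
      have h1 : HasDerivWithinAt (fun s => 1 / (2 * N + 1 : ℂ) *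
          ∑ l ∈ Finset.range (2 * N + 1), (U s (node N l) : ℂ) * expi (-k) (node N l)) (b k)
          (Set.Ici 0) t :=
        (HasDerivWithinAt.fun_sum fun l _ => (HasDerivWithinAt.ofReal_comp
          (hUt (node N l))).mul_const _).const_mul _
      have h2 : ∀ s ∈ Set.Ici (0 : ℝ), fourierHat (U s) k = 1 / (2 * N + 1 : ℂ) *
          ∑ l ∈ Finset.range (2 * N + 1), (U s (node N l) : ℂ) * expi (-k) (node N l) :=
        fun s hs => by
          simp only [(h.mem s hs).eq_trig]
          exact (sum_trig_node _ hk).symm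
      exact h1.congr h2 (h2 t ht)
    -- Nothing says beforehand that `Ut` lies in `SN N`; uniqueness of one-sided derivatives
    -- identifies it with the polynomial of coefficients `b`.
    have hUtrig : ∀ x, (Ut x : ℂ) = trig N b x := fun x => by
      have h1 : HasDerivWithinAt (fun s => (U s x : ℂ)) (Ut x : ℂ) (Set.Ici 0) t :=
        HasDerivWithinAt.ofReal_comp (hUt x)
      have h2 : HasDerivWithinAt (fun s => trig N (fourierHat (U s)) x) (trig N b x)
          (Set.Ici 0) t :=
        HasDerivWithinAt.fun_sum fun k hk => (hd k hk).mul_const _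
      have h3 : HasDerivWithinAt (fun s => (U s x : ℂ)) (trig N b x) (Set.Ici 0) t :=
        h2.congr (fun s hs => (h.mem s hs).eq_trig x) ((h.mem t ht).eq_trig x)
      exact (uniqueDiffOn_Ici 0 t ht).eq_deriv _ h1 h3
    have h4 := (coef_eq_zero_iff _ k).2 (heq (expi k) (expi_mem_SN hk))
    simp only [Complex.ofReal_add, hUtrig] at h4
    rw [coef_add ((continuous_trig _ _).intervalIntegrable _ _)
      ((h.mem t ht).continuous_spatialPart.intervalIntegrable _ _), coef_trig, if_pos hk,
      (h.mem t ht).coef_spatialPart hk] at h4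
    exact (hd k hk).congr_deriv (by rw [← sub_eq_zero]; exact h4)

lemma MemH.intervalIntegrable {r : ℕ} {f : ℝ → ℝ} (hf : MemH r f) :
    IntervalIntegrable (fun x => (f x : ℂ)) volume (-Real.pi) Real.pi := by
  have h : IntegrableOn f (Set.Icc (-Real.pi) Real.pi) := hf.memL2.integrable one_le_two
  rw [intervalIntegrable_iff_integrableOn_Icc_of_le (by linarith [Real.pi_pos])]
  exact h.ofReal

lemma IsProj.fourierHat_eq {N r : ℕ} {f g : ℝ → ℝ} (hf : MemH r f) (h : IsProj N f g) {k : ℤ}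
    (hk : k ∈ box N) : fourierHat g k = fourierHat f k := by
  have h1 := (coef_eq_zero_iff _ k).2 (h.2 (expi k) (expi_mem_SN hk))
  rw [← fourierHat_eq_coef (fun x => f x - g x), fourierHat_sub hf.intervalIntegrable
    (Continuous.intervalIntegrable_ofReal h.1.continuous _ _)] at h1
  exact (sub_eq_zero.1 h1).symm

lemma bra_pow_two_mul_le (k : ℤ) (s : ℕ) : bra k ^ (2 * s) ≤ 2 ^ s * (1 + (k : ℝ) ^ 2) ^ s := by
  rw [pow_mul, ← mul_pow]
  refine pow_le_pow_left₀ (sq_nonneg _) ?_ s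
  unfold bra
  nlinarith [sq_nonneg (1 - |(k : ℝ)|), sq_abs (k : ℝ)]

lemma MemH.sum_bra_pow_le {r s : ℕ} {f : ℝ → ℝ} (hf : MemH r f) (hs : s ≤ r) (S : Finset ℤ) :
    ∑ k ∈ S, bra k ^ (2 * s) * ‖fourierHat f k‖ ^ 2
      ≤ 2 ^ r * ∑' k : ℤ, (1 + (k : ℝ) ^ 2) ^ r * ‖fourierHat f k‖ ^ 2 := by
  have h1 : ∑ k ∈ S, (1 + (k : ℝ) ^ 2) ^ r * ‖fourierHat f k‖ ^ 2
      ≤ ∑' k : ℤ, (1 + (k : ℝ) ^ 2) ^ r * ‖fourierHat f k‖ ^ 2 :=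
    hf.summable.sum_le_tsum S fun k _ => by positivity
  refine le_trans ?_ (mul_le_mul_of_nonneg_left h1 (by positivity))
  rw [Finset.mul_sum]
  refine Finset.sum_le_sum fun k _ => ?_
  rw [← mul_assoc]
  refine mul_le_mul_of_nonneg_right ?_ (sq_nonneg _)
  exact (pow_le_pow_right₀ (one_le_bra k) (by omega)).trans (bra_pow_two_mul_le k r)

/-- Uniform bounds for all semi-discrete solutions with given initial data. -/
lemma exists_semiDiscrete_bound {r : ℕ} {u₀ : ℝ → ℝ} (hr : 16 ≤ r) (hu₀ : MemH r u₀) (T : ℝ) :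
    ∃ A : ℝ, 0 < A ∧ ∀ (N : ℕ) (U : ℝ → ℝ → ℝ), IsSemiDiscrete N u₀ U →
      ∀ t ∈ Set.Icc 0 T, wnorm N 15 (fourierHat (U t)) ≤ A := by
  obtain ⟨A, hA, h⟩ := exists_wnorm_bound
    (2 ^ r * ∑' k : ℤ, (1 + (k : ℝ) ^ 2) ^ r * ‖fourierHat u₀ k‖ ^ 2) T
  refine ⟨A, hA, fun N U hU => h N _ hU.isGalerkin ?_⟩
  rw [Finset.sum_congr rfl fun k hk => by rw [hU.initial.fourierHat_eq hu₀ hk]]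
  exact hu₀.sum_bra_pow_le (s := 16) hr _

lemma IsCrankNicolson.l2Norm_eq {N : ℕ} {τ : ℝ} {M : ℕ} {V : ℕ → ℝ → ℝ}
    (h : IsCrankNicolson N τ M V) {m : ℕ} (hm : m ≤ M) : l2Norm (V m) = l2Norm (V 0) := by
  rw [(h.mem m hm).l2Norm_eq, (h.mem 0 (Nat.zero_le _)).l2Norm_eq, h.isCNCoeff.l2_eq m hm]

/-! ### Sobolev embedding and truncation in `H^r`. -/

/-- Pointwise bound by the absolute sum of the Fourier coefficients. -/
lemma norm_le_tsum_coef {g : ℝ → ℂ} (hc : Continuous g) (hp : Function.Periodic g (2 * Real.pi))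
    (hs : Summable fun k => ‖coef g k‖) (x : ℝ) : ‖g x‖ ≤ ∑' k, ‖coef g k‖ := by
  have : Fact (0 < 2 * Real.pi) := ⟨by positivity⟩
  have hG : Continuous hp.lift := by
    refine (QuotientAddGroup.isQuotientMap_mk (N := AddSubgroup.zmultiples
      (2 * Real.pi))).continuous_iff.2 ?_
    exact hc
  set G : C(AddCircle (2 * Real.pi), ℂ) := ⟨hp.lift, hG⟩
  have hcoef : ∀ n, fourierCoeff G n = coef g n := fun n => by
    rw [fourierCoeff_eq_intervalIntegral G n (-Real.pi), coef, Complex.real_smul,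
      show -Real.pi + 2 * Real.pi = Real.pi by ring]
    congr 1
    · push_cast; ring
    · refine intervalIntegral.integral_congr fun x _ => ?_
      simp only [smul_eq_mul]
      rw [mul_comm, fourier_coe_apply, expi]
      congr 2
      have : (Real.pi : ℂ) ≠ 0 := by exact_mod_cast Real.pi_ne_zero
      push_cast
      field_simp
  have hsum : Summable (fourierCoeff G) := by
    refine Summable.of_norm ?_
    simpa only [hcoef] using hs
  have h := has_pointwise_sum_fourier_series_of_summable hsum (x : AddCircle (2 * Real.pi))
  have h1 : g x = G (x : AddCircle (2 * Real.pi)) := (hp.lift_coe x).symm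
  rw [h1, ← h.tsum_eq]
  have hn : ∀ i, ‖fourierCoeff G i • fourier i (x : AddCircle (2 * Real.pi))‖ = ‖coef g i‖ :=
    fun i => by rw [norm_smul, hcoef, fourier_apply, Circle.norm_coe, mul_one]
  refine (norm_tsum_le_tsum_norm ?_).trans_eq ?_
  · simpa only [hn] using hs
  · simp only [hn]

lemma coef_deriv {f f' : ℝ → ℂ} (hf : ∀ x, HasDerivAt f (f' x) x) (hf' : Continuous f')
    (hp : Function.Periodic f (2 * Real.pi)) (k : ℤ) : coef f' k = Complex.I * k * coef f k := by
  have hcf : Continuous f := continuous_iff_continuousAt.2 fun x => (hf x).continuousAt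
  have h1 : ∀ x, HasDerivAt (fun x => f x * expi (-k) x)
      (f' x * expi (-k) x + f x * (Complex.I * (-k : ℤ) * expi (-k) x)) x := fun x =>
    (hf x).mul (hasDerivAt_expi (-k) x)
  have i1 : IntervalIntegrable (fun x => f' x * expi (-k) x) volume (-Real.pi) Real.pi :=
    (hf'.mul (continuous_expi _)).intervalIntegrable _ _
  have i2 : IntervalIntegrable (fun x => f x * (Complex.I * (-k : ℤ) * expi (-k) x)) volume
      (-Real.pi) Real.pi :=
    (hcf.mul (continuous_const.mul (continuous_expi _))).intervalIntegrable _ _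
  have h2 := intervalIntegral.integral_eq_sub_of_hasDerivAt (a := -Real.pi) (b := Real.pi)
    (fun x _ => h1 x) (i1.add i2)
  have e1 : f Real.pi = f (-Real.pi) := by
    rw [← hp (-Real.pi)]; congr 1; ring
  have e2 : expi (-k) Real.pi = expi (-k) (-Real.pi) := by
    rw [← expi_periodic (-k) (-Real.pi)]; congr 1; ring
  rw [e1, e2, sub_self, intervalIntegral.integral_add i1 i2] at h2
  have e3 : ∫ x in (-Real.pi)..Real.pi, f x * (Complex.I * (-k : ℤ) * expi (-k) x)
      = -(Complex.I * k) * ∫ x in (-Real.pi)..Real.pi, f x * expi (-k) x := by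
    rw [← intervalIntegral.integral_const_mul]
    refine intervalIntegral.integral_congr fun x _ => ?_
    push_cast; ring
  rw [e3] at h2
  rw [coef, coef]
  linear_combination (1 / (2 * Real.pi : ℂ)) * h2

lemma periodic_iteratedDeriv {f : ℝ → ℝ} {c : ℝ} (hf : Function.Periodic f c) (n : ℕ) :
    Function.Periodic (iteratedDeriv n f) c := fun x => by
  have h := congrFun (iteratedDeriv_comp_add_const n f c) x
  rw [← h]
  congr 1
  exact funext hf

lemma coef_iteratedDeriv {f : ℝ → ℝ} {m : ℕ} (hf : ContDiff ℝ m f)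
    (hp : Function.Periodic f (2 * Real.pi)) (k : ℤ) :
    ∀ n ≤ m, coef (fun x => ((iteratedDeriv n f x : ℝ) : ℂ)) k
      = (Complex.I * k) ^ n * fourierHat f k
  | 0, _ => by simp [fourierHat_eq_coef]
  | n + 1, hn => by
    have hd : ∀ x, HasDerivAt (iteratedDeriv n f) (iteratedDeriv (n + 1) f x) x := fun x => by
      rw [iteratedDeriv_succ]
      exact (hf.differentiable_iteratedDeriv n (by exact_mod_cast hn) x).hasDerivAt
    rw [coef_deriv (fun x => (hd x).ofReal_comp)
      (Complex.continuous_ofReal.comp (hf.continuous_iteratedDeriv (n + 1) (by exact_mod_cast hn)))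
      (fun x => by simp only [periodic_iteratedDeriv hp n x]),
      coef_iteratedDeriv hf hp k n (by omega)]
    ring

/-- The square of the `H^r` norm. -/
def sobolevSq (r : ℕ) (f : ℝ → ℝ) : ℝ := ∑' k : ℤ, (1 + (k : ℝ) ^ 2) ^ r * ‖fourierHat f k‖ ^ 2

lemma sobolevSq_nonneg (r : ℕ) (f : ℝ → ℝ) : 0 ≤ sobolevSq r f :=
  tsum_nonneg fun k => by positivity

/-- The constant bounding `∑ (1 + |k|)^{r-1} |f̂(k)|` in terms of a bound on `sobolevSq`. -/
def embConst (r : ℕ) (D : ℝ) : ℝ := Real.sqrt (braConst * (2 ^ r * D))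

lemma MemH.sum_bra_le {r s : ℕ} {f : ℝ → ℝ} {D : ℝ} (hf : MemH r f) (hs : s + 1 ≤ r)
    (hD : sobolevSq r f ≤ D) (S : Finset ℤ) :
    ∑ k ∈ S, bra k ^ s * ‖fourierHat f k‖ ≤ embConst r D := by
  refine Real.le_sqrt_of_sq_le ((sum_bra_mul_sq_le S s _).trans
    (mul_le_mul_of_nonneg_left ?_ braConst_pos.le))
  exact (hf.sum_bra_pow_le (s := s + 1) hs S).trans (mul_le_mul_of_nonneg_left hD (by positivity))

lemma MemH.summable_bra {r s : ℕ} {f : ℝ → ℝ} (hf : MemH r f) (hs : s + 1 ≤ r) :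
    Summable fun k => bra k ^ s * ‖fourierHat f k‖ :=
  summable_of_sum_le (fun k => by have := bra_pos k; positivity) (hf.sum_bra_le hs le_rfl)

lemma MemH.tsum_bra_le {r s : ℕ} {f : ℝ → ℝ} {D : ℝ} (hf : MemH r f) (hs : s + 1 ≤ r)
    (hD : sobolevSq r f ≤ D) : ∑' k, bra k ^ s * ‖fourierHat f k‖ ≤ embConst r D :=
  (hf.summable_bra hs).tsum_le_of_sum_le (hf.sum_bra_le hs hD)

lemma MemH.abs_iteratedDeriv_le {r n : ℕ} {f : ℝ → ℝ} {D : ℝ} (hf : MemH r f)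
    (hc : ContDiff ℝ n f) (hn : n + 1 ≤ r) (hD : sobolevSq r f ≤ D) (x : ℝ) :
    |iteratedDeriv n f x| ≤ embConst r D := by
  have hle : ∀ k, ‖coef (fun x => ((iteratedDeriv n f x : ℝ) : ℂ)) k‖
      ≤ bra k ^ n * ‖fourierHat f k‖ := fun k => by
    rw [coef_iteratedDeriv hc hf.periodic k n le_rfl, norm_mul, norm_pow, norm_mul, Complex.norm_I,
      one_mul, norm_intCast_complex]
    exact mul_le_mul_of_nonneg_right (pow_le_pow_left₀ (abs_nonneg _) (abs_le_bra k) n)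
      (norm_nonneg _)
  have hs := Summable.of_nonneg_of_le (fun k => norm_nonneg _) hle (hf.summable_bra hn)
  have h := norm_le_tsum_coef (Complex.continuous_ofReal.comp
    (hc.continuous_iteratedDeriv n le_rfl))
    (fun x => by simp only [Function.comp, periodic_iteratedDeriv hf.periodic n x]) hs x
  simp only [Function.comp, Complex.norm_real, Real.norm_eq_abs] at h
  exact h.trans ((hs.tsum_le_tsum hle (hf.summable_bra hn)).trans (hf.tsum_bra_le hn hD))

lemma MemH.norm_trig_le {r K : ℕ} {f : ℝ → ℝ} {D : ℝ} (hf : MemH r f) (hr : 1 ≤ r)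
    (hD : sobolevSq r f ≤ D) (x : ℝ) : ‖trig K (fourierHat f) x‖ ≤ embConst r D := by
  refine (norm_sum_le _ _).trans ?_
  simpa [norm_expi] using hf.sum_bra_le (s := 0) hr hD (box K)

lemma bra_ge_of_notMem_box {N : ℕ} {k : ℤ} (hk : k ∉ box N) : (N : ℝ) + 1 ≤ bra k := by
  rw [mem_box, not_le] at hk
  have : ((N : ℤ) : ℝ) < ((|k| : ℤ) : ℝ) := by exact_mod_cast hk
  push_cast at this
  unfold bra
  linarith

/-- The coefficients with weight `bra^(r-1)` are absolutely summable, and every discarded frequency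
has bracket at least `K + 1`. -/
lemma MemH.norm_sub_trig_le {r K : ℕ} {f : ℝ → ℝ} {D : ℝ} (hf : MemH r f) (hc : Continuous f)
    (hr : 1 ≤ r) (hD : sobolevSq r f ≤ D) (x : ℝ) :
    ‖(f x : ℂ) - trig K (fourierHat f) x‖ ≤ embConst r D / ((K : ℝ) + 1) ^ (r - 1) := by
  have hcc : Continuous fun x => (f x : ℂ) := Complex.continuous_ofReal.comp hc
  have hcoef : ∀ k, coef (fun x => (f x : ℂ) - trig K (fourierHat f) x) k
      = high K (fourierHat f) k := fun k => by
    rw [coef_sub (hcc.intervalIntegrable _ _) ((continuous_trig _ _).intervalIntegrable _ _),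
      coef_trig, ← fourierHat_eq_coef, high]
    split_ifs <;> simp
  have hle : ∀ k, ‖coef (fun x => (f x : ℂ) - trig K (fourierHat f) x) k‖
      ≤ (((K : ℝ) + 1) ^ (r - 1))⁻¹ * (bra k ^ (r - 1) * ‖fourierHat f k‖) := fun k => by
    have hb := bra_pos k
    rw [hcoef, high]
    split_ifs with hk
    · rw [norm_zero]; positivity
    · rw [← mul_assoc]
      refine le_mul_of_one_le_left (norm_nonneg _) ?_
      rw [inv_mul_eq_div, one_le_div (by positivity)]
      exact pow_le_pow_left₀ (by positivity) (bra_ge_of_notMem_box hk) _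
  have hsb := hf.summable_bra (s := r - 1) (by omega)
  have hs := Summable.of_nonneg_of_le (fun k => norm_nonneg _) hle (hsb.mul_left _)
  have hp : Function.Periodic (fun x => (f x : ℂ) - trig K (fourierHat f) x) (2 * Real.pi) :=
    fun x => by
      simp only [hf.periodic x, trig, expi_periodic _ x]
  refine (norm_le_tsum_coef (hcc.sub (continuous_trig _ _)) hp hs x).trans ?_
  refine (hs.tsum_le_tsum hle (hsb.mul_left _)).trans ?_
  rw [tsum_mul_left, inv_mul_eq_div]
  gcongr
  exact hf.tsum_bra_le (by omega) hD

lemma MemH.sub_estimates {r : ℕ} {f g : ℝ → ℝ} (hf : MemH r f) (hg : MemH r g) :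
    (∀ k, ‖fourierHat f k - fourierHat g k‖ ≤ sobolevNorm r fun x => f x - g x) ∧
    sobolevSq r f ≤ 2 * sobolevNorm r (fun x => f x - g x) ^ 2 + 2 * sobolevSq r g := by
  have hsub : ∀ k, fourierHat (fun x => f x - g x) k = fourierHat f k - fourierHat g k :=
    fourierHat_sub hf.intervalIntegrable hg.intervalIntegrable
  have hpar : ∀ a b : ℂ, ‖a - b‖ ^ 2 ≤ 2 * ‖a‖ ^ 2 + 2 * ‖b‖ ^ 2 := fun a b => by
    have := norm_sub_le a b
    have := norm_nonneg (a - b)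
    nlinarith [sq_nonneg (‖a‖ - ‖b‖)]
  have hs : Summable fun k : ℤ => (1 + (k : ℝ) ^ 2) ^ r
      * ‖fourierHat (fun x => f x - g x) k‖ ^ 2 := by
    refine Summable.of_nonneg_of_le (fun k => by positivity) (fun k => ?_)
      ((hf.summable.mul_left 2).add (hg.summable.mul_left 2))
    rw [hsub]
    calc _ ≤ (1 + (k : ℝ) ^ 2) ^ r * (2 * ‖fourierHat f k‖ ^ 2 + 2 * ‖fourierHat g k‖ ^ 2) := by
          gcongr; exact hpar _ _
      _ = _ := by ring
  constructor
  · intro k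
    rw [← hsub]
    refine Real.le_sqrt_of_sq_le (le_trans ?_ (hs.le_tsum k fun j _ => by positivity))
    exact le_mul_of_one_le_left (sq_nonneg _) (one_le_pow₀ (by nlinarith [sq_nonneg (k : ℝ)]))
  · rw [sobolevNorm, Real.sq_sqrt (tsum_nonneg fun k => by positivity), sobolevSq, sobolevSq,
      ← tsum_mul_left, ← tsum_mul_left, ← (hs.mul_left 2).tsum_add (hg.summable.mul_left 2)]
    refine hf.summable.tsum_le_tsum (fun k => ?_) ((hs.mul_left 2).add (hg.summable.mul_left 2))
    rw [hsub]
    have h1 : ‖fourierHat f k‖ ^ 2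
        ≤ 2 * ‖fourierHat f k - fourierHat g k‖ ^ 2 + 2 * ‖fourierHat g k‖ ^ 2 := by
      have := hpar (fourierHat f k - fourierHat g k) (-fourierHat g k)
      simpa using this
    calc _ ≤ (1 + (k : ℝ) ^ 2) ^ r * (2 * ‖fourierHat f k - fourierHat g k‖ ^ 2
          + 2 * ‖fourierHat g k‖ ^ 2) := by gcongr
      _ = _ := by ring

/-! ### Classical solutions as approximate Galerkin solutions. -/

/-- Continuity in `H^r` gives a bound near each time, and compactness of `[0, T]` makes it uniform.
-/
lemma IsSolution.exists_sobolevSq_bound {r : ℕ} {u₀ : ℝ → ℝ} {u : ℝ → ℝ → ℝ}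
    (h : IsSolution r u₀ u) (T : ℝ) : ∃ D : ℝ, ∀ t ∈ Set.Icc 0 T, sobolevSq r (u t) ≤ D := by
  refine isCompact_Icc.induction_on (p := fun s => ∃ D : ℝ, ∀ t ∈ s, 0 ≤ t → sobolevSq r (u t) ≤ D)
    ⟨0, by simp⟩ ?_ ?_ ?_ |>.imp fun D hD t ht => hD t ht ht.1
  · rintro s t hst ⟨D, hD⟩
    exact ⟨D, fun x hx => hD x (hst hx)⟩
  · rintro s t ⟨D, hD⟩ ⟨D', hD'⟩
    refine ⟨max D D', fun x hx h0 => ?_⟩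
    rcases hx with hx | hx
    · exact (hD x hx h0).trans (le_max_left _ _)
    · exact (hD' x hx h0).trans (le_max_right _ _)
  · intro t ht
    have h1 := (h.continuous t ht.1).eventually (gt_mem_nhds zero_lt_one)
    have h2 : ∀ᶠ s in 𝓝[Set.Icc 0 T] t, s ∈ Set.Ici (0 : ℝ) ∧
        sobolevNorm r (fun x => u s x - u t x) < 1 :=
      (Filter.Eventually.and self_mem_nhdsWithin h1).filter_mono
        (nhdsWithin_mono t Set.Icc_subset_Ici_self)
    refine ⟨_, h2, 2 + 2 * sobolevSq r (u t), fun s hs h0 => ?_⟩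
    have h3 := ((h.memH s h0).sub_estimates (h.memH t ht.1)).2
    have h4 : 0 ≤ sobolevNorm r (fun x => u s x - u t x) := Real.sqrt_nonneg _
    have h5 := hs.2
    nlinarith

lemma IsSolution.continuousOn_fourierHat {r : ℕ} {u₀ : ℝ → ℝ} {u : ℝ → ℝ → ℝ}
    (h : IsSolution r u₀ u) (T : ℝ) (k : ℤ) :
    ContinuousOn (fun t => fourierHat (u t) k) (Set.Icc 0 T) := by
  refine ContinuousOn.mono (fun t ht => ?_) Set.Icc_subset_Ici_self
  rw [ContinuousWithinAt, tendsto_iff_norm_sub_tendsto_zero]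
  refine squeeze_zero' (Filter.Eventually.of_forall fun _ => norm_nonneg _) ?_ (h.continuous t ht)
  filter_upwards [self_mem_nhdsWithin] with s hs
  exact ((h.memH s hs).sub_estimates (h.memH t ht)).1 k

lemma continuous_spatialPart_of_contDiff {f : ℝ → ℝ} (hf : ContDiff ℝ 5 f) :
    Continuous (spatialPart f) := by
  have h1 := hf.continuous_iteratedDeriv 1 (by norm_num)
  rw [iteratedDeriv_one] at h1
  exact ((hf.continuous.mul h1).add (hf.continuous_iteratedDeriv 3 (by norm_num))).sub
    (hf.continuous_iteratedDeriv 5 (by norm_num))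

lemma MemH.abs_spatialPart_le {r : ℕ} {f : ℝ → ℝ} {D : ℝ} (hf : MemH r f) (hr : 6 ≤ r)
    (hc : ContDiff ℝ 5 f) (hD : sobolevSq r f ≤ D) (x : ℝ) :
    |spatialPart f x| ≤ embConst r D ^ 2 + 2 * embConst r D := by
  have b : ∀ n : ℕ, n ≤ 5 → |iteratedDeriv n f x| ≤ embConst r D := fun n hn =>
    hf.abs_iteratedDeriv_le (hc.of_le (by exact_mod_cast hn)) (by omega) hD x
  have b0 := b 0 (by norm_num)
  have b1 := b 1 (by norm_num)
  have b3 := b 3 (by norm_num)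
  have b5 := b 5 (by norm_num)
  rw [iteratedDeriv_zero] at b0
  rw [iteratedDeriv_one] at b1
  have hW : 0 ≤ embConst r D := Real.sqrt_nonneg _
  have h1 : |f x * deriv f x| ≤ embConst r D ^ 2 := by
    rw [abs_mul, sq]; exact mul_le_mul b0 b1 (abs_nonneg _) hW
  unfold spatialPart
  have e1 := abs_sub (f x * deriv f x + iteratedDeriv 3 f x) (iteratedDeriv 5 f x)
  have e2 := abs_add_le (f x * deriv f x) (iteratedDeriv 3 f x)
  linarith

lemma coef_spatialPart_of_contDiff {f : ℝ → ℝ} (hf : ContDiff ℝ 5 f)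
    (hp : Function.Periodic f (2 * Real.pi)) (k : ℤ) :
    coef (fun x => ((spatialPart f x : ℝ) : ℂ)) k
      = Complex.I * k / 2 * coef (fun x => (f x : ℂ) ^ 2) k - disp k * fourierHat f k := by
  have hd : ∀ x, HasDerivAt f (deriv f x) x := fun x =>
    (hf.differentiable (by norm_num) x).hasDerivAt
  have h1 := hf.continuous_iteratedDeriv 1 (by norm_num)
  rw [iteratedDeriv_one] at h1
  have c0 : Continuous fun x => (f x : ℂ) := Complex.continuous_ofReal.comp hf.continuous
  have c1 : Continuous fun x => ((deriv f x : ℝ) : ℂ) := Complex.continuous_ofReal.comp h1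
  have c3 : Continuous fun x => ((iteratedDeriv 3 f x : ℝ) : ℂ) :=
    Complex.continuous_ofReal.comp (hf.continuous_iteratedDeriv 3 (by norm_num))
  have c5 : Continuous fun x => ((iteratedDeriv 5 f x : ℝ) : ℂ) :=
    Complex.continuous_ofReal.comp (hf.continuous_iteratedDeriv 5 (by norm_num))
  have hsq : coef (fun x => 2 * ((f x : ℂ) * ((deriv f x : ℝ) : ℂ))) k
      = Complex.I * k * coef (fun x => (f x : ℂ) ^ 2) k := by
    refine coef_deriv (fun x => ?_) (continuous_const.mul (c0.mul c1))
      (fun x => by simp only [hp x]) k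
    refine ((hd x).ofReal_comp.pow 2).congr_deriv ?_
    simp; ring
  rw [coef_const_mul] at hsq
  have h3 := coef_iteratedDeriv (m := 5) hf hp k 3 (by norm_num)
  have h5 := coef_iteratedDeriv (m := 5) hf hp k 5 (by norm_num)
  simp only [spatialPart, Complex.ofReal_sub, Complex.ofReal_add, Complex.ofReal_mul]
  rw [coef_sub (f := fun x => (f x : ℂ) * ((deriv f x : ℝ) : ℂ) + ((iteratedDeriv 3 f x : ℝ) : ℂ))
      (((c0.mul c1).add c3).intervalIntegrable _ _) (c5.intervalIntegrable _ _),
    coef_add (f := fun x => (f x : ℂ) * ((deriv f x : ℝ) : ℂ)) ((c0.mul c1).intervalIntegrable _ _)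
      (c3.intervalIntegrable _ _), h3, h5, disp]
  rw [mul_pow, mul_pow, Complex.I_pow_three, show Complex.I ^ 5 = Complex.I by
      rw [show 5 = 4 + 1 by rfl, pow_succ, Complex.I_pow_four, one_mul]]
  linear_combination (1 / 2) * hsq

/-- The equation holds pointwise in `x`; Sobolev embedding bounds its right side uniformly near `t`,
which permits differentiation under the integral. -/
lemma IsSolution.hasDerivAt_fourierHat {r : ℕ} {u₀ : ℝ → ℝ} {u : ℝ → ℝ → ℝ}
    (h : IsSolution r u₀ u) (hr : 6 ≤ r) {t : ℝ} (ht : 0 < t) (k : ℤ) :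
    HasDerivAt (fun s => fourierHat (u s) k)
      (disp k * fourierHat (u t) k - Complex.I * k / 2 * coef (fun x => (u t x : ℂ) ^ 2) k) t := by
  obtain ⟨D, hD⟩ := h.exists_sobolevSq_bound (t + 1)
  have hmem : Set.Ioo 0 (t + 1) ∈ 𝓝 t := Ioo_mem_nhds ht (by linarith)
  have hc : ∀ s, 0 ≤ s → Continuous fun x => (u s x : ℂ) * expi (-k) x := fun s hs =>
    (Complex.continuous_ofReal.comp (h.contDiff s hs).continuous).mul (continuous_expi _)
  have hcs : Continuous fun x => ((-spatialPart (u t) x : ℝ) : ℂ) * expi (-k) x :=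
    (Complex.continuous_ofReal.comp
      (continuous_spatialPart_of_contDiff (h.contDiff t ht.le)).neg).mul (continuous_expi _)
  have key := (intervalIntegral.hasDerivAt_integral_of_dominated_loc_of_deriv_le
    (μ := volume) (a := -Real.pi) (b := Real.pi) (s := Set.Ioo 0 (t + 1)) (x₀ := t)
    (F := fun s x => (u s x : ℂ) * expi (-k) x)
    (F' := fun s x => ((-spatialPart (u s) x : ℝ) : ℂ) * expi (-k) x)
    (bound := fun _ => embConst r D ^ 2 + 2 * embConst r D) hmem
    (by
      filter_upwards [hmem] with s hs
      exact (hc s hs.1.le).aestronglyMeasurable)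
    ((hc t ht.le).intervalIntegrable _ _) hcs.aestronglyMeasurable
    (Filter.Eventually.of_forall fun x _ s hs => by
      rw [norm_mul, norm_expi, mul_one, Complex.norm_real, norm_neg, Real.norm_eq_abs]
      exact (h.memH s hs.1.le).abs_spatialPart_le hr (h.contDiff s hs.1.le)
        (hD s (Set.Ioo_subset_Icc_self hs)) x)
    intervalIntegrable_const
    (Filter.Eventually.of_forall fun x _ s hs =>
      (((h.equation s hs.1.le x).hasDerivAt (Ici_mem_nhds hs.1)).ofReal_comp).mul_const _)).2
  have h1 := key.const_mul (1 / (2 * Real.pi : ℂ))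
  have e : ∀ s, fourierHat (u s) k = 1 / (2 * Real.pi : ℂ)
      * ∫ x in (-Real.pi)..Real.pi, (u s x : ℂ) * expi (-k) x := fun s => fourierHat_eq_coef _ _
  simp only [e]
  refine h1.congr_deriv ?_
  rw [← e t]
  change coef (fun x => ((-spatialPart (u t) x : ℝ) : ℂ)) k = _
  have e2 : (fun x => ((-spatialPart (u t) x : ℝ) : ℂ))
      = fun x => (-1 : ℂ) * ((spatialPart (u t) x : ℝ) : ℂ) := by funext x; push_cast; ring
  rw [e2, coef_const_mul, coef_spatialPart_of_contDiff (h.contDiff t ht.le)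
    (h.memH t ht.le).periodic]
  ring

/-- The residual of the truncation `P_K u` of a solution in the Galerkin equations. -/
def truncResidual (K : ℕ) (f : ℝ → ℝ) (k : ℤ) : ℂ :=
  -(Complex.I * k / 2) * coef (fun x => (f x : ℂ) ^ 2 - trig K (fourierHat f) x ^ 2) k

/-- The sup-norm truncation error is `(K+1)^{-(r-1)}`. The derivative and the count of `2K + 1`
frequencies each lose one power, whence `r - 3`. -/
lemma MemH.wnorm_truncResidual_le {r : ℕ} {f : ℝ → ℝ} {D : ℝ} (hf : MemH r f) (hr : 3 ≤ r)
    (hc : Continuous f) (hD : sobolevSq r f ≤ D) (K : ℕ) :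
    wnorm K 0 (truncResidual K f) ≤ 2 * embConst r D ^ 2 / ((K : ℝ) + 1) ^ (r - 3) := by
  set W := embConst r D
  have hW : 0 ≤ W := Real.sqrt_nonneg _
  have hK : (0 : ℝ) < (K : ℝ) + 1 := by positivity
  have hb : ∀ x, ‖(f x : ℂ) ^ 2 - trig K (fourierHat f) x ^ 2‖
      ≤ W / ((K : ℝ) + 1) ^ (r - 1) * (2 * W) := fun x => by
    rw [sq_sub_sq, mul_comm, norm_mul]
    refine mul_le_mul (hf.norm_sub_trig_le hc (by omega) hD x) ?_ (norm_nonneg _) (by positivity)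
    have h0 := hf.abs_iteratedDeriv_le (n := 0) (contDiff_zero.2 hc) (by omega) hD x
    rw [iteratedDeriv_zero] at h0
    have h1 := hf.norm_trig_le (K := K) (by omega) hD x
    refine (norm_add_le _ _).trans ?_
    rw [Complex.norm_real, Real.norm_eq_abs]
    linarith
  have hk : ∀ k ∈ box K, bra k ^ 0 * ‖truncResidual K f k‖
      ≤ K / 2 * (W / ((K : ℝ) + 1) ^ (r - 1) * (2 * W)) := fun k hk => by
    rw [pow_zero, one_mul, truncResidual, norm_mul, norm_neg, norm_div, norm_mul, Complex.norm_I,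
      one_mul, norm_intCast_complex, Complex.norm_ofNat]
    have hk' : |(k : ℝ)| ≤ K := by rw [mem_box] at hk; exact_mod_cast hk
    exact mul_le_mul (by linarith) (norm_coef_le hb k) (norm_nonneg _) (by positivity)
  refine (Finset.sum_le_sum hk).trans ?_
  rw [Finset.sum_const, nsmul_eq_mul]
  have hcard : ((box K).card : ℝ) = 2 * K + 1 := by
    have : (box K).card = 2 * K + 1 := by
      rw [box, Int.card_Icc]; omega
    rw [this]; push_cast; ring
  rw [hcard]
  have e : ((K : ℝ) + 1) ^ (r - 1) = ((K : ℝ) + 1) ^ (r - 3) * ((K : ℝ) + 1) ^ 2 := by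
    rw [← pow_add]; congr 1; omega
  rw [e, le_div_iff₀ (by positivity)]
  have e2 : (2 * (K : ℝ) + 1) * (K / 2 * (W / (((K : ℝ) + 1) ^ (r - 3) * ((K : ℝ) + 1) ^ 2)
      * (2 * W))) * ((K : ℝ) + 1) ^ (r - 3)
      = W ^ 2 * ((2 * (K : ℝ) + 1) * K / ((K : ℝ) + 1) ^ 2) := by
    field_simp
  rw [e2]
  have h2 : (2 * (K : ℝ) + 1) * K / ((K : ℝ) + 1) ^ 2 ≤ 2 := by
    rw [div_le_iff₀ (by positivity)]
    nlinarith [Nat.cast_nonneg (α := ℝ) K]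
  nlinarith [sq_nonneg W]

lemma IsSolution.isApproxGalerkin {r : ℕ} {u₀ : ℝ → ℝ} {u : ℝ → ℝ → ℝ}
    (h : IsSolution r u₀ u) (hr : 6 ≤ r) (K : ℕ) (T : ℝ) :
    IsApproxGalerkin K T (fun t => low K (fourierHat (u t))) fun t => truncResidual K (u t) where
  real _ _ := (isRealCoeff_fourierHat _).low
  support _ _ k hk := by simp [low, hk]
  cont k _ := continuousOn_low (h.continuousOn_fourierHat T k)
  deriv t ht k hk := by
    have h1 := h.hasDerivAt_fourierHat hr ht.1 k
    have hlow : ∀ j ∈ box K, low K (fourierHat (u t)) j = fourierHat (u t) j := fun j hj => by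
      rw [low, if_pos hj]
    have hd := HasDerivAt.low (N := K) (a := fun t => fourierHat (u t)) (a' := fun k =>
      disp k * fourierHat (u t) k - Complex.I * k / 2 * coef (fun x => (u t x : ℂ) ^ 2) k) h1
    refine hd.congr_deriv ?_
    have hc : Continuous fun x => (u t x : ℂ) ^ 2 :=
      (Complex.continuous_ofReal.comp (h.contDiff t ht.1.le).continuous).pow 2
    rw [hlow k hk, bil_congr hlow hlow, low, if_pos hk, truncResidual,
      coef_sub (g := fun x => trig K (fourierHat (u t)) x ^ 2) (hc.intervalIntegrable _ _) (((continuous_trig _ _).pow 2).intervalIntegrable _ _),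
      bil, ← coef_trig_mul_trig]
    simp only [sq]
    ring

lemma MemH.wnorm_low_le {r s K N : ℕ} {f : ℝ → ℝ} {D : ℝ} (hf : MemH r f) (hs : s + 1 ≤ r)
    (hD : sobolevSq r f ≤ D) : wnorm K s (low N (fourierHat f)) ≤ embConst r D :=
  (wnorm_le_of_norm_le fun k _ => norm_low_le N _ k).trans (hf.sum_bra_le hs hD (box K))

lemma IsSolution.fourierHat_zero {r : ℕ} {u₀ : ℝ → ℝ} {u : ℝ → ℝ → ℝ} (h : IsSolution r u₀ u)
    (k : ℤ) : fourierHat (u 0) k = fourierHat u₀ k := by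
  unfold fourierHat
  rw [fourierCoeffOn_congr_ae]
  refine ae_restrict_of_ae ?_
  filter_upwards [h.initial] with x hx
  rw [hx]

/-! ### Uniqueness and a bound common to all solutions. -/

/-- Uniqueness of solutions, in terms of Fourier coefficients. -/
lemma IsSolution.fourierHat_unique {r : ℕ} (hr : 6 ≤ r) {u₀ : ℝ → ℝ} {u v : ℝ → ℝ → ℝ}
    (hu : IsSolution r u₀ u) (hv : IsSolution r u₀ v) {t : ℝ} (ht : 0 ≤ t) (k : ℤ) :
    fourierHat (u t) k = fourierHat (v t) k := by
  obtain ⟨D₁, hD₁⟩ := hu.exists_sobolevSq_bound t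
  obtain ⟨D₂, hD₂⟩ := hv.exists_sobolevSq_bound t
  set D := max D₁ D₂
  have hDu := fun s hs => (hD₁ s hs).trans (le_max_left D₁ D₂)
  have hDv := fun s hs => (hD₂ s hs).trans (le_max_right D₁ D₂)
  set W := embConst r D
  have hW : 0 ≤ W := Real.sqrt_nonneg _
  obtain ⟨C, hC, hcmp⟩ := exists_comparison_bound (W + 2 * W ^ 2 + 1) t (by positivity)
  have hK : ∀ K : ℕ, k ∈ box K →
      ‖fourierHat (u t) k - fourierHat (v t) k‖ ≤ C * (2 * W ^ 2 * (1 / ((K : ℝ) + 1))) := by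
    intro K hkK
    have hK1 : (1 : ℝ) ≤ (K : ℝ) + 1 := by linarith [Nat.cast_nonneg (α := ℝ) K]
    have hres : 2 * W ^ 2 / ((K : ℝ) + 1) ^ (r - 3) ≤ 2 * W ^ 2 * (1 / ((K : ℝ) + 1)) := by
      rw [mul_one_div]
      gcongr
      exact le_self_pow₀ hK1 (by omega)
    have hδ0 : 0 ≤ 2 * W ^ 2 * (1 / ((K : ℝ) + 1)) := by positivity
    have hδ : 2 * W ^ 2 * (1 / ((K : ℝ) + 1)) ≤ W + 2 * W ^ 2 + 1 := by
      have : 1 / ((K : ℝ) + 1) ≤ 1 := (div_le_one (by positivity)).2 hK1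
      nlinarith [sq_nonneg W]
    -- Both solutions are truncated at the same `K`, so there is no high part and `δ` only has to
    -- dominate the residuals, which tend to zero with `K → ∞`.
    have hhigh : ∀ f : ℤ → ℂ, l2 K (high K f) = 0 := fun f => by
      rw [l2, Finset.sum_eq_zero fun k hk => by simp [high, hk], Real.sqrt_zero]
    have h := hcmp K K (2 * W ^ 2 * (1 / ((K : ℝ) + 1))) _ _ _ _ le_rfl hδ
      (hv.isApproxGalerkin hr K t) (hu.isApproxGalerkin hr K t)
      (fun s hs => ((hv.memH s hs.1).wnorm_low_le (by omega) (hDv s hs)).trans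
        (by linarith [sq_nonneg W]))
      (fun s hs => ((hu.memH s hs.1).wnorm_low_le (by omega) (hDu s hs)).trans
        (by linarith [sq_nonneg W]))
      (fun s _ => by rw [hhigh]; exact hδ0)
      (fun s hs => ((hv.memH s hs.1).wnorm_truncResidual_le (by omega)
        (hv.contDiff s hs.1).continuous (hDv s hs) K).trans hres)
      (fun s hs => ((hu.memH s hs.1).wnorm_truncResidual_le (by omega)
        (hu.contDiff s hs.1).continuous (hDu s hs) K).trans hres)
      (fun s _ => by rw [hhigh]; exact hδ0)
      (fun j _ => by simp only [low, hu.fourierHat_zero, hv.fourierHat_zero])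
      t ⟨ht, le_rfl⟩
    have h1 := (norm_le_l2 (fun k => low K (fourierHat (u t)) k - low K (fourierHat (v t)) k)
      hkK).trans h
    simpa only [low, if_pos hkK] using h1
  have hlim : Tendsto (fun K : ℕ => C * (2 * W ^ 2 * (1 / ((K : ℝ) + 1)))) atTop (𝓝 0) := by
    have := (tendsto_one_div_add_atTop_nhds_zero_nat (𝕜 := ℝ)).const_mul (2 * W ^ 2)
    simpa using this.const_mul C
  have hle : ‖fourierHat (u t) k - fourierHat (v t) k‖ ≤ 0 := by
    refine ge_of_tendsto hlim ?_
    filter_upwards [eventually_ge_atTop k.natAbs] with K hKk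
    refine hK K (mem_box.2 ?_)
    rw [Int.abs_eq_natAbs]
    exact_mod_cast hKk
  exact sub_eq_zero.1 (norm_le_zero_iff.1 hle)

/-- A bound for all solutions with given initial data. -/
lemma exists_solution_bound {r : ℕ} (hr : 6 ≤ r) (u₀ : ℝ → ℝ) (T : ℝ) : ∃ D : ℝ, 0 ≤ D ∧
    ∀ u, IsSolution r u₀ u → ∀ t ∈ Set.Icc 0 T, sobolevSq r (u t) ≤ D := by
  -- By uniqueness any one solution supplies the bound for all of them; without a solution any
  -- constant works.
  by_cases hex : ∃ v, IsSolution r u₀ v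
  · obtain ⟨v, hv⟩ := hex
    obtain ⟨D, hD⟩ := hv.exists_sobolevSq_bound T
    refine ⟨|D|, abs_nonneg _, fun u hu t ht => ?_⟩
    have : sobolevSq r (u t) = sobolevSq r (v t) := by
      simp only [sobolevSq, hu.fourierHat_unique hr hv ht.1]
    rw [this]
    exact (hD t ht).trans (le_abs_self D)
  · exact ⟨0, le_rfl, fun u hu => (hex ⟨u, hu⟩).elim⟩

/-! ### Error of the semi-discretization. -/

lemma IsGalerkin.isApproxGalerkin {N : ℕ} {a : ℝ → ℤ → ℂ} (h : IsGalerkin N a)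
    (hs : ∀ t, 0 ≤ t → ∀ k ∉ box N, a t k = 0) (T : ℝ) :
    IsApproxGalerkin N T a fun _ _ => 0 where
  real t ht := h.real t ht.1
  support t ht := hs t ht.1
  cont k hk t ht := (h.deriv t ht.1 k hk).continuousWithinAt.mono Set.Icc_subset_Ici_self
  deriv t ht k hk := by
    rw [add_zero]
    exact (h.deriv t ht.1.le k hk).hasDerivAt (Ici_mem_nhds ht.1)

lemma MemH.l2_high_le {r N : ℕ} {f : ℝ → ℝ} {D : ℝ} (hf : MemH r f) (hN : 1 ≤ N)
    (hD : sobolevSq r f ≤ D) (K : ℕ) :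
    l2 K (high N (fourierHat f)) ≤ Real.sqrt D * (1 / (N : ℝ) ^ r) := by
  have hN' : (0 : ℝ) < N := by exact_mod_cast hN
  have hD0 : 0 ≤ D := (sobolevSq_nonneg r f).trans hD
  refine Real.sqrt_le_iff.2 ⟨by positivity, ?_⟩
  rw [mul_pow, Real.sq_sqrt hD0]
  have h1 : ∀ k ∈ box K, ‖high N (fourierHat f) k‖ ^ 2
      ≤ (1 / (N : ℝ) ^ r) ^ 2 * ((1 + (k : ℝ) ^ 2) ^ r * ‖fourierHat f k‖ ^ 2) := fun k _ => by
    rw [high]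
    split_ifs with hk
    · rw [norm_zero, zero_pow two_ne_zero]; positivity
    · rw [← mul_assoc]
      refine le_mul_of_one_le_left (sq_nonneg _) ?_
      rw [one_div, inv_pow, inv_mul_eq_div, one_le_div (by positivity), ← pow_mul, mul_comm r 2,
        pow_mul]
      refine pow_le_pow_left₀ (by positivity) ?_ r
      rw [mem_box, not_le] at hk
      have h2 : (N : ℝ) ≤ |(k : ℝ)| := by exact_mod_cast hk.le
      nlinarith [sq_abs (k : ℝ)]
  refine (Finset.sum_le_sum h1).trans ?_
  rw [← Finset.mul_sum, mul_comm D]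
  exact mul_le_mul_of_nonneg_left ((hf.summable.sum_le_tsum _ fun k _ => by positivity).trans hD)
    (by positivity)

/-- Outside the box `N^r ≤ bra^(r+1)`: the smoothing weight gives two powers and the algebra norm of
`b` gives `r - 1`. -/
lemma l2_high_conv_le {N K r : ℕ} (hN : 1 ≤ N) (hr : 1 ≤ r) (b : ℤ → ℂ) :
    l2 K (high N fun k => (((bra k ^ 2)⁻¹ : ℝ) : ℂ) * conv K b b k)
      ≤ wnorm K (r - 1) b ^ 2 * (1 / (N : ℝ) ^ r) := by
  have hN' : (1 : ℝ) ≤ N := by exact_mod_cast hN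
  refine (l2_le_wnorm K 0 _).trans ?_
  have h1 : ∀ k ∈ box K, bra k ^ 0 * ‖high N (fun k => (((bra k ^ 2)⁻¹ : ℝ) : ℂ) * conv K b b k) k‖
      ≤ (1 / (N : ℝ) ^ r) * (bra k ^ (r - 1) * ‖conv K b b k‖) := fun k _ => by
    have hb := bra_pos k
    rw [pow_zero, one_mul, high]
    split_ifs with hk
    · rw [norm_zero]; positivity
    · rw [norm_mul, Complex.norm_real, Real.norm_of_nonneg (by positivity), ← mul_assoc]
      refine mul_le_mul_of_nonneg_right ?_ (norm_nonneg _)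
      rw [one_div, inv_mul_eq_div, inv_eq_one_div, div_le_div_iff₀ (by positivity) (by positivity),
        one_mul, ← pow_add]
      have h2 : (N : ℝ) ≤ bra k := by linarith [bra_ge_of_notMem_box hk]
      exact (pow_le_pow_left₀ (by positivity) h2 r).trans
        (pow_le_pow_right₀ (one_le_bra k) (by omega))
  refine (Finset.sum_le_sum h1).trans ?_
  rw [← Finset.mul_sum, mul_comm, sq]
  exact mul_le_mul_of_nonneg_right (wnorm_conv_le K (r - 1) b b) (by positivity)

/-- Optimal order convergence of the semi-discretization. -/
lemma exists_semiDiscrete_error_bound {r : ℕ} (hr : 6 ≤ r) {u₀ : ℝ → ℝ} (hu₀ : MemH r u₀)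
    {A : ℝ} (T D : ℝ) (hA : 0 < A) : ∃ C : ℝ, 0 < C ∧
    ∀ (N : ℕ) (U u : ℝ → ℝ → ℝ), 1 ≤ N → IsSemiDiscrete N u₀ U →
      (∀ t ∈ Set.Icc 0 T, wnorm N 1 (fourierHat (U t)) ≤ A) → IsSolution r u₀ u →
      (∀ t ∈ Set.Icc 0 T, sobolevSq r (u t) ≤ D) → ∀ t ∈ Set.Icc 0 T,
        l2 N (fun k => fourierHat (u t) k - fourierHat (U t) k) ≤ C * (1 / (N : ℝ) ^ r) := by
  set W := embConst r D
  have hW : 0 ≤ W := Real.sqrt_nonneg _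
  set B := Real.sqrt D + 2 * W ^ 2
  have hB : 0 ≤ B := by positivity
  obtain ⟨C, hC, hcmp⟩ := exists_comparison_bound (A + W + B) T (by positivity)
  refine ⟨C * B + 1, by positivity, fun N U u hN hU hUA hu hD t ht => ?_⟩
  have hN' : (1 : ℝ) ≤ N := by exact_mod_cast hN
  set ε : ℝ := 1 / (N : ℝ) ^ r
  have hε0 : 0 ≤ ε := by positivity
  have hε1 : ε ≤ 1 := (div_le_one (by positivity)).2 (one_le_pow₀ hN')
  have hsupp : ∀ t, 0 ≤ t → ∀ k ∉ box N, fourierHat (U t) k = 0 := fun t ht k hk =>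
    (hU.mem t ht).fourierHat_eq_zero hk
  -- The comparison truncation is `K = N²`; since `r ≤ 2(r - 3)` for `r ≥ 6`, its residual is below
  -- `N^{-r}` up to a constant.
  have hNK : N ≤ N ^ 2 := Nat.le_self_pow two_ne_zero N
  have hWB : W ^ 2 ≤ B := by
    have := Real.sqrt_nonneg D
    simp only [B]; linarith [sq_nonneg W]
  have hres : 2 * W ^ 2 / (((N ^ 2 : ℕ) : ℝ) + 1) ^ (r - 3) ≤ B * ε := by
    have h1 : (N : ℝ) ^ r ≤ (((N ^ 2 : ℕ) : ℝ) + 1) ^ (r - 3) := by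
      calc (N : ℝ) ^ r ≤ (N : ℝ) ^ (2 * (r - 3)) := pow_le_pow_right₀ hN' (by omega)
        _ = ((N : ℝ) ^ 2) ^ (r - 3) := pow_mul _ _ _
        _ ≤ _ := by
          push_cast
          exact pow_le_pow_left₀ (by positivity) (by linarith) _
    calc _ ≤ 2 * W ^ 2 / (N : ℝ) ^ r := by gcongr
      _ = 2 * W ^ 2 * ε := by rw [← mul_one_div]
      _ ≤ _ := by
        refine mul_le_mul_of_nonneg_right ?_ hε0
        simp only [B]; linarith [Real.sqrt_nonneg D]
  have hlh : ∀ s, high N (low (N ^ 2) (fourierHat (u s))) = fun k =>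
      low (N ^ 2) (high N (fourierHat (u s))) k := fun s => by
    funext k; simp only [high, low]; split_ifs <;> rfl
  have h := hcmp N (N ^ 2) (B * ε) _ _ _ _ hNK (by nlinarith) (hU.isGalerkin.isApproxGalerkin hsupp T)
    (hu.isApproxGalerkin hr (N ^ 2) T)
    (fun s hs => by
      rw [wnorm_eq_of_support hNK (hsupp s hs.1)]
      linarith [hUA s hs])
    (fun s hs => ((hu.memH s hs.1).wnorm_low_le (by omega) (hD s hs)).trans (by linarith))
    (fun s hs => by
      rw [hlh]
      refine (l2_le_of_norm_le fun k _ => norm_low_le _ _ k).trans ?_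
      refine ((hu.memH s hs.1).l2_high_le hN (hD s hs) _).trans ?_
      refine mul_le_mul_of_nonneg_right ?_ hε0
      simp only [B]; linarith [sq_nonneg W])
    (fun s _ => by
      have : wnorm (N ^ 2) 0 (fun _ => 0) = 0 := by simp [wnorm]
      rw [this]; positivity)
    (fun s hs => ((hu.memH s hs.1).wnorm_truncResidual_le (by omega)
        (hu.contDiff s hs.1).continuous (hD s hs) (N ^ 2)).trans hres)
    (fun s hs => by
      refine (l2_high_conv_le (r := r) hN (by omega) _).trans ?_
      refine mul_le_mul_of_nonneg_right (le_trans ?_ hWB) hε0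
      exact pow_le_pow_left₀ (wnorm_nonneg _ _ _)
        ((hu.memH s hs.1).wnorm_low_le (by omega) (hD s hs)) 2)
    (fun k hk => by
      rw [low, if_pos (box_mono hNK hk), hu.fourierHat_zero, hU.initial.fourierHat_eq hu₀ hk])
    t ht
  have e : l2 N (fun k => fourierHat (u t) k - fourierHat (U t) k)
      = l2 N (fun k => low (N ^ 2) (fourierHat (u t)) k - fourierHat (U t) k) :=
    l2_congr fun k hk => by rw [low, if_pos (box_mono hNK hk)]
  rw [e]
  refine h.trans ?_
  nlinarith

/-- The full error in terms of the low-frequency error. -/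
lemma MemH.l2Norm_sub_le {r N : ℕ} {f g : ℝ → ℝ} {D : ℝ} (hf : MemH r f) (hc : Continuous f)
    (hg : MemRealSN N g) (hN : 1 ≤ N) (hD : sobolevSq r f ≤ D) :
    l2Norm (fun x => f x - g x) ≤ Real.sqrt (2 * Real.pi) *
      (l2 N (fun k => fourierHat f k - fourierHat g k) + Real.sqrt D * (1 / (N : ℝ) ^ r)) := by
  have hD0 : 0 ≤ D := (sobolevSq_nonneg r f).trans hD
  have hN' : (0 : ℝ) < N := by exact_mod_cast hN
  have hfg : Continuous fun x => f x - g x := hc.sub hg.continuous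
  obtain ⟨hp, hs⟩ := l2Norm_eq_of_memLp (Continuous.memLp_Ioc hfg)
  rw [hp, Real.sqrt_mul (by positivity)]
  refine mul_le_mul_of_nonneg_left ?_ (Real.sqrt_nonneg _)
  have hl2 := l2_nonneg N (fun k => fourierHat f k - fourierHat g k)
  refine Real.sqrt_le_iff.2 ⟨by positivity, ?_⟩
  set x := l2 N (fun k => fourierHat f k - fourierHat g k)
  set y := Real.sqrt D * (1 / (N : ℝ) ^ r)
  have hy0 : 0 ≤ y := by positivity
  have hsub : ∀ k, fourierHat (fun x => f x - g x) k = fourierHat f k - fourierHat g k :=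
    fourierHat_sub hf.intervalIntegrable (Continuous.intervalIntegrable_ofReal hg.continuous _ _)
  have hbound : ∑' k, ‖fourierHat (fun x => f x - g x) k‖ ^ 2 ≤ x ^ 2 + y ^ 2 := by
    refine hs.tsum_le_of_sum_le fun S => ?_
    obtain ⟨K, hK⟩ : ∃ K : ℕ, S ∪ box N ⊆ box K := by
      refine ⟨(S ∪ box N).sup Int.natAbs, fun k hk => mem_box.2 ?_⟩
      rw [Int.abs_eq_natAbs]
      exact_mod_cast Finset.le_sup (f := Int.natAbs) hk
    have hNK : box N ⊆ box K := Finset.union_subset_right hK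
    calc _ ≤ ∑ k ∈ box K, ‖fourierHat (fun x => f x - g x) k‖ ^ 2 :=
          Finset.sum_le_sum_of_subset_of_nonneg (Finset.union_subset_left hK)
            fun _ _ _ => sq_nonneg _
      _ = ∑ k ∈ box K, ((if k ∈ box N then ‖fourierHat f k - fourierHat g k‖ ^ 2 else 0)
            + ‖high N (fourierHat f) k‖ ^ 2) := Finset.sum_congr rfl fun k _ => by
          rw [hsub, high]
          split_ifs with hk
          · simp
          · rw [hg.fourierHat_eq_zero hk]; simp
      _ = x ^ 2 + l2 K (high N (fourierHat f)) ^ 2 := by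
          rw [Finset.sum_add_distrib, l2_sq, l2_sq, Finset.sum_ite_mem,
            Finset.inter_eq_right.2 hNK]
      _ ≤ _ := by
          have := pow_le_pow_left₀ (l2_nonneg _ _) (hf.l2_high_le hN hD K) 2
          linarith
  nlinarith

end Kawahara

end

/-! ### Assembly of the two error bounds. -/

theorem mainTheorem3 :
    -- the scheme conserves the `L²` norm
    (∀ (N : ℕ) (τ : ℝ) (M : ℕ) (V : ℕ → ℝ → ℝ), 1 ≤ N → 0 < τ →
      Kawahara.IsCrankNicolson N τ M V →
        ∀ m, m ≤ M → Kawahara.l2Norm (V m) = Kawahara.l2Norm (V 0)) ∧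
    -- the error bounds
    (∀ (r : ℕ) (u₀ : ℝ → ℝ) (T : ℝ), 16 ≤ r → Kawahara.MemH r u₀ → 0 < T →
      ∃ C₁ : ℝ, 0 < C₁ ∧ ∃ C : ℝ, 0 < C ∧
        ∀ (N : ℕ) (τ : ℝ) (M : ℕ) (U : ℝ → ℝ → ℝ) (V : ℕ → ℝ → ℝ),
          1 ≤ N → 0 < τ → (M : ℝ) * τ = T → (N : ℝ) * τ ≤ C₁ →
          Kawahara.IsSemiDiscrete N u₀ U →
          Kawahara.IsCrankNicolson N τ M V → V 0 = U 0 →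
            (∀ m : ℕ, m ≤ M →
              Kawahara.l2Norm (fun x => V m x - U ((m : ℝ) * τ) x) ≤ C * τ ^ 2) ∧
            (∀ u : ℝ → ℝ → ℝ, Kawahara.IsSolution r u₀ u →
              ∀ m : ℕ, m ≤ M →
                Kawahara.l2Norm (fun x => u ((m : ℝ) * τ) x - V m x)
                  ≤ C * (1 / (N : ℝ) ^ r + τ ^ 2))) := by
  open Kawahara in
  refine ⟨fun N τ M V _ _ hV m hm => hV.l2Norm_eq hm, fun r u₀ T hr hu₀ hT => ?_⟩
  obtain ⟨A, hA, hU15⟩ := exists_semiDiscrete_bound hr hu₀ T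
  obtain ⟨C₂, hC₂, hcn⟩ := exists_cn_bound A T hA hT
  obtain ⟨D, hD0, hD⟩ := exists_solution_bound (r := r) (by omega) u₀ T
  obtain ⟨C₃, hC₃, hsd⟩ := exists_semiDiscrete_error_bound (r := r) (by omega) hu₀ T D hA
  set p := Real.sqrt (2 * Real.pi)
  have hp : 0 ≤ p := Real.sqrt_nonneg _
  have hpp : 0 < p := Real.sqrt_pos.2 (by positivity)
  have hsD := Real.sqrt_nonneg D
  -- Stability only needs `τ A ≤ 2`; since `N ≥ 1`, the condition `N τ ≤ 2 / A` implies it. The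
  -- factor `p` is the Parseval constant.
  refine ⟨2 / A, by positivity, p * (C₂ + C₃ + Real.sqrt D), by positivity, ?_⟩
  intro N τ M U V hN hτ hMT hNτ hU hV h0
  have hN' : (1 : ℝ) ≤ N := by exact_mod_cast hN
  have hτA : τ * A ≤ 2 := by
    rw [le_div_iff₀ hA] at hNτ
    nlinarith [mul_pos hτ hA]
  have hmem : ∀ m : ℕ, m ≤ M → (m : ℝ) * τ ∈ Set.Icc 0 T := fun m hm =>
    ⟨by positivity, by rw [← hMT]; gcongr⟩
  have herr := hcn N _ τ M _ hU.isGalerkin (hU15 N U hU) hτ hτA hMT hV.isCNCoeff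
    (fun k _ => by rw [h0])
  refine ⟨fun m hm => ?_, fun u hu m hm => ?_⟩
  · have hVm := hV.mem m hm
    have hUm := hU.mem _ (hmem m hm).1
    rw [(hVm.sub hUm).l2Norm_eq, mul_assoc]
    refine mul_le_mul_of_nonneg_left ?_ hp
    have e : fourierHat (fun x => V m x - U (m * τ) x)
        = fun k => fourierHat (V m) k - fourierHat (U (m * τ)) k :=
      funext (fourierHat_sub (Continuous.intervalIntegrable_ofReal hVm.continuous _ _)
        (Continuous.intervalIntegrable_ofReal hUm.continuous _ _))
    rw [e]
    refine (herr m hm).trans (mul_le_mul_of_nonneg_right ?_ (sq_nonneg τ))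
    linarith
  · have ht := hmem m hm
    have h1 := (hu.memH _ ht.1).l2Norm_sub_le (hu.contDiff _ ht.1).continuous (hV.mem m hm) hN
      (hD u hu _ ht)
    have h2 := hsd N U u hN hU (fun t ht => (wnorm_mono N (by norm_num) _).trans (hU15 N U hU t ht))
      hu (hD u hu) _ ht
    have h3 := herr m hm
    have h4 : l2 N (fun k => fourierHat (u (m * τ)) k - fourierHat (V m) k)
        ≤ l2 N (fun k => fourierHat (u (m * τ)) k - fourierHat (U (m * τ)) k)
          + l2 N (fun k => fourierHat (V m) k - fourierHat (U (m * τ)) k) := by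
      have h5 := l2_add_le N (fun k => fourierHat (u (m * τ)) k - fourierHat (U (m * τ)) k)
        (fun k => fourierHat (U (m * τ)) k - fourierHat (V m) k)
      have e1 : l2 N (fun k => fourierHat (U (m * τ)) k - fourierHat (V m) k)
          = l2 N (fun k => fourierHat (V m) k - fourierHat (U (m * τ)) k) :=
        l2_congr fun k _ => norm_sub_rev _ _
      rw [e1] at h5
      refine le_trans (le_of_eq ?_) h5
      congr 1; funext k; ring
    rw [mul_assoc]
    refine h1.trans (mul_le_mul_of_nonneg_left ?_ hp)
    have hε : 0 ≤ 1 / (N : ℝ) ^ r := by positivity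
    nlinarith [mul_nonneg hC₂.le hε, mul_nonneg hC₃.le (sq_nonneg τ),
      mul_nonneg hsD (sq_nonneg τ)]
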